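/- Let $n\ge 1$ and let $q:\mathbb R^{2n}\to\mathbb C$ be a complex-valued quadratic form with $\operatorname{Re} q\ge 0$. Let $Q$ be the symmetric matrix of $q$ in the canonical basis, $J=\begin{pmatrix}0&I_n\\-I_n&0\end{pmatrix}$, and let $F=JQ$ be the Hamilton map of $q$, with entrywise real and imaginary parts $\operatorname{Re}F$, $\operatorname{Im}F$. Let $$S=\bigcap_{j\ge 0}\operatorname{Ker}\big(\operatorname{Re}F\,(\operatorname{Im}F)^j\big)\cap\mathbb R^{2n}$$ be the singular space of $q$ and let $k_0\ge 0$ be the smallest integer such that $S=\bigcap_{j=0}^{k_0}\operatorname{Ker}\big(\operatorname{Re}F\,(\operatorname{Im}F)^j\big)\cap\mathbb R^{2n}$. For a quadratic form $p:\mathbb R^{2n}\to\mathbb C$ with matrix $P$ and $\operatorname{Re}p\ge0$, let $p^w=(x,-i\nabla)\,P\,(x,-i\nabla)^T$ be its Weyl quantization, with domain $\{u\in L^2(\mathbb R^n): p^wu\in L^2(\mathbb R^n)\}$, and let $(e^{-sp^w})_{s\ge0}$ be the strongly continuous contraction semigroup on $L^2(\mathbb R^n)$ generated by $-p^w$. Let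 $(a_t)_{t\in\mathbb R}$ be the family of the polar decomposition of $(e^{-tq^w})_{t\geq 0}$, that is, a family of non-negative quadratic forms $a_t:\mathbb R^{2n}\to\mathbb R_+$ depending analytically on $t\in\mathbb R$ such that, for some unitary operators $U_t$ on $L^2(\mathbb R^n)$ (metaplectic operators, for instance), $$e^{-tq^w}=e^{-ta_t^w}U_t\qquad\text{for all } t\ge 0,$$ where $e^{-ta_t^w}=e^{-sa_t^w}|_{s=t}$. Then $k_0\le 2n-1$, and there exist constants $0<T<1$ and $c>0$ such that for all $0\le t\le T$ and all $X\in\mathbb R^{2n}$, $$a_t(X)\ \ge\ c\sum_{j=0}^{k_0}t^{2j}\,\operatorname{Re}q\big((\operatorname{Im}F)^jX\big).$$ -/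

import Mathlib

open MeasureTheory Filter Topology
open scoped Matrix SchwartzMap LineDeriv

noncomputable section

namespace QuadraticSemigroup

/-- The phase space `ℝ²ⁿ`. A point is `X = (x, ξ)`: `Sum.inl j` indexes `x_j` and `Sum.inr j`
indexes `ξ_j`. -/
abbrev Phase (n : ℕ) := Fin n ⊕ Fin n → ℝ

/-- The complex Hilbert space `L²(ℝⁿ)`. -/
abbrev L2 (n : ℕ) := Lp ℂ 2 (volume : Measure (EuclideanSpace ℝ (Fin n)))

/-- Square matrices of size `2n`, in block form. -/
abbrev Mat (n : ℕ) (R : Type*) := Matrix (Fin n ⊕ Fin n) (Fin n ⊕ Fin n) R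

/-! ### Hamilton map, singular space, structural index -/

/-- The symmetric matrix `Q` of a complex-valued quadratic form `q` in the canonical basis. -/
def formMatrix {n : ℕ} (q : QuadraticMap ℝ (Phase n) ℂ) : Mat n ℂ :=
  Matrix.of fun i j => QuadraticMap.polar q (Pi.single i 1) (Pi.single j 1) / 2

/-- The symplectic matrix `J`, with blocks `0, I` in the first row and `-I, 0` in the second. -/
def symplJ (n : ℕ) : Mat n ℂ := Matrix.fromBlocks 0 1 (-1) 0

/-- The Hamilton map `F = J Q` of `q`. -/
def hamiltonMap {n : ℕ} (q : QuadraticMap ℝ (Phase n) ℂ) : Mat n ℂ := symplJ n * formMatrix q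

/-- The entrywise real part of the Hamilton map. -/
def reF {n : ℕ} (q : QuadraticMap ℝ (Phase n) ℂ) : Mat n ℝ := (hamiltonMap q).map Complex.re

/-- The entrywise imaginary part of the Hamilton map. -/
def imF {n : ℕ} (q : QuadraticMap ℝ (Phase n) ℂ) : Mat n ℝ := (hamiltonMap q).map Complex.im

/-- `Ker (Re F (Im F)^j) ∩ ℝ²ⁿ`. -/
def kerStep {n : ℕ} (q : QuadraticMap ℝ (Phase n) ℂ) (j : ℕ) : Submodule ℝ (Phase n) :=
  LinearMap.ker (Matrix.toLin' (reF q * imF q ^ j))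

/-- The singular space: the intersection of all the `Ker (Re F (Im F)^j) ∩ ℝ²ⁿ`, `j ≥ 0`. -/
def singularSpace {n : ℕ} (q : QuadraticMap ℝ (Phase n) ℂ) : Submodule ℝ (Phase n) :=
  ⨅ j : ℕ, kerStep q j

/-- The smallest `k ≥ 0` such that the kernels with `0 ≤ j ≤ k` already intersect in the
singular space. -/
def structuralIndex {n : ℕ} (q : QuadraticMap ℝ (Phase n) ℂ) : ℕ :=
  sInf {k : ℕ | singularSpace q = ⨅ j ∈ Finset.range (k + 1), kerStep q j}

/-- The infimum which defines the structural index is taken over a non-empty set, hence it is a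
minimum. -/
theorem structuralIndex_isLeast {n : ℕ} (q : QuadraticMap ℝ (Phase n) ℂ) :
    IsLeast {k : ℕ | singularSpace q = ⨅ j ∈ Finset.range (k + 1), kerStep q j}
      (structuralIndex q) := by
  have hne : {k : ℕ | singularSpace q = ⨅ j ∈ Finset.range (k + 1), kerStep q j}.Nonempty := by
    let f : ℕ →o (Submodule ℝ (Phase n))ᵒᵈ :=
      { toFun := fun k => OrderDual.toDual (⨅ j ∈ Finset.range (k + 1), kerStep q j)
        monotone' := by
          intro k l hkl
          refine OrderDual.toDual_le_toDual.2 ?_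
          refine le_iInf₂ fun j hj => iInf₂_le j ?_
          simp only [Finset.mem_range] at hj ⊢
          omega }
    obtain ⟨m, hm⟩ := IsArtinian.monotone_stabilizes f
    refine ⟨m, le_antisymm (le_iInf₂ fun j _ => iInf_le _ j) (le_iInf fun j => ?_)⟩
    have h : (⨅ i ∈ Finset.range (m + 1), kerStep q i)
        = ⨅ i ∈ Finset.range (max m j + 1), kerStep q i :=
      OrderDual.toDual.injective (hm (max m j) (le_max_left m j))
    rw [h]
    refine iInf₂_le j ?_
    simp only [Finset.mem_range]
    have := le_max_right m j
    omega
  exact ⟨Nat.sInf_mem hne, fun k hk => Nat.sInf_le hk⟩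

/-! ### Quadratic differential operators and the semigroups that they generate -/

/-- The operators `x_j` (multiplication) and `D_j = -i ∂_j` on tempered distributions on `ℝⁿ`. -/
def phaseOp {n : ℕ} : Fin n ⊕ Fin n →
    𝓢'(EuclideanSpace ℝ (Fin n), ℂ) → 𝓢'(EuclideanSpace ℝ (Fin n), ℂ)
  | Sum.inl j, u => TemperedDistribution.smulLeftCLM ℂ
      (fun x : EuclideanSpace ℝ (Fin n) => ((x j : ℝ) : ℂ)) u
  | Sum.inr j, u => (-Complex.I) • ∂_{EuclideanSpace.single j (1 : ℝ)} u

/-- The Weyl quantization of a quadratic form `q` with matrix `Q`, acting on tempered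
distributions: `q^w(x, D) = (x, D) Q (x, D)ᵀ = ∑ᵢⱼ Qᵢⱼ Zᵢ Zⱼ` with `Z = (x, D)`. -/
def weylOp {n : ℕ} (q : QuadraticMap ℝ (Phase n) ℂ)
    (u : 𝓢'(EuclideanSpace ℝ (Fin n), ℂ)) : 𝓢'(EuclideanSpace ℝ (Fin n), ℂ) :=
  ∑ i, ∑ j, formMatrix q i j • phaseOp i (phaseOp j u)

/-- `S t = e^{-t q^w}` for `t ≥ 0`: `S` is the strongly continuous contraction semigroup on
`L²(ℝⁿ)` whose generator is `-q^w`, where `q^w` has the domain `{u ∈ L² : q^w u ∈ L²}` and acts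
in the sense of tempered distributions. The values `S t`, `t < 0`, play no role. -/
structure IsSemigroupOf {n : ℕ} (q : QuadraticMap ℝ (Phase n) ℂ)
    (S : ℝ → L2 n →L[ℂ] L2 n) : Prop where
  zero : S 0 = ContinuousLinearMap.id ℂ (L2 n)
  add : ∀ s t : ℝ, 0 ≤ s → 0 ≤ t → S (s + t) = (S s).comp (S t)
  contraction : ∀ t : ℝ, 0 ≤ t → ‖S t‖ ≤ 1
  continuous : ∀ u : L2 n, ContinuousOn (fun t => S t u) (Set.Ici 0)
  /- `u` is in the domain of the generator, with value `-f`, if and only if `q^w u = f`. -/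
  generator : ∀ u f : L2 n,
    Tendsto (fun t : ℝ => (t : ℂ)⁻¹ • (S t u - u)) (𝓝[>] 0) (𝓝 (-f)) ↔
      weylOp q (Lp.toTemperedDistribution u) = Lp.toTemperedDistribution f

/-- A real-valued quadratic form, seen as a complex-valued one. -/
def toComplexForm {n : ℕ} (a : QuadraticForm ℝ (Phase n)) : QuadraticMap ℝ (Phase n) ℂ :=
  (Complex.ofRealCLM : ℝ →ₗ[ℝ] ℂ).compQuadraticMap a

/-- `(a_t)` is the family of quadratic forms in the polar decomposition of the semigroup generated
by `q^w`: the `a_t` are non-negative real quadratic forms, they depend analytically on `t ∈ ℝ`, and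
`e^{-t q^w} = e^{-t a_t^w} U_t` for all `t ≥ 0`, with unitary operators `U_t` on `L²(ℝⁿ)`.
Here `S s = e^{-s q^w}` and `E t s = e^{-s a_t^w}`, so that `e^{-t a_t^w} = E t t`. -/
structure IsPolarFamily {n : ℕ} (q : QuadraticMap ℝ (Phase n) ℂ)
    (a : ℝ → QuadraticForm ℝ (Phase n)) : Prop where
  nonneg : ∀ (t : ℝ) (X : Phase n), 0 ≤ a t X
  analytic : ∀ X : Phase n, AnalyticOnNhd ℝ (fun t => a t X) Set.univ
  polar : ∃ (S : ℝ → L2 n →L[ℂ] L2 n) (E : ℝ → ℝ → L2 n →L[ℂ] L2 n)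
      (U : ℝ → L2 n ≃ₗᵢ[ℂ] L2 n),
    IsSemigroupOf q S ∧ (∀ t : ℝ, 0 ≤ t → IsSemigroupOf (toComplexForm (a t)) (E t)) ∧
      ∀ t : ℝ, 0 ≤ t → ∀ u : L2 n, S t u = E t t (U t u)

end QuadraticSemigroup

end

/-! The unitary factor of the polar decomposition cancels in `S S* = E E*`, where `S = e^{-tq^w}`
and `E = e^{-ta_t^w}`. Both sides can be computed on Gaussians: the semigroup of an accretive form
moves a Gaussian by letting the complex Hamiltonian flow `e^{-2itJQ}` act on a frame of the positive
Lagrangian subspace attached to it, and the adjoint semigroup acts in the same way with `Q̄`.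
Gaussians with linear terms determine the frames, not only the subspaces. Hence, with `A` the matrix
of `a_t`, `e^{-2itJQ} e^{-2itJQ̄} = (e^{-2itJA})²` (`hflow_mul_hflow_eq`). From there on the
argument is finite-dimensional.

Along `Y' = -2iJQ̄Y` the quantity `Im (Y* J Y)` grows at the rate `4 Re (Y* Q Y)`, and its value at
time `t` depends only on the product above. So the energies dissipated on `[0, t]` from a real point
`X`, along the flow of `Q̄` and along the flow of `A`, are equal (`integral_energy_eq`).

For `A`, real and non-negative, the energy density grows at most exponentially, at a rate controlled
by the trace of `A`, which is bounded for `t ∈ [0, 1]`; the dissipated energy is at most `t e^{4K}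
a_t(X)` (`integral_energy_le`).

For `Q̄`, write `Re Q = Pᵀ P`. The flow is then `Y' = -2 (Im F Y + iJPᵀ (P Y))` and the density is
`|P Y|²`. After the rescaling `s = tσ`, the vector with entries `t^j P (Im F)^j Y`, `j ≤ k₀`, solves
a closed linear system, by the definition of `k₀`. This system is observable from its first entry
for every `t ∈ [0, 1]`, even `t = 0`, so compactness gives an observability constant uniform in `t`,
and the dissipated energy is at least `tδ ∑ t^{2j} Re q((Im F)^j X)` (`exists_le_integral_energy`).
Dividing by `t` ends the proof. The bound on `k₀` is the Cayley–Hamilton theorem. -/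

noncomputable section

namespace QuadraticSemigroup

/-! ### Strongly continuous contraction semigroups -/

section Semigroup

variable {H : Type*} [NormedAddCommGroup H] [InnerProductSpace ℂ H]

/-- A strongly continuous contraction semigroup, parametrized by `t ≥ 0`. -/
structure IsContractionSemigroup (S : ℝ → H →L[ℂ] H) : Prop where
  zero : S 0 = ContinuousLinearMap.id ℂ H
  add : ∀ s t : ℝ, 0 ≤ s → 0 ≤ t → S (s + t) = (S s).comp (S t)
  contraction : ∀ t : ℝ, 0 ≤ t → ‖S t‖ ≤ 1
  continuous : ∀ u : H, ContinuousOn (fun t => S t u) (Set.Ici 0)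

/-- Strong continuity becomes joint continuity because `S τ (v - v₀)` is no larger than `v - v₀`. -/
theorem IsContractionSemigroup.tendsto {S : ℝ → H →L[ℂ] H} (hS : IsContractionSemigroup S)
    {ι : Type*} {l : Filter ι} {τ : ι → ℝ} {τ₀ : ℝ} {v : ι → H} {v₀ : H}
    (hτ : Tendsto τ l (𝓝 τ₀)) (hpos : ∀ᶠ i in l, 0 ≤ τ i) (hτ₀ : 0 ≤ τ₀)
    (hv : Tendsto v l (𝓝 v₀)) : Tendsto (fun i => S (τ i) (v i)) l (𝓝 (S τ₀ v₀)) := by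
  have h1 : Tendsto (fun i => S (τ i) v₀) l (𝓝 (S τ₀ v₀)) :=
    (hS.continuous v₀ τ₀ hτ₀).tendsto.comp (tendsto_nhdsWithin_iff.2 ⟨hτ, hpos⟩)
  have h2 : Tendsto (fun i => S (τ i) (v i - v₀)) l (𝓝 0) := by
    refine squeeze_zero_norm' (a := fun i => ‖v i - v₀‖) ?_ ?_
    · filter_upwards [hpos] with i hi
      calc ‖S (τ i) (v i - v₀)‖ ≤ ‖S (τ i)‖ * ‖v i - v₀‖ := (S (τ i)).le_opNorm _
        _ ≤ 1 * ‖v i - v₀‖ := by gcongr; exact hS.contraction _ hi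
        _ = _ := one_mul _
    · simpa using (hv.sub_const v₀).norm
  have h3 := h1.add h2
  simp only [map_sub, add_sub_cancel, add_zero] at h3
  exact h3

/-- By the semigroup law, the slope from `s` to `r` is `S (t - r)` applied to the slope of `u` minus
the difference quotient of the semigroup at `u s`; joint continuity then passes to the limit. The
derivative is one-sided because the generator is a right limit, which is enough for the constancy
criterion used below. -/
theorem IsContractionSemigroup.hasDerivWithinAt_comp {S : ℝ → H →L[ℂ] H}
    (hS : IsContractionSemigroup S) {t s : ℝ} (hs : s < t) {u : ℝ → H} {u' f : H}
    (hu : HasDerivWithinAt u u' (Set.Ici s) s)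
    (hf : Tendsto (fun δ : ℝ => (δ : ℂ)⁻¹ • (S δ (u s) - u s)) (𝓝[>] 0) (𝓝 (-f))) :
    HasDerivWithinAt (fun r => S (t - r) (u r)) (S (t - s) (u' + f)) (Set.Ici s) s := by
  rw [hasDerivWithinAt_iff_tendsto_slope, Set.Ici_sdiff_left] at hu ⊢
  have hδ : Tendsto (fun r => r - s) (𝓝[>] s) (𝓝[>] 0) := by
    refine tendsto_nhdsWithin_iff.2 ⟨?_, ?_⟩
    · have : Tendsto (fun r : ℝ => r - s) (𝓝 s) (𝓝 (s - s)) :=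
        tendsto_id.sub_const s
      rw [sub_self] at this
      exact this.mono_left nhdsWithin_le_nhds
    · filter_upwards [self_mem_nhdsWithin] with r hr
      exact sub_pos.2 (Set.mem_Ioi.1 hr)
  have h1 := hu.sub (hf.comp hδ)
  rw [sub_neg_eq_add] at h1
  have hlt : ∀ᶠ r in 𝓝[>] s, r < t :=
    nhdsWithin_le_nhds (Iio_mem_nhds hs)
  have h2 := hS.tendsto (τ := fun r => t - r) (τ₀ := t - s) (l := 𝓝[>] s)
    (by
      have : Tendsto (fun r : ℝ => t - r) (𝓝 s) (𝓝 (t - s)) :=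
        tendsto_const_nhds.sub tendsto_id
      exact this.mono_left nhdsWithin_le_nhds)
    (hlt.mono fun r hr => by linarith) (by linarith) h1
  refine h2.congr' ?_
  filter_upwards [hlt, self_mem_nhdsWithin] with r hr hsr
  have hsr' : s < r := hsr
  have h3 : S (t - s) (u s) = S (t - r) (S (r - s) (u s)) := by
    have := hS.add (t - r) (r - s) (by linarith) (by linarith)
    rw [show t - r + (r - s) = t - s by ring] at this
    rw [this]; rfl
  have h4 : ∀ w : H, ((r - s : ℝ) : ℂ)⁻¹ • w = (r - s)⁻¹ • w := fun w => by
    rw [← Complex.ofReal_inv, Complex.coe_smul]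
  simp only [slope, vsub_eq_sub, Function.comp_apply, h4, h3, ← smul_sub]
  rw [(S (t - r)).map_smul_of_tower, ← map_sub]
  congr 2
  abel

/-- Uniqueness for the Cauchy problem: `r ↦ S (t - r) (u r)` has zero right derivative, and its
values at `0` and `t` are the two sides. -/
theorem IsContractionSemigroup.apply_eq_of_hasDerivAt {S : ℝ → H →L[ℂ] H}
    (hS : IsContractionSemigroup S) {u f : ℝ → H}
    (hu : ∀ s, 0 ≤ s → HasDerivAt u (-f s) s)
    (hf : ∀ s, 0 ≤ s →
      Tendsto (fun δ : ℝ => (δ : ℂ)⁻¹ • (S δ (u s) - u s)) (𝓝[>] 0) (𝓝 (-f s)))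
    {t : ℝ} (ht : 0 ≤ t) : S t (u 0) = u t := by
  have hc : ContinuousOn (fun r => S (t - r) (u r)) (Set.Icc 0 t) := by
    intro s hs
    refine hS.tendsto (τ := fun r => t - r) (τ₀ := t - s) ?_ ?_ (by linarith [hs.2]) ?_
    · exact (by fun_prop : Continuous fun r : ℝ => t - r).continuousWithinAt
    · filter_upwards [self_mem_nhdsWithin] with r hr
      linarith [hr.2]
    · exact (hu s hs.1).continuousAt.continuousWithinAt
  have h := constant_of_has_deriv_right_zero hc (fun s hs => by
    have := hS.hasDerivWithinAt_comp hs.2 (hu s hs.1).hasDerivWithinAt (hf s hs.1)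
    simpa using this) t ⟨ht, le_rfl⟩
  simp only [sub_self, sub_zero, hS.zero] at h
  exact h.symm

/-- Dual form of the uniqueness argument: `r ↦ ⟨S (t - r) u, φ r⟩` is constant. The relation `hg`
says that `g` is the formal adjoint of the generator applied to `φ`, so the generator of the adjoint
semigroup never has to be identified. -/
theorem IsContractionSemigroup.inner_apply_eq_of_hasDerivAt {S : ℝ → H →L[ℂ] H}
    (hS : IsContractionSemigroup S) {u f : H} {φ g : ℝ → H}
    (hf : Tendsto (fun δ : ℝ => (δ : ℂ)⁻¹ • (S δ u - u)) (𝓝[>] 0) (𝓝 (-f)))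
    (hφ : ∀ s, 0 ≤ s → HasDerivAt φ (-g s) s)
    (hg : ∀ τ s, 0 ≤ τ → 0 ≤ s → inner ℂ (S τ f) (φ s) = inner ℂ (S τ u) (g s))
    {t : ℝ} (ht : 0 ≤ t) : inner ℂ (S t u) (φ 0) = inner ℂ u (φ t) := by
  have hc : ContinuousOn (fun r => inner ℂ (S (t - r) u) (φ r)) (Set.Icc 0 t) := by
    intro s hs
    refine ContinuousWithinAt.inner (𝕜 := ℂ) ?_ (hφ s hs.1).continuousAt.continuousWithinAt
    refine hS.tendsto (τ := fun r => t - r) (τ₀ := t - s) ?_ ?_ (by linarith [hs.2])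
      tendsto_const_nhds
    · exact (by fun_prop : Continuous fun r : ℝ => t - r).continuousWithinAt
    · filter_upwards [self_mem_nhdsWithin] with r hr
      linarith [hr.2]
  have h := constant_of_has_deriv_right_zero hc (fun s hs => by
    have h1 := hS.hasDerivWithinAt_comp hs.2 (hasDerivWithinAt_const s (Set.Ici s) u) hf
    have h2 := h1.inner ℂ (hφ s hs.1).hasDerivWithinAt
    rw [zero_add, hg _ _ (by linarith [hs.2]) hs.1, inner_neg_right, neg_add_cancel] at h2
    exact h2) t ⟨ht, le_rfl⟩
  simp only [sub_self, sub_zero, hS.zero] at h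
  exact h.symm

/-- The generator commutes with the semigroup. -/
theorem IsContractionSemigroup.tendsto_apply {S : ℝ → H →L[ℂ] H}
    (hS : IsContractionSemigroup S) {u f : H}
    (hf : Tendsto (fun δ : ℝ => (δ : ℂ)⁻¹ • (S δ u - u)) (𝓝[>] 0) (𝓝 (-f)))
    {τ : ℝ} (hτ : 0 ≤ τ) :
    Tendsto (fun δ : ℝ => (δ : ℂ)⁻¹ • (S δ (S τ u) - S τ u)) (𝓝[>] 0) (𝓝 (-S τ f)) := by
  have h := ((S τ).continuous.tendsto _).comp hf
  rw [map_neg] at h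
  refine h.congr' ?_
  filter_upwards [self_mem_nhdsWithin] with δ hδ
  have h1 : S δ (S τ u) = S τ (S δ u) := by
    have e1 := hS.add δ τ (le_of_lt hδ) hτ
    have e2 := hS.add τ δ hτ (le_of_lt hδ)
    rw [add_comm, e2] at e1
    exact (DFunLike.congr_fun e1 u).symm
  simp [h1]

/-- Since `S = E U`, the factor `U U* = 1` drops out of `S S*`. Nothing but unitarity of `U` enters
the proof. -/
theorem comp_adjoint_eq_of_polar [CompleteSpace H] {S E : H →L[ℂ] H} {U : H ≃ₗᵢ[ℂ] H}
    (h : ∀ u, S u = E (U u)) :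
    S.comp (ContinuousLinearMap.adjoint S) = E.comp (ContinuousLinearMap.adjoint E) := by
  have hSE : S = E.comp (U.toContinuousLinearEquiv : H →L[ℂ] H) := by ext u; exact h u
  have hU : ∀ v, ContinuousLinearMap.adjoint (U.toContinuousLinearEquiv : H →L[ℂ] H) v
      = U.symm v := by
    intro v
    refine ext_inner_left ℂ fun w => ?_
    rw [ContinuousLinearMap.adjoint_inner_right]
    have := U.inner_map_map w (U.symm v)
    rw [U.apply_symm_apply] at this
    exact this
  rw [hSE, ContinuousLinearMap.adjoint_comp]
  ext u
  simp only [ContinuousLinearMap.comp_apply, hU]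
  congr 1
  exact U.apply_symm_apply _

end Semigroup

theorem IsSemigroupOf.isContractionSemigroup {n : ℕ} {q : QuadraticMap ℝ (Phase n) ℂ}
    {S : ℝ → L2 n →L[ℂ] L2 n} (hS : IsSemigroupOf q S) : IsContractionSemigroup S :=
  ⟨hS.zero, hS.add, hS.contraction, hS.continuous⟩

/-! ### Quadratic differential operators on Schwartz functions -/

theorem hasTemperateGrowth_coord {n : ℕ} (j : Fin n) :
    Function.HasTemperateGrowth (fun x : EuclideanSpace ℝ (Fin n) => ((x j : ℝ) : ℂ)) :=
  (Complex.ofRealCLM.comp (EuclideanSpace.proj j : EuclideanSpace ℝ (Fin n) →L[ℝ] ℝ)).hasTemperateGrowth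

/-- The operators `x_j` and `D_j = -i ∂_j` on Schwartz functions. -/
def phaseS {n : ℕ} : Fin n ⊕ Fin n →
    𝓢(EuclideanSpace ℝ (Fin n), ℂ) → 𝓢(EuclideanSpace ℝ (Fin n), ℂ)
  | Sum.inl j, f => SchwartzMap.smulLeftCLM ℂ
      (fun x : EuclideanSpace ℝ (Fin n) => ((x j : ℝ) : ℂ)) f
  | Sum.inr j, f => (-Complex.I) • ∂_{EuclideanSpace.single j (1 : ℝ)} f

/-- The operator `∑ᵢⱼ Qᵢⱼ Zᵢ Zⱼ`, `Z = (x, D)`, on Schwartz functions. -/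
def weylS {n : ℕ} (Q : Mat n ℂ) (f : 𝓢(EuclideanSpace ℝ (Fin n), ℂ)) :
    𝓢(EuclideanSpace ℝ (Fin n), ℂ) :=
  ∑ i, ∑ j, Q i j • phaseS i (phaseS j f)

theorem phaseS_inl_apply {n : ℕ} (j : Fin n) (f : 𝓢(EuclideanSpace ℝ (Fin n), ℂ))
    (x : EuclideanSpace ℝ (Fin n)) : phaseS (Sum.inl j) f x = (x j : ℂ) * f x := by
  simp [phaseS, SchwartzMap.smulLeftCLM_apply_apply (hasTemperateGrowth_coord j)]

theorem phaseS_inr_apply {n : ℕ} (j : Fin n) (f : 𝓢(EuclideanSpace ℝ (Fin n), ℂ))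
    (x : EuclideanSpace ℝ (Fin n)) : phaseS (Sum.inr j) f x =
      -Complex.I * fderiv ℝ f x (EuclideanSpace.single j 1) := by
  simp [phaseS, SchwartzMap.lineDerivOp_apply_eq_fderiv]

theorem phaseOp_toTemperedDistributionCLM {n : ℕ} (i : Fin n ⊕ Fin n)
    (f : 𝓢(EuclideanSpace ℝ (Fin n), ℂ)) :
    phaseOp i (f.toTemperedDistributionCLM _ _ volume)
      = (phaseS i f).toTemperedDistributionCLM _ _ volume := by
  cases i with
  | inl j =>
    ext g
    simp only [phaseOp, phaseS, TemperedDistribution.smulLeftCLM_apply_apply,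
      SchwartzMap.toTemperedDistributionCLM_apply_apply,
      SchwartzMap.smulLeftCLM_apply_apply (hasTemperateGrowth_coord j)]
    refine integral_congr_ae (Eventually.of_forall fun x => ?_)
    simp only [smul_eq_mul]; ring
  | inr j =>
    simp only [phaseOp, phaseS, map_smul]
    rw [TemperedDistribution.lineDerivOp_toTemperedDistributionCLM_eq]

theorem weylOp_toLp {n : ℕ} (q : QuadraticMap ℝ (Phase n) ℂ)
    (f : 𝓢(EuclideanSpace ℝ (Fin n), ℂ)) :
    weylOp q (Lp.toTemperedDistribution (f.toLp 2))
      = Lp.toTemperedDistribution ((weylS (formMatrix q) f).toLp 2) := by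
  simp only [Lp.toTemperedDistribution_toLp_eq, weylOp, weylS, map_sum, map_smul,
    phaseOp_toTemperedDistributionCLM]

/-- Complex conjugation on Schwartz functions. -/
def conjS {n : ℕ} (f : 𝓢(EuclideanSpace ℝ (Fin n), ℂ)) : 𝓢(EuclideanSpace ℝ (Fin n), ℂ) :=
  f.postcompCLM (𝕜 := ℝ) (Complex.conjCLE : ℂ →L[ℝ] ℂ)

@[simp]
theorem conjS_apply {n : ℕ} (f : 𝓢(EuclideanSpace ℝ (Fin n), ℂ))
    (x : EuclideanSpace ℝ (Fin n)) : conjS f x = star (f x) := by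
  simp [conjS]

theorem conjS_sum {n : ℕ} {ι : Type*} (s : Finset ι)
    (f : ι → 𝓢(EuclideanSpace ℝ (Fin n), ℂ)) :
    conjS (∑ i ∈ s, f i) = ∑ i ∈ s, conjS (f i) := by
  simp [conjS]

theorem conjS_smul {n : ℕ} (c : ℂ) (f : 𝓢(EuclideanSpace ℝ (Fin n), ℂ)) :
    conjS (c • f) = star c • conjS f := by
  ext x; simp

/-- `x_j` and `D_j` are formally self-adjoint. The pairing of distributions with test functions is
bilinear, so the conjugation turns it into the sesquilinear one, where the sign from integrating by
parts is absorbed by conjugating `-i`. -/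
theorem phaseOp_apply_conjS {n : ℕ} (i : Fin n ⊕ Fin n)
    (u : 𝓢'(EuclideanSpace ℝ (Fin n), ℂ)) (f : 𝓢(EuclideanSpace ℝ (Fin n), ℂ)) :
    phaseOp i u (conjS f) = u (conjS (phaseS i f)) := by
  cases i with
  | inl j =>
    simp only [phaseOp, TemperedDistribution.smulLeftCLM_apply_apply]
    congr 1
    ext x
    simp [SchwartzMap.smulLeftCLM_apply_apply (hasTemperateGrowth_coord j), phaseS_inl_apply]
  | inr j =>
    have h : conjS (phaseS (Sum.inr j) f)
        = (-Complex.I) • (-∂_{EuclideanSpace.single j (1 : ℝ)} (conjS f)) := by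
      ext x
      have h1 : fderiv ℝ (conjS f) x
          = (Complex.conjCLE : ℂ →L[ℝ] ℂ).comp (fderiv ℝ f x) := by
        have h2 : (conjS f : EuclideanSpace ℝ (Fin n) → ℂ) = fun x => Complex.conjCLE (f x) := by
          ext y; simp
        rw [h2]
        exact ((Complex.conjCLE : ℂ →L[ℝ] ℂ).hasFDerivAt.comp x f.differentiableAt.hasFDerivAt).fderiv
      simp [phaseS_inr_apply, SchwartzMap.lineDerivOp_apply_eq_fderiv, h1]
    rw [h, map_smul]
    rfl

/-- Moving `Zᵢ Zⱼ` onto the test function reverses the order of the factors and conjugates the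
coefficient, hence the conjugate transpose. -/
theorem weylOp_apply_conjS {n : ℕ} (q : QuadraticMap ℝ (Phase n) ℂ)
    (u : 𝓢'(EuclideanSpace ℝ (Fin n), ℂ)) (f : 𝓢(EuclideanSpace ℝ (Fin n), ℂ)) :
    weylOp q u (conjS f) = u (conjS (weylS (formMatrix q).conjTranspose f)) := by
  have h : weylOp q u (conjS f) = ∑ i, ∑ j, formMatrix q i j * phaseOp i (phaseOp j u) (conjS f) := by
    simp [weylOp]
  rw [h, weylS, Finset.sum_comm]
  simp only [conjS_sum, conjS_smul, map_sum, map_smul, phaseOp_apply_conjS,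
    Matrix.conjTranspose_apply, star_star, smul_eq_mul]

theorem inner_toLp {n : ℕ} (u : L2 n) (f : 𝓢(EuclideanSpace ℝ (Fin n), ℂ)) :
    inner ℂ u (f.toLp 2) = star (Lp.toTemperedDistribution u (conjS f)) := by
  rw [Lp.toTemperedDistribution_apply, L2.inner_def, ← starRingEnd_apply, ← integral_conj]
  refine integral_congr_ae ?_
  filter_upwards [f.coeFn_toLp 2 volume] with x hx
  rw [hx]
  simp

/-- The formal adjoint of `q^w` acts on Schwartz functions as `q̄^w`. -/
theorem inner_toLp_of_weylOp_eq {n : ℕ} {q : QuadraticMap ℝ (Phase n) ℂ} {u f : L2 n}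
    (h : weylOp q (Lp.toTemperedDistribution u) = Lp.toTemperedDistribution f)
    (φ : 𝓢(EuclideanSpace ℝ (Fin n), ℂ)) :
    inner ℂ f (φ.toLp 2) = inner ℂ u ((weylS (formMatrix q).conjTranspose φ).toLp 2) := by
  rw [inner_toLp, inner_toLp, ← h, weylOp_apply_conjS]

/-- A path of Schwartz functions which solves `∂_t u = -q^w u` in `L²` is the orbit of its initial
value. -/
theorem IsSemigroupOf.apply_toLp {n : ℕ} {q : QuadraticMap ℝ (Phase n) ℂ}
    {S : ℝ → L2 n →L[ℂ] L2 n} (hS : IsSemigroupOf q S)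
    {ψ : ℝ → 𝓢(EuclideanSpace ℝ (Fin n), ℂ)}
    (hψ : ∀ s, 0 ≤ s → HasDerivAt (fun r => ((ψ r).toLp 2 : L2 n))
      (-(weylS (formMatrix q) (ψ s)).toLp 2) s) {t : ℝ} (ht : 0 ≤ t) :
    S t ((ψ 0).toLp 2) = (ψ t).toLp 2 :=
  hS.isContractionSemigroup.apply_eq_of_hasDerivAt hψ
    (fun _ _ => (hS.generator _ _).2 (weylOp_toLp q _)) ht

/-- Tested against Schwartz functions `f`, which are dense: the orbit `S τ f` stays in the domain,
where `q^w` acts in the sense of distributions, so the operator can be moved onto the Schwartz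
function `ψ s`. -/
theorem IsSemigroupOf.adjoint_apply_toLp {n : ℕ} {q : QuadraticMap ℝ (Phase n) ℂ}
    {S : ℝ → L2 n →L[ℂ] L2 n} (hS : IsSemigroupOf q S)
    {ψ : ℝ → 𝓢(EuclideanSpace ℝ (Fin n), ℂ)}
    (hψ : ∀ s, 0 ≤ s → HasDerivAt (fun r => ((ψ r).toLp 2 : L2 n))
      (-(weylS (formMatrix q).conjTranspose (ψ s)).toLp 2) s) {t : ℝ} (ht : 0 ≤ t) :
    ContinuousLinearMap.adjoint (S t) ((ψ 0).toLp 2) = (ψ t).toLp 2 := by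
  have hd : Dense (Set.range (fun f : 𝓢(EuclideanSpace ℝ (Fin n), ℂ) => (f.toLp 2 : L2 n))) :=
    SchwartzMap.denseRange_toLpCLM (F := ℂ) (E := EuclideanSpace ℝ (Fin n)) (p := 2)
      (μ := volume) ENNReal.ofNat_ne_top
  refine hd.eq_of_inner_right ℂ ?_
  rintro _ ⟨f, rfl⟩
  rw [ContinuousLinearMap.adjoint_inner_right]
  have hf := (hS.generator _ _).2 (weylOp_toLp q f)
  exact hS.isContractionSemigroup.inner_apply_eq_of_hasDerivAt hf hψ
    (fun τ s hτ _ => inner_toLp_of_weylOp_eq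
      ((hS.generator _ _).1 (hS.isContractionSemigroup.tendsto_apply hf hτ)) _) ht

/-! ### Gaussians as Schwartz functions -/

theorem exists_pow_mul_exp_neg_mul_sq_le (N : ℕ) {ε : ℝ} (hε : 0 < ε) :
    ∃ K : ℝ, 0 ≤ K ∧ ∀ r : ℝ, 0 ≤ r → (1 + r) ^ N * Real.exp (-ε * r ^ 2) ≤ K := by
  -- From `(1 + r)^N ≤ N! e^{1 + r}` and `r - ε r² ≤ 1 / (4ε)`.
  refine ⟨N.factorial * Real.exp (1 + 1 / (4 * ε)), by positivity, fun r hr => ?_⟩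
  have h1 : (1 + r) ^ N ≤ N.factorial * Real.exp (1 + r) := by
    have := Real.pow_div_factorial_le_exp (1 + r) (by linarith) N
    rw [div_le_iff₀ (by positivity)] at this
    linarith
  calc (1 + r) ^ N * Real.exp (-ε * r ^ 2)
      ≤ N.factorial * Real.exp (1 + r) * Real.exp (-ε * r ^ 2) := by gcongr
    _ = N.factorial * Real.exp (1 + r + -ε * r ^ 2) := by rw [mul_assoc, ← Real.exp_add]
    _ ≤ _ := by
      gcongr ?_ * Real.exp ?_
      have h2 : 1 / (4 * ε) - r + ε * r ^ 2 = ε * (r - 1 / (2 * ε)) ^ 2 := by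
        field_simp; ring
      have : 0 ≤ ε * (r - 1 / (2 * ε)) ^ 2 := by positivity
      linarith

/-- Write `exp w = exp z · exp (w - z)` and translate: all derivatives at `z` are those at `0` times
`exp z`. -/
theorem norm_iteratedFDeriv_cexp (i : ℕ) (z : ℂ) :
    ‖iteratedFDeriv ℝ i Complex.exp z‖
      = Real.exp z.re * ‖iteratedFDeriv ℝ i Complex.exp 0‖ := by
  have h : Complex.exp = fun w => Complex.exp z • Complex.exp (w - z) := by
    ext w; rw [smul_eq_mul, ← Complex.exp_add]; congr 1; ring
  have hc : ContDiff ℝ i (fun w => Complex.exp (w - z)) :=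
    (Complex.contDiff_exp (𝕜 := ℝ)).comp (contDiff_id.sub contDiff_const)
  conv_lhs => rw [h]
  rw [iteratedFDeriv_const_smul_apply' hc.contDiffAt, iteratedFDeriv_comp_sub, sub_self,
    norm_smul, Complex.norm_exp]

/-- `exp ∘ p` is a Schwartz function if `p` has temperate growth and its real part goes to `-∞`
at least quadratically. -/
def expSchwartz {E : Type*} [NormedAddCommGroup E] [NormedSpace ℝ E] (p : E → ℂ)
    (hp : p.HasTemperateGrowth)
    (hre : ∃ C ε : ℝ, 0 < ε ∧ ∀ x, (p x).re ≤ C - ε * ‖x‖ ^ 2) : 𝓢(E, ℂ) where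
  toFun x := Complex.exp (p x)
  smooth' := Complex.contDiff_exp.comp hp.1
  decay' k n := by
    obtain ⟨C, ε, hε, hre⟩ := hre
    obtain ⟨l, D, hD, hl⟩ := hp.norm_iteratedFDeriv_le_uniform n
    set M : ℝ := ∑ i ∈ Finset.range (n + 1), ‖iteratedFDeriv ℝ i Complex.exp 0‖ with hM
    have hM0 : 0 ≤ M := Finset.sum_nonneg fun _ _ => norm_nonneg _
    obtain ⟨K, hK, hKr⟩ := exists_pow_mul_exp_neg_mul_sq_le (k + l * n) hε
    refine ⟨n.factorial * (Real.exp C * M) * (1 + D) ^ n * K, fun x => ?_⟩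
    have hx := norm_nonneg x
    -- Faà di Bruno estimate: it asks for the `i`-th derivative of `p` to be bounded by an `i`-th
    -- power. Replacing `D` by `1 + D` makes the base at least `1`, so that a first power is bounded
    -- by the `i`-th one.
    have h1 : ‖iteratedFDeriv ℝ n (Complex.exp ∘ p) x‖
        ≤ n.factorial * (Real.exp (p x).re * M) * ((1 + D) * (1 + ‖x‖) ^ l) ^ n := by
      refine norm_iteratedFDeriv_comp_le (N := ((n : ℕ∞) : WithTop ℕ∞))
        (Complex.contDiff_exp (𝕜 := ℝ)) (hp.1.of_le (by exact_mod_cast le_top)) le_rfl x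
        (fun i hi => ?_) (fun i hi1 hi => ?_)
      · rw [norm_iteratedFDeriv_cexp]
        gcongr
        exact Finset.single_le_sum (f := fun i => ‖iteratedFDeriv ℝ i Complex.exp (0 : ℂ)‖)
          (fun _ _ => norm_nonneg _) (Finset.mem_range.2 (by omega))
      · have h2 : 1 ≤ (1 + ‖x‖) ^ l := one_le_pow₀ (by linarith)
        have h3 : 1 ≤ (1 + D) * (1 + ‖x‖) ^ l := one_le_mul_of_one_le_of_one_le (by linarith) h2
        calc _ ≤ D * (1 + ‖x‖) ^ l := hl i hi x
          _ ≤ (1 + D) * (1 + ‖x‖) ^ l := by gcongr; linarith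
          _ ≤ _ := le_self_pow₀ h3 (by omega)
    calc ‖x‖ ^ k * ‖iteratedFDeriv ℝ n (Complex.exp ∘ p) x‖
        ≤ (1 + ‖x‖) ^ k * (n.factorial * (Real.exp (C - ε * ‖x‖ ^ 2) * M)
            * ((1 + D) * (1 + ‖x‖) ^ l) ^ n) := by
          refine mul_le_mul (by gcongr; linarith) (h1.trans ?_) (norm_nonneg _) (by positivity)
          gcongr
          exact hre x
      _ = n.factorial * (Real.exp C * M) * (1 + D) ^ n
            * ((1 + ‖x‖) ^ (k + l * n) * Real.exp (-ε * ‖x‖ ^ 2)) := by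
          rw [sub_eq_add_neg, Real.exp_add, neg_mul, mul_pow, pow_add, pow_mul]; ring
      _ ≤ _ := by gcongr; exact hKr _ hx

@[simp]
theorem expSchwartz_apply {E : Type*} [NormedAddCommGroup E] [NormedSpace ℝ E] (p : E → ℂ)
    (hp : p.HasTemperateGrowth)
    (hre : ∃ C ε : ℝ, 0 < ε ∧ ∀ x, (p x).re ≤ C - ε * ‖x‖ ^ 2) (x : E) :
    expSchwartz p hp hre x = Complex.exp (p x) := rfl

/-- Differentiability in `L²` of a family of Schwartz functions, from pointwise differentiability
and a square integrable Lipschitz bound. -/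
theorem hasDerivAt_toLp {n : ℕ} {F : ℝ → 𝓢(EuclideanSpace ℝ (Fin n), ℂ)}
    {g : 𝓢(EuclideanSpace ℝ (Fin n), ℂ)} {B : EuclideanSpace ℝ (Fin n) → ℝ} {t₀ : ℝ}
    (hB : Integrable (fun x => B x ^ 2))
    (hF : ∀ x, HasDerivAt (fun t => F t x) (g x) t₀)
    (hFB : ∀ᶠ t in 𝓝 t₀, ∀ x, ‖F t x - F t₀ x‖ ≤ |t - t₀| * B x) :
    HasDerivAt (fun t => ((F t).toLp 2 : L2 n)) (g.toLp 2) t₀ := by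
  have hsq : ∀ f : 𝓢(EuclideanSpace ℝ (Fin n), ℂ), ‖(f.toLp 2 : L2 n)‖ ^ 2 = ∫ x, ‖f x‖ ^ 2 := by
    intro f
    rw [SchwartzMap.norm_toLp' two_ne_zero ENNReal.ofNat_ne_top]
    have h0 : 0 ≤ ∫ x, ‖f x‖ ^ (2 : ENNReal).toReal := integral_nonneg fun x => by positivity
    rw [← Real.rpow_natCast, ← Real.rpow_mul h0]
    simp
  -- The pointwise derivative inherits the Lipschitz bound as a limit of slopes; hence `4 B²`
  -- dominates the squared error.
  have hgB : ∀ x, ‖g x‖ ≤ B x := fun x => by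
    have h1 := (hasDerivAt_iff_tendsto_slope.1 (hF x)).norm
    refine le_of_tendsto h1 ?_
    filter_upwards [nhdsWithin_le_nhds hFB, self_mem_nhdsWithin] with t ht hne
    have : 0 < |t - t₀| := abs_pos.2 (sub_ne_zero.2 hne)
    rw [slope_def_module, norm_smul, norm_inv, Real.norm_eq_abs, inv_mul_le_iff₀ this]
    exact ht x
  rw [hasDerivAt_iff_tendsto_slope, tendsto_iff_norm_sub_tendsto_zero]
  have key : Tendsto (fun t => ∫ x, ‖((t - t₀)⁻¹ • (F t - F t₀) - g) x‖ ^ 2) (𝓝[≠] t₀) (𝓝 0) := by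
    have h0 : (0 : ℝ) = ∫ _ : EuclideanSpace ℝ (Fin n), (0 : ℝ) := by simp
    rw [h0]
    refine tendsto_integral_filter_of_dominated_convergence (fun x => 4 * B x ^ 2) ?_ ?_
      (hB.const_mul 4) ?_
    · refine Eventually.of_forall fun t => ?_
      exact ((SchwartzMap.continuous _).norm.pow 2).aestronglyMeasurable
    · filter_upwards [nhdsWithin_le_nhds hFB, self_mem_nhdsWithin] with t ht hne
      refine Eventually.of_forall fun x => ?_
      have hpos : 0 < |t - t₀| := abs_pos.2 (sub_ne_zero.2 hne)
      have h1 : ‖(t - t₀)⁻¹ • (F t x - F t₀ x)‖ ≤ B x := by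
        rw [norm_smul, norm_inv, Real.norm_eq_abs, inv_mul_le_iff₀ hpos]
        exact ht x
      have h2 : ‖((t - t₀)⁻¹ • (F t - F t₀) - g) x‖ ≤ 2 * B x := by
        calc _ = ‖(t - t₀)⁻¹ • (F t x - F t₀ x) - g x‖ := by simp
          _ ≤ _ := (norm_sub_le _ _).trans (by linarith [hgB x])
      rw [Real.norm_of_nonneg (by positivity)]
      calc _ ≤ (2 * B x) ^ 2 := by gcongr
        _ = _ := by ring
    · refine Eventually.of_forall fun x => ?_
      have h1 := hasDerivAt_iff_tendsto_slope.1 (hF x)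
      have h2 := ((h1.sub_const (g x)).norm.pow 2)
      simp only [sub_self, norm_zero, ne_eq, OfNat.ofNat_ne_zero, not_false_eq_true, zero_pow]
        at h2
      exact h2
  have h3 := key.sqrt
  rw [Real.sqrt_zero] at h3
  refine h3.congr fun t => ?_
  rw [← hsq, Real.sqrt_sq (norm_nonneg _)]
  congr 1

/-- A real vector, seen as a complex one. -/
def cvec {n : ℕ} (x : EuclideanSpace ℝ (Fin n)) : Fin n → ℂ := fun j => (x j : ℂ)

/-- The exponent `(i/2) x·Zx + i m·x + κ` of a Gaussian. -/
def gaussExponent {n : ℕ} (Z : Matrix (Fin n) (Fin n) ℂ) (m : Fin n → ℂ) (κ : ℂ)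
    (x : EuclideanSpace ℝ (Fin n)) : ℂ :=
  Complex.I / 2 * (cvec x ⬝ᵥ Z *ᵥ cvec x) + Complex.I * (m ⬝ᵥ cvec x) + κ

/-- The imaginary part of the matrix `Z` is positive definite. -/
def ImPosDef {n : ℕ} (Z : Matrix (Fin n) (Fin n) ℂ) : Prop :=
  ∃ ε : ℝ, 0 < ε ∧ ∀ x : EuclideanSpace ℝ (Fin n), ε * ‖x‖ ^ 2 ≤ (cvec x ⬝ᵥ Z *ᵥ cvec x).im

theorem norm_cvec_apply_le {n : ℕ} (x : EuclideanSpace ℝ (Fin n)) (j : Fin n) :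
    ‖cvec x j‖ ≤ ‖x‖ := by
  simpa [cvec] using PiLp.norm_apply_le x j

theorem norm_dotProduct_cvec_le {n : ℕ} (m : Fin n → ℂ) (x : EuclideanSpace ℝ (Fin n)) :
    ‖m ⬝ᵥ cvec x‖ ≤ (∑ j, ‖m j‖) * ‖x‖ := by
  rw [Finset.sum_mul]
  refine (norm_sum_le _ _).trans (Finset.sum_le_sum fun j _ => ?_)
  rw [norm_mul]
  gcongr
  exact norm_cvec_apply_le x j

theorem norm_cvec_dotProduct_mulVec_le {n : ℕ} (Z : Matrix (Fin n) (Fin n) ℂ)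
    (x : EuclideanSpace ℝ (Fin n)) :
    ‖cvec x ⬝ᵥ Z *ᵥ cvec x‖ ≤ (∑ i, ∑ j, ‖Z i j‖) * ‖x‖ ^ 2 := by
  rw [Finset.sum_mul]
  refine (norm_sum_le _ _).trans (Finset.sum_le_sum fun i _ => ?_)
  rw [norm_mul]
  calc _ ≤ ‖x‖ * ((∑ j, ‖Z i j‖) * ‖x‖) := by
        gcongr
        · exact norm_cvec_apply_le x i
        · exact norm_dotProduct_cvec_le (Z i) x
    _ = _ := by ring

theorem gaussExponent_re_le {n : ℕ} {Z : Matrix (Fin n) (Fin n) ℂ} (hZ : ImPosDef Z)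
    (m : Fin n → ℂ) (κ : ℂ) :
    ∃ C ε : ℝ, 0 < ε ∧ ∀ x, (gaussExponent Z m κ x).re ≤ C - ε * ‖x‖ ^ 2 := by
  obtain ⟨ε, hε, h⟩ := hZ
  set M := ∑ j, ‖m j‖
  refine ⟨‖κ‖ + M ^ 2 / ε, ε / 4, by positivity, fun x => ?_⟩
  have h1 : (Complex.I * (m ⬝ᵥ cvec x)).re ≤ M * ‖x‖ := by
    refine (Complex.re_le_norm _).trans ?_
    rw [norm_mul, Complex.norm_I, one_mul]
    exact norm_dotProduct_cvec_le m x
  have h2 : (Complex.I / 2 * (cvec x ⬝ᵥ Z *ᵥ cvec x)).re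
      = -(cvec x ⬝ᵥ Z *ᵥ cvec x).im / 2 := by
    simp [Complex.mul_re]; ring
  have h3 := Complex.re_le_norm κ
  have h4 := h x
  have h5 : M * ‖x‖ ≤ M ^ 2 / ε + ε / 4 * ‖x‖ ^ 2 := by
    have : M ^ 2 / ε + ε / 4 * ‖x‖ ^ 2 - M * ‖x‖ = ε * (‖x‖ / 2 - M / ε) ^ 2 := by
      field_simp; ring
    have : 0 ≤ ε * (‖x‖ / 2 - M / ε) ^ 2 := by positivity
    linarith
  simp only [gaussExponent, Complex.add_re, h2]
  linarith

theorem gaussExponent_hasTemperateGrowth {n : ℕ} (Z : Matrix (Fin n) (Fin n) ℂ)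
    (m : Fin n → ℂ) (κ : ℂ) : (gaussExponent Z m κ).HasTemperateGrowth := by
  have hx := fun j : Fin n => hasTemperateGrowth_coord (n := n) j
  have h1 : Function.HasTemperateGrowth fun x : EuclideanSpace ℝ (Fin n) => m ⬝ᵥ cvec x :=
    Function.HasTemperateGrowth.sum fun j _ =>
      (Function.HasTemperateGrowth.const (m j)).mul (hx j)
  have h2 : Function.HasTemperateGrowth
      fun x : EuclideanSpace ℝ (Fin n) => cvec x ⬝ᵥ Z *ᵥ cvec x :=
    Function.HasTemperateGrowth.sum fun i _ => (hx i).mul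
      (show Function.HasTemperateGrowth fun x => (Z *ᵥ cvec x) i from
        Function.HasTemperateGrowth.sum (s := Finset.univ)
          (f := fun j (x : EuclideanSpace ℝ (Fin n)) => Z i j * cvec x j) fun j _ =>
          (Function.HasTemperateGrowth.const (Z i j)).mul (hx j))
  exact (((Function.HasTemperateGrowth.const _).mul h2).add
    ((Function.HasTemperateGrowth.const _).mul h1)).add (Function.HasTemperateGrowth.const κ)

open Classical in
/-- The Gaussian `exp ((i/2) x·Zx + i m·x + κ)`, for `Z` with positive definite imaginary part. -/
def gaussS {n : ℕ} (Z : Matrix (Fin n) (Fin n) ℂ) (m : Fin n → ℂ) (κ : ℂ) :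
    𝓢(EuclideanSpace ℝ (Fin n), ℂ) :=
  if hZ : ImPosDef Z then
    expSchwartz (gaussExponent Z m κ) (gaussExponent_hasTemperateGrowth Z m κ)
      (gaussExponent_re_le hZ m κ)
  -- The default value makes `gaussS` total, so that a path of matrices can be inserted without a
  -- proof of positivity at each time.
  else 0

theorem gaussS_apply {n : ℕ} {Z : Matrix (Fin n) (Fin n) ℂ} (hZ : ImPosDef Z) (m : Fin n → ℂ)
    (κ : ℂ) (x : EuclideanSpace ℝ (Fin n)) :
    gaussS Z m κ x = Complex.exp (gaussExponent Z m κ x) := by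
  rw [gaussS, dif_pos hZ, expSchwartz_apply]

theorem gaussExponent_sub {n : ℕ} (Z Z' : Matrix (Fin n) (Fin n) ℂ) (m m' : Fin n → ℂ)
    (κ κ' : ℂ) (x : EuclideanSpace ℝ (Fin n)) :
    gaussExponent Z m κ x - gaussExponent Z' m' κ' x
      = gaussExponent (Z - Z') (m - m') (κ - κ') x := by
  simp only [gaussExponent, Matrix.sub_mulVec, dotProduct_sub, sub_dotProduct]
  ring

theorem norm_gaussExponent_le {n : ℕ} (Z : Matrix (Fin n) (Fin n) ℂ) (m : Fin n → ℂ) (κ : ℂ)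
    (x : EuclideanSpace ℝ (Fin n)) :
    ‖gaussExponent Z m κ x‖
      ≤ ((∑ i, ∑ j, ‖Z i j‖) + (∑ j, ‖m j‖) + ‖κ‖) * (1 + ‖x‖) ^ 2 := by
  have h1 := norm_cvec_dotProduct_mulVec_le Z x
  have h2 := norm_dotProduct_cvec_le m x
  set a := ∑ i, ∑ j, ‖Z i j‖
  set b := ∑ j, ‖m j‖
  have ha : 0 ≤ a := Finset.sum_nonneg fun _ _ => Finset.sum_nonneg fun _ _ => norm_nonneg _
  have hb : 0 ≤ b := Finset.sum_nonneg fun _ _ => norm_nonneg _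
  have hx := norm_nonneg x
  have hk := norm_nonneg κ
  have h3 : ‖Complex.I / 2 * (cvec x ⬝ᵥ Z *ᵥ cvec x)‖ ≤ a * ‖x‖ ^ 2 := by
    rw [norm_mul]
    calc _ ≤ 1 * (a * ‖x‖ ^ 2) := by
          gcongr
          simp; norm_num
      _ = _ := one_mul _
  have h4 : ‖Complex.I * (m ⬝ᵥ cvec x)‖ ≤ b * ‖x‖ := by simpa using h2
  calc _ ≤ a * ‖x‖ ^ 2 + b * ‖x‖ + ‖κ‖ := by
        refine (norm_add_le _ _).trans ?_
        gcongr
        exact (norm_add_le _ _).trans (add_le_add h3 h4)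
    _ ≤ a * (1 + ‖x‖) ^ 2 + b * (1 + ‖x‖) ^ 2 + ‖κ‖ * (1 + ‖x‖) ^ 2 := by
        gcongr
        · linarith
        · nlinarith
        · nlinarith
    _ = _ := by ring

theorem integrable_exp_neg_mul_sq_norm {n : ℕ} {b : ℝ} (hb : 0 < b) :
    Integrable fun x : EuclideanSpace ℝ (Fin n) => Real.exp (-b * ‖x‖ ^ 2) := by
  have h := (GaussianFourier.integrable_cexp_neg_mul_sq_norm_add (b := (b : ℂ))
    (by simpa using hb) 0 (0 : EuclideanSpace ℝ (Fin n))).re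
  refine h.congr (Eventually.of_forall fun x => ?_)
  have : (-(b : ℂ) * (‖x‖ : ℂ) ^ 2) = ((-b * ‖x‖ ^ 2 : ℝ) : ℂ) := by push_cast; ring
  simp only [zero_mul, add_zero, this]
  exact Complex.exp_ofReal_re _

/-- Differentiability in `L²` of a family of Gaussians whose parameters are differentiable. -/
theorem hasDerivAt_gaussS_toLp {n : ℕ} {Z : ℝ → Matrix (Fin n) (Fin n) ℂ}
    {Z' : Matrix (Fin n) (Fin n) ℂ} {m : ℝ → Fin n → ℂ} {m' : Fin n → ℂ} {κ : ℝ → ℂ} {κ' : ℂ}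
    {t₀ : ℝ} (hZ : ∀ i j, HasDerivAt (fun t => Z t i j) (Z' i j) t₀)
    (hm : ∀ j, HasDerivAt (fun t => m t j) (m' j) t₀) (hκ : HasDerivAt κ κ' t₀)
    (hpos : ImPosDef (Z t₀)) {g : 𝓢(EuclideanSpace ℝ (Fin n), ℂ)}
    (hg : ∀ x, g x = gaussExponent Z' m' κ' x * gaussS (Z t₀) (m t₀) (κ t₀) x) :
    HasDerivAt (fun t => ((gaussS (Z t) (m t) (κ t)).toLp 2 : L2 n)) (g.toLp 2) t₀ := by
  -- `ω t` measures the displacement of all the parameters; the two exponents differ by at most `ω t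
  -- (1 + ‖x‖)²`, and `ω` is Lipschitz at `t₀`.
  set ω : ℝ → ℝ := fun t => (∑ i, ∑ j, ‖(Z t - Z t₀) i j‖) + (∑ j, ‖(m t - m t₀) j‖)
    + ‖κ t - κ t₀‖ with hω
  have hω0 : ∀ t, 0 ≤ ω t := fun t => by positivity
  have hωO : ω =O[𝓝 t₀] fun t => t - t₀ := by
    refine ((Asymptotics.IsBigO.fun_sum fun i _ => Asymptotics.IsBigO.fun_sum fun j _ => ?_).add
      (Asymptotics.IsBigO.fun_sum fun j _ => ?_)).add ?_
    · exact (hZ i j).isBigO_sub.norm_left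
    · exact (hm j).isBigO_sub.norm_left
    · exact hκ.isBigO_sub.norm_left
  obtain ⟨c, hc, hωc⟩ := hωO.exists_pos
  have hωt : Tendsto ω (𝓝 t₀) (𝓝 0) := by
    refine hωO.trans_tendsto ?_
    have : Tendsto (fun t : ℝ => t - t₀) (𝓝 t₀) (𝓝 (t₀ - t₀)) := tendsto_id.sub_const t₀
    rwa [sub_self] at this
  obtain ⟨C, ε, hε, hre⟩ := gaussExponent_re_le hpos (m t₀) (κ t₀)
  -- Positivity is an open condition, so the default value of `gaussS` does not occur near `t₀`.
  have hposE : ∀ᶠ t in 𝓝 t₀, ImPosDef (Z t) := by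
    obtain ⟨δ, hδ, h⟩ := hpos
    filter_upwards [hωt.eventually (gt_mem_nhds (half_pos hδ))] with t ht
    refine ⟨δ / 2, half_pos hδ, fun x => ?_⟩
    have h1 : (cvec x ⬝ᵥ Z t *ᵥ cvec x).im = (cvec x ⬝ᵥ Z t₀ *ᵥ cvec x).im
        + (cvec x ⬝ᵥ (Z t - Z t₀) *ᵥ cvec x).im := by
      rw [← Complex.add_im, Matrix.sub_mulVec, dotProduct_sub]
      congr 1; ring
    have h2 := (abs_le.1 ((Complex.abs_im_le_norm _).trans
      (norm_cvec_dotProduct_mulVec_le (Z t - Z t₀) x))).1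
    have h3 : (∑ i, ∑ j, ‖(Z t - Z t₀) i j‖) ≤ δ / 2 := by
      refine le_trans ?_ ht.le
      rw [hω]
      have : 0 ≤ (∑ j, ‖(m t - m t₀) j‖) + ‖κ t - κ t₀‖ := by positivity
      simp only
      linarith
    have h4 : (∑ i, ∑ j, ‖(Z t - Z t₀) i j‖) * ‖x‖ ^ 2 ≤ δ / 2 * ‖x‖ ^ 2 := by gcongr
    rw [h1]
    linarith [h x]
  obtain ⟨K, hK, hKr⟩ := exists_pow_mul_exp_neg_mul_sq_le 4 (half_pos hε)
  -- The bound comes from `|e^a - e^b| ≤ e^{Re b} |a - b| e^{|a - b|}`: once `ω ≤ ε / 4`, the last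
  -- factor is at most `e^{ε/2 + ε‖x‖²/2}` and costs half of the decay `-ε‖x‖²`. In `B²`, one of the
  -- two remaining Gaussian factors absorbs `(1 + ‖x‖)⁴` and the other one is integrable.
  refine hasDerivAt_toLp (B := fun x => c * (1 + ‖x‖) ^ 2 * Real.exp (C + ε / 2 - ε / 2 * ‖x‖ ^ 2))
    ?_ (fun x => ?_) ?_
  · refine ((integrable_exp_neg_mul_sq_norm (n := n) (half_pos hε)).const_mul
      (c ^ 2 * Real.exp (2 * C + ε) * K)).mono' (by fun_prop) (Eventually.of_forall fun x => ?_)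
    rw [Real.norm_of_nonneg (by positivity)]
    have e1 : Real.exp (C + ε / 2 - ε / 2 * ‖x‖ ^ 2) ^ 2 = Real.exp (2 * C + ε)
        * Real.exp (-(ε / 2) * ‖x‖ ^ 2) * Real.exp (-(ε / 2) * ‖x‖ ^ 2) := by
      rw [← Real.exp_add, ← Real.exp_add, ← Real.exp_nat_mul]
      congr 1; push_cast; ring
    calc _ = c ^ 2 * Real.exp (2 * C + ε) * ((1 + ‖x‖) ^ 4 * Real.exp (-(ε / 2) * ‖x‖ ^ 2))
          * Real.exp (-(ε / 2) * ‖x‖ ^ 2) := by rw [mul_pow, e1]; ring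
      _ ≤ _ := by
        gcongr
        exact hKr _ (norm_nonneg x)
  · have h1 : HasDerivAt (fun t => gaussExponent (Z t) (m t) (κ t) x)
        (gaussExponent Z' m' κ' x) t₀ := by
      refine HasDerivAt.add (HasDerivAt.add (HasDerivAt.const_mul _ ?_)
        (HasDerivAt.const_mul _ ?_)) hκ
      · refine HasDerivAt.fun_sum fun i _ => HasDerivAt.const_mul _ ?_
        exact HasDerivAt.fun_sum (u := Finset.univ) (A := fun j t => Z t i j * cvec x j)
          fun j _ => (hZ i j).mul_const (cvec x j)
      · exact HasDerivAt.fun_sum fun j _ => (hm j).mul_const _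
    have h2 := h1.cexp
    rw [hg, gaussS_apply hpos, mul_comm]
    refine h2.congr_of_eventuallyEq ?_
    filter_upwards [hposE] with t ht
    exact gaussS_apply ht _ _ x
  · filter_upwards [hposE, hωc.bound, hωt.eventually (gt_mem_nhds (by positivity : 0 < ε / 4))]
      with t ht htc hts x
    rw [gaussS_apply ht, gaussS_apply hpos]
    set a := gaussExponent (Z t) (m t) (κ t) x
    set b := gaussExponent (Z t₀) (m t₀) (κ t₀) x
    have hab : ‖a - b‖ ≤ ω t * (1 + ‖x‖) ^ 2 := by
      simp only [a, b]
      rw [gaussExponent_sub]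
      exact norm_gaussExponent_le _ _ _ x
    rw [Real.norm_of_nonneg (hω0 t), Real.norm_eq_abs] at htc
    have h1 : Complex.exp a - Complex.exp b = Complex.exp b * (Complex.exp (a - b) - 1) := by
      rw [mul_sub, ← Complex.exp_add, mul_one]; congr 2; ring
    have h2 := Complex.norm_exp_sub_sum_le_norm_mul_exp (a - b) 1
    simp only [Finset.range_one, Finset.sum_singleton, pow_zero, Nat.factorial_zero, Nat.cast_one,
      div_one, pow_one] at h2
    have hx := norm_nonneg x
    rw [h1, norm_mul, Complex.norm_exp]
    calc _ ≤ Real.exp b.re * (ω t * (1 + ‖x‖) ^ 2 * Real.exp (ω t * (1 + ‖x‖) ^ 2)) := by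
          gcongr
          exact h2.trans (by gcongr)
      _ = ω t * (1 + ‖x‖) ^ 2 * Real.exp (b.re + ω t * (1 + ‖x‖) ^ 2) := by
          rw [Real.exp_add]; ring
      _ ≤ c * |t - t₀| * (1 + ‖x‖) ^ 2 * Real.exp (C + ε / 2 - ε / 2 * ‖x‖ ^ 2) := by
          gcongr
          have h3 : (1 + ‖x‖) ^ 2 ≤ 2 + 2 * ‖x‖ ^ 2 := by nlinarith [sq_nonneg (1 - ‖x‖)]
          have h4 : ω t * (1 + ‖x‖) ^ 2 ≤ ε / 4 * (2 + 2 * ‖x‖ ^ 2) := by gcongr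
          have := hre x
          simp only [b]
          linarith
      _ = _ := by ring

/-! ### Quadratic differential operators on Gaussians -/

/-- The frame `(1, Z)` of the graph of `Z`. -/
def graphFrame {n : ℕ} (Z : Matrix (Fin n) (Fin n) ℂ) : Matrix (Fin n ⊕ Fin n) (Fin n) ℂ :=
  Matrix.fromRows 1 Z

/-- The phase space vector `(0, m)`. -/
def xiVec {n : ℕ} (m : Fin n → ℂ) : Fin n ⊕ Fin n → ℂ := Sum.elim 0 m

/-- The vector `(x, Zx + m)`: the operators `x`, `D` act on the Gaussian with parameters `Z`, `m`
as multiplication by its coordinates. -/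
def gaussSymbol {n : ℕ} (Z : Matrix (Fin n) (Fin n) ℂ) (m : Fin n → ℂ)
    (x : EuclideanSpace ℝ (Fin n)) : Fin n ⊕ Fin n → ℂ :=
  Sum.elim (cvec x) (Z *ᵥ cvec x + m)

theorem gaussSymbol_eq {n : ℕ} (Z : Matrix (Fin n) (Fin n) ℂ) (m : Fin n → ℂ)
    (x : EuclideanSpace ℝ (Fin n)) :
    gaussSymbol Z m x = graphFrame Z *ᵥ cvec x + xiVec m := by
  rw [graphFrame, Matrix.fromRows_mulVec, Matrix.one_mulVec]
  ext (i | i) <;> simp [gaussSymbol, xiVec]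

theorem hasFDerivAt_cvec {n : ℕ} (j : Fin n) (x : EuclideanSpace ℝ (Fin n)) :
    HasFDerivAt (fun x => cvec x j)
      (Complex.ofRealCLM.comp (EuclideanSpace.proj j : EuclideanSpace ℝ (Fin n) →L[ℝ] ℝ)) x :=
  (Complex.ofRealCLM.comp
    (EuclideanSpace.proj j : EuclideanSpace ℝ (Fin n) →L[ℝ] ℝ)).hasFDerivAt

theorem fderiv_sum_mul_cvec {n : ℕ} (a : Fin n → ℂ) (x : EuclideanSpace ℝ (Fin n)) (k : Fin n) :
    DifferentiableAt ℝ (fun x => a ⬝ᵥ cvec x) x ∧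
      fderiv ℝ (fun x => a ⬝ᵥ cvec x) x (EuclideanSpace.single k 1) = a k := by
  have h : HasFDerivAt (fun x => a ⬝ᵥ cvec x) (∑ j, a j • (Complex.ofRealCLM.comp
      (EuclideanSpace.proj j : EuclideanSpace ℝ (Fin n) →L[ℝ] ℝ))) x :=
    HasFDerivAt.fun_sum fun j _ => (hasFDerivAt_cvec j x).const_mul (a j)
  refine ⟨h.differentiableAt, ?_⟩
  rw [h.fderiv]
  simp [apply_ite Complex.ofReal]

theorem gaussSymbol_apply_eq {n : ℕ} (Z : Matrix (Fin n) (Fin n) ℂ) (m : Fin n → ℂ)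
    (x : EuclideanSpace ℝ (Fin n)) (j : Fin n ⊕ Fin n) :
    gaussSymbol Z m x j = graphFrame Z j ⬝ᵥ cvec x + xiVec m j := by
  rw [gaussSymbol_eq]; rfl

theorem fderiv_gaussSymbol {n : ℕ} (Z : Matrix (Fin n) (Fin n) ℂ) (m : Fin n → ℂ)
    (x : EuclideanSpace ℝ (Fin n)) (j : Fin n ⊕ Fin n) (k : Fin n) :
    DifferentiableAt ℝ (fun x => gaussSymbol Z m x j) x ∧
      fderiv ℝ (fun x => gaussSymbol Z m x j) x (EuclideanSpace.single k 1)
        = graphFrame Z j k := by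
  obtain ⟨h1, h2⟩ := fderiv_sum_mul_cvec (graphFrame Z j) x k
  have h : (fun x => gaussSymbol Z m x j)
      = fun x => graphFrame Z j ⬝ᵥ cvec x + xiVec m j := by
    ext y; exact gaussSymbol_apply_eq Z m y j
  rw [h]
  refine ⟨h1.add_const _, ?_⟩
  rw [fderiv_add_const, h2]

theorem fderiv_gaussExponent {n : ℕ} {Z : Matrix (Fin n) (Fin n) ℂ} (hZ : Z.IsSymm)
    (m : Fin n → ℂ) (κ : ℂ) (x : EuclideanSpace ℝ (Fin n)) (k : Fin n) :
    DifferentiableAt ℝ (gaussExponent Z m κ) x ∧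
      fderiv ℝ (gaussExponent Z m κ) x (EuclideanSpace.single k 1)
        = Complex.I * (Z *ᵥ cvec x + m) k := by
  have h1 : HasFDerivAt (fun x => cvec x ⬝ᵥ Z *ᵥ cvec x)
      (∑ i, (cvec x i • (∑ j, Z i j • (Complex.ofRealCLM.comp
          (EuclideanSpace.proj j : EuclideanSpace ℝ (Fin n) →L[ℝ] ℝ)))
        + (Z *ᵥ cvec x) i • (Complex.ofRealCLM.comp
          (EuclideanSpace.proj i : EuclideanSpace ℝ (Fin n) →L[ℝ] ℝ)))) x := by
    refine HasFDerivAt.fun_sum fun i _ => (hasFDerivAt_cvec i x).mul ?_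
    exact HasFDerivAt.fun_sum (u := Finset.univ) (A := fun j x => Z i j * cvec x j)
      fun j _ => (hasFDerivAt_cvec j x).const_mul (Z i j)
  obtain ⟨h2, h3⟩ := fderiv_sum_mul_cvec m x k
  have h4 := ((h1.const_mul (Complex.I / 2)).add (h2.hasFDerivAt.const_mul Complex.I)).add_const κ
  have h5 : HasFDerivAt (gaussExponent Z m κ) _ x := h4
  refine ⟨h5.differentiableAt, ?_⟩
  rw [h5.fderiv]
  have h6 : (Z *ᵥ cvec x) k = ∑ i, cvec x i * Z i k := by
    simp only [Matrix.mulVec, dotProduct]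
    exact Finset.sum_congr rfl fun i _ => by rw [hZ.apply, mul_comm]
  simp [h3, Finset.sum_add_distrib, apply_ite Complex.ofReal]
  rw [h6]
  ring

theorem phaseS_gaussS {n : ℕ} {Z : Matrix (Fin n) (Fin n) ℂ} (hZ : Z.IsSymm) (hp : ImPosDef Z)
    (m : Fin n → ℂ) (κ : ℂ) (j : Fin n ⊕ Fin n) (x : EuclideanSpace ℝ (Fin n)) :
    phaseS j (gaussS Z m κ) x = gaussSymbol Z m x j * gaussS Z m κ x := by
  cases j with
  | inl j => rw [phaseS_inl_apply]; rfl
  | inr k =>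
    obtain ⟨h1, h2⟩ := fderiv_gaussExponent hZ m κ x k
    have h3 : (gaussS Z m κ : EuclideanSpace ℝ (Fin n) → ℂ)
        = fun x => Complex.exp (gaussExponent Z m κ x) := by
      ext y; exact gaussS_apply hp m κ y
    rw [phaseS_inr_apply, h3, h1.hasFDerivAt.cexp.fderiv]
    simp only [smul_apply, h2, smul_eq_mul, gaussSymbol, Sum.elim_inr]
    linear_combination (-(Z *ᵥ cvec x + m) k * Complex.exp (gaussExponent Z m κ x)) * Complex.I_sq

/-- The second operator also differentiates the symbol produced by the first one, but only if it is
some `D_k`; this is the source of the trace term below. -/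
theorem phaseS_phaseS_gaussS {n : ℕ} {Z : Matrix (Fin n) (Fin n) ℂ} (hZ : Z.IsSymm)
    (hp : ImPosDef Z) (m : Fin n → ℂ) (κ : ℂ) (i j : Fin n ⊕ Fin n)
    (x : EuclideanSpace ℝ (Fin n)) :
    phaseS i (phaseS j (gaussS Z m κ)) x = (gaussSymbol Z m x i * gaussSymbol Z m x j
      + Sum.elim (0 : Fin n → ℂ) (fun k => -Complex.I * graphFrame Z j k) i)
        * gaussS Z m κ x := by
  cases i with
  | inl i =>
    rw [phaseS_inl_apply, phaseS_gaussS hZ hp]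
    simp only [gaussSymbol, Sum.elim_inl, cvec, Pi.zero_apply]
    ring
  | inr k =>
    obtain ⟨h1, h2⟩ := fderiv_gaussSymbol Z m x j k
    have h3 : (phaseS j (gaussS Z m κ) : EuclideanSpace ℝ (Fin n) → ℂ)
        = fun x => gaussSymbol Z m x j * gaussS Z m κ x := by
      ext y; exact phaseS_gaussS hZ hp m κ j y
    have h4 := phaseS_gaussS hZ hp m κ (Sum.inr k) x
    rw [phaseS_inr_apply] at h4
    rw [phaseS_inr_apply, h3,
      (h1.hasFDerivAt.fun_mul (gaussS Z m κ).differentiableAt.hasFDerivAt).fderiv]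
    simp only [add_apply, smul_apply, h2, smul_eq_mul,
      Sum.elim_inr]
    linear_combination gaussSymbol Z m x j * h4

/-- The constant `-i tr (Q N)_ξ`, `N = (1, Z)`, produced by the commutators. -/
def gaussTrace {n : ℕ} (Q : Mat n ℂ) (Z : Matrix (Fin n) (Fin n) ℂ) : ℂ :=
  -Complex.I * ∑ k, (Q * graphFrame Z) (Sum.inr k) k

theorem weylS_gaussS {n : ℕ} {Z : Matrix (Fin n) (Fin n) ℂ} (hZ : Z.IsSymm)
    (hp : ImPosDef Z) (Q : Mat n ℂ) (m : Fin n → ℂ) (κ : ℂ) (x : EuclideanSpace ℝ (Fin n)) :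
    weylS Q (gaussS Z m κ) x = (gaussSymbol Z m x ⬝ᵥ Q *ᵥ gaussSymbol Z m x + gaussTrace Q Z)
      * gaussS Z m κ x := by
  have h0 : weylS Q (gaussS Z m κ) x
      = ∑ i, ∑ j, Q i j * phaseS i (phaseS j (gaussS Z m κ)) x := by
    simp [weylS]
  have h1 : gaussTrace Q Z = ∑ i, ∑ j, Q i j *
      Sum.elim (0 : Fin n → ℂ) (fun k => -Complex.I * graphFrame Z j k) i := by
    rw [gaussTrace, Fintype.sum_sum_type]
    simp only [Sum.elim_inl, Pi.zero_apply, mul_zero, Finset.sum_const_zero, zero_add,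
      Sum.elim_inr, Finset.mul_sum, Matrix.mul_apply]
    exact Finset.sum_congr rfl fun _ _ => Finset.sum_congr rfl fun _ _ => by ring
  simp only [h0, phaseS_phaseS_gaussS hZ hp, h1, dotProduct, Matrix.mulVec, Finset.mul_sum,
    ← Finset.sum_add_distrib, Finset.sum_mul]
  exact Finset.sum_congr rfl fun _ _ => Finset.sum_congr rfl fun _ _ => by ring

/-- Expanding `-q(x, Zx + m)` in powers of `x` and comparing with the normal form of an exponent
gives the right-hand sides of the Riccati system for `Z`, `m` and the constant. -/
theorem gaussSymbol_dotProduct {n : ℕ} {Q : Mat n ℂ} (hQ : Q.IsSymm)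
    (Z : Matrix (Fin n) (Fin n) ℂ) (m : Fin n → ℂ) (κ : ℂ) (x : EuclideanSpace ℝ (Fin n)) :
    -(gaussSymbol Z m x ⬝ᵥ Q *ᵥ gaussSymbol Z m x + κ)
      = gaussExponent
        ((2 * Complex.I) • ((graphFrame Z)ᵀ * Q * graphFrame Z))
        ((2 * Complex.I) • ((graphFrame Z)ᵀ *ᵥ Q *ᵥ xiVec m))
        (-(xiVec m ⬝ᵥ Q *ᵥ xiVec m) - κ) x := by
  rw [gaussSymbol_eq, gaussExponent]
  set N := graphFrame Z
  set y := cvec x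
  set μ : Fin n ⊕ Fin n → ℂ := xiVec m
  have h1 : N *ᵥ y ⬝ᵥ Q *ᵥ N *ᵥ y = y ⬝ᵥ (Nᵀ * Q * N) *ᵥ y := by
    rw [← Matrix.mulVec_mulVec, ← Matrix.mulVec_mulVec, Matrix.dotProduct_mulVec y,
      Matrix.vecMul_transpose]
  have h2 : N *ᵥ y ⬝ᵥ Q *ᵥ μ = (Nᵀ *ᵥ Q *ᵥ μ) ⬝ᵥ y := by
    rw [dotProduct_comm, Matrix.dotProduct_mulVec, ← Matrix.mulVec_transpose]
  have h3 : μ ⬝ᵥ Q *ᵥ N *ᵥ y = (Nᵀ *ᵥ Q *ᵥ μ) ⬝ᵥ y := by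
    rw [← h2, Matrix.dotProduct_mulVec μ, ← Matrix.mulVec_transpose, hQ.eq, dotProduct_comm]
  simp only [Matrix.mulVec_add, dotProduct_add, add_dotProduct, h1, h2, h3, Matrix.smul_mulVec,
    dotProduct_smul, smul_dotProduct, smul_eq_mul]
  linear_combination (-(y ⬝ᵥ (Nᵀ * Q * N) *ᵥ y) - 2 * ((Nᵀ *ᵥ Q *ᵥ μ) ⬝ᵥ y)) * Complex.I_sq

/-- A path of Gaussians whose parameters satisfy the Riccati system solves `∂_t u = -Q^w u`. -/
theorem hasDerivAt_gaussS_of_riccati {n : ℕ} {Q : Mat n ℂ} (hQ : Q.IsSymm)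
    {Z : ℝ → Matrix (Fin n) (Fin n) ℂ} {m : ℝ → Fin n → ℂ} {κ : ℝ → ℂ} {t₀ : ℝ}
    (hsymm : (Z t₀).IsSymm) (hpos : ImPosDef (Z t₀))
    (hZ : ∀ i j, HasDerivAt (fun t => Z t i j) (((2 * Complex.I) •
      ((graphFrame (Z t₀))ᵀ * Q * graphFrame (Z t₀))) i j) t₀)
    (hm : ∀ j, HasDerivAt (fun t => m t j) (((2 * Complex.I) •
      ((graphFrame (Z t₀))ᵀ *ᵥ Q *ᵥ xiVec (m t₀))) j) t₀)
    (hκ : HasDerivAt κ (-(xiVec (m t₀) ⬝ᵥ Q *ᵥ xiVec (m t₀)) - gaussTrace Q (Z t₀)) t₀) :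
    HasDerivAt (fun t => ((gaussS (Z t) (m t) (κ t)).toLp 2 : L2 n))
      (-(weylS Q (gaussS (Z t₀) (m t₀) (κ t₀))).toLp 2) t₀ := by
  have h : (-(weylS Q (gaussS (Z t₀) (m t₀) (κ t₀))).toLp 2 : L2 n)
      = (-(weylS Q (gaussS (Z t₀) (m t₀) (κ t₀)))).toLp 2 :=
    (map_neg (SchwartzMap.toLpCLM ℂ ℂ 2 volume) _).symm
  rw [h]
  refine hasDerivAt_gaussS_toLp hZ hm hκ hpos fun x => ?_
  rw [← gaussSymbol_dotProduct hQ]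
  simp only [neg_apply, weylS_gaussS hsymm hpos]
  ring

/-! ### The complex Hamiltonian flow and positive Lagrangian frames -/

section Flow

open scoped Matrix.Norms.Operator

/-- The complex Hamiltonian flow `exp (-2it JQ)`. -/
def hflow {n : ℕ} (Q : Mat n ℂ) (t : ℝ) : Mat n ℂ :=
  NormedSpace.exp (t • ((-2 * Complex.I) • (symplJ n * Q)))

@[simp]
theorem hflow_zero {n : ℕ} (Q : Mat n ℂ) : hflow Q 0 = 1 := by
  simp [hflow, NormedSpace.exp_zero]

theorem hasDerivAt_hflow {n : ℕ} (Q : Mat n ℂ) (t : ℝ) :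
    HasDerivAt (hflow Q) ((-2 * Complex.I) • (symplJ n * Q) * hflow Q t) t :=
  hasDerivAt_exp_smul_const' (𝕂 := ℝ) ((-2 * Complex.I) • (symplJ n * Q)) t

theorem hasDerivAt_linearMap_hflow {n : ℕ} {V : Type*} [NormedAddCommGroup V] [NormedSpace ℝ V]
    (L : Mat n ℂ →ₗ[ℝ] V) (Q : Mat n ℂ) (t : ℝ) :
    HasDerivAt (fun t => L (hflow Q t)) (L ((-2 * Complex.I) • (symplJ n * Q) * hflow Q t)) t :=
  (LinearMap.toContinuousLinearMap L).hasFDerivAt.comp_hasDerivAt t (hasDerivAt_hflow Q t)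

theorem hasDerivAt_hflow_mulVec {n : ℕ} (Q : Mat n ℂ) (X : Fin n ⊕ Fin n → ℂ) (t : ℝ) :
    HasDerivAt (fun t => hflow Q t *ᵥ X)
      ((-2 * Complex.I) • (symplJ n *ᵥ Q *ᵥ hflow Q t *ᵥ X)) t := by
  have h := hasDerivAt_linearMap_hflow
    ({ toFun := fun G => G *ᵥ X
       map_add' := fun A B => Matrix.add_mulVec A B X
       map_smul' := fun c A => Matrix.smul_mulVec c A X } :
      Mat n ℂ →ₗ[ℝ] (Fin n ⊕ Fin n → ℂ)) Q t
  simpa only [LinearMap.coe_mk, AddHom.coe_mk, Matrix.smul_mul, Matrix.smul_mulVec,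
    Matrix.mulVec_mulVec, Matrix.mul_assoc] using h

theorem symplJ_transpose (n : ℕ) : (symplJ n)ᵀ = -symplJ n := by
  simp [symplJ, Matrix.fromBlocks_transpose, Matrix.fromBlocks_neg]

theorem symplJ_mul_self (n : ℕ) : symplJ n * symplJ n = -1 := by
  simp [symplJ, Matrix.fromBlocks_multiply, ← Matrix.fromBlocks_one, Matrix.fromBlocks_neg]

theorem symplJ_conjTranspose (n : ℕ) : (symplJ n)ᴴ = -symplJ n := by
  simp [symplJ, Matrix.fromBlocks_conjTranspose, Matrix.fromBlocks_neg]

/-- The real quadratic form `Im (Y* J Y)` on complex phase space. -/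
def symplIm {n : ℕ} (Y : Fin n ⊕ Fin n → ℂ) : ℝ := (star Y ⬝ᵥ symplJ n *ᵥ Y).im

theorem star_symplJ_mulVec_dotProduct {n : ℕ} (Y Y' : Fin n ⊕ Fin n → ℂ) :
    star (symplJ n *ᵥ Y) ⬝ᵥ symplJ n *ᵥ Y' = star Y ⬝ᵥ Y' := by
  rw [Matrix.star_mulVec, ← Matrix.dotProduct_mulVec, Matrix.mulVec_mulVec,
    symplJ_conjTranspose, Matrix.neg_mul, symplJ_mul_self, neg_neg, Matrix.one_mulVec]

theorem star_dotProduct_star_comm {n : ℕ} (Y Y' : Fin n ⊕ Fin n → ℂ) :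
    star Y ⬝ᵥ Y' = star (star Y' ⬝ᵥ Y) := by
  rw [Matrix.star_dotProduct]

theorem HasDerivAt.star_dotProduct {ι : Type*} [Fintype ι] {Y W : ℝ → ι → ℂ} {Y' W' : ι → ℂ}
    {t : ℝ} (hY : HasDerivAt Y Y' t) (hW : HasDerivAt W W' t) :
    HasDerivAt (fun t => star (Y t) ⬝ᵥ W t) (star Y' ⬝ᵥ W t + star (Y t) ⬝ᵥ W') t := by
  rw [hasDerivAt_pi] at hY hW
  have h : star Y' ⬝ᵥ W t + star (Y t) ⬝ᵥ W'
      = ∑ i, (star (Y' i) * W t i + star (Y t i) * W' i) := by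
    simp [dotProduct, Finset.sum_add_distrib]
  rw [h]
  exact HasDerivAt.fun_sum fun i _ => (hY i).star.mul (hW i)

theorem HasDerivAt.const_mulVec {ι ι' : Type*} [Fintype ι] [Fintype ι'] {W : ℝ → ι → ℂ}
    {W' : ι → ℂ} {t : ℝ} (B : Matrix ι' ι ℂ) (hW : HasDerivAt W W' t) :
    HasDerivAt (fun t => B *ᵥ W t) (B *ᵥ W') t := by
  rw [hasDerivAt_pi] at hW ⊢
  exact fun i => HasDerivAt.fun_sum (u := Finset.univ) (A := fun j t => B i j * W t j)
    fun j _ => (hW j).const_mul (B i j)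

/-- Because `J* J = 1` and `J² = -1`, the two terms of the product rule are `2i` times `Y* Q Y` and
its conjugate. This identity yields both the preservation of positive Lagrangians and the comparison
of dissipated energies. -/
theorem hasDerivAt_symplIm {n : ℕ} {Q : Mat n ℂ} {Y : ℝ → Fin n ⊕ Fin n → ℂ} {t : ℝ}
    (hY : HasDerivAt Y ((-2 * Complex.I) • (symplJ n *ᵥ Q *ᵥ Y t)) t) :
    HasDerivAt (fun t => symplIm (Y t)) (4 * (star (Y t) ⬝ᵥ Q *ᵥ Y t).re) t := by
  have h1 := HasDerivAt.star_dotProduct hY (HasDerivAt.const_mulVec (symplJ n) hY)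
  have h2 : star ((-2 * Complex.I) • (symplJ n *ᵥ Q *ᵥ Y t)) ⬝ᵥ symplJ n *ᵥ Y t
      + star (Y t) ⬝ᵥ symplJ n *ᵥ ((-2 * Complex.I) • (symplJ n *ᵥ Q *ᵥ Y t))
      = 2 * Complex.I * (star (star (Y t) ⬝ᵥ Q *ᵥ Y t) + star (Y t) ⬝ᵥ Q *ᵥ Y t) := by
    rw [star_smul, smul_dotProduct, star_symplJ_mulVec_dotProduct, Matrix.mulVec_smul,
      Matrix.mulVec_mulVec (Q *ᵥ Y t), symplJ_mul_self, Matrix.neg_mulVec, Matrix.one_mulVec,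
      dotProduct_smul, dotProduct_neg, star_dotProduct_star_comm (Q *ᵥ Y t) (Y t)]
    simp
    ring
  rw [h2] at h1
  have h3 := Complex.imCLM.hasFDerivAt.comp_hasDerivAt t h1
  have h4 : Complex.imCLM (2 * Complex.I * (star (star (Y t) ⬝ᵥ Q *ᵥ Y t) + star (Y t) ⬝ᵥ Q *ᵥ Y t))
      = 4 * (star (Y t) ⬝ᵥ Q *ᵥ Y t).re := by
    simp
    ring
  rw [h4] at h3
  exact h3


theorem isUnit_symplJ (n : ℕ) : IsUnit (symplJ n) :=
  IsUnit.of_mul_eq_one (-symplJ n) (by rw [mul_neg, symplJ_mul_self, neg_neg])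

theorem symplJ_inv (n : ℕ) : (symplJ n)⁻¹ = -symplJ n :=
  Matrix.inv_eq_right_inv (by rw [mul_neg, symplJ_mul_self, neg_neg])

/-- Conjugating the exponential by `J` replaces `JQ` by `QJ`. Both adjunction identities that follow
rest on it. -/
theorem symplJ_mul_hflow {n : ℕ} (Q : Mat n ℂ) (t : ℝ) :
    symplJ n * hflow Q t
      = NormedSpace.exp (t • ((-2 * Complex.I) • (Q * symplJ n))) * symplJ n := by
  have h : t • ((-2 * Complex.I) • (Q * symplJ n))
      = symplJ n * (t • ((-2 * Complex.I) • (symplJ n * Q))) * (symplJ n)⁻¹ := by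
    rw [symplJ_inv]
    simp only [Matrix.mul_smul, Matrix.smul_mul, Matrix.mul_neg, ← Matrix.mul_assoc,
      symplJ_mul_self, Matrix.neg_mul, Matrix.one_mul, smul_neg, neg_neg]
  rw [h, Matrix.exp_conj _ _ (isUnit_symplJ n), hflow, symplJ_inv]
  simp only [Matrix.mul_neg, Matrix.neg_mul, Matrix.mul_assoc, symplJ_mul_self, Matrix.mul_one,
    neg_neg]

theorem exp_neg_mul_exp_mul {n : ℕ} (A B : Mat n ℂ) :
    NormedSpace.exp (-A) * NormedSpace.exp A * B = B := by
  have h : IsUnit (NormedSpace.exp A).det :=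
    (Matrix.isUnit_iff_isUnit_det _).1 (Matrix.isUnit_exp A)
  rw [Matrix.exp_neg, Matrix.nonsing_inv_mul _ h, Matrix.one_mul]

/-- For symmetric `Q` one has `(JQ)ᵀ = -QJ`, so the transposed flow is inverse to the exponential on
the other side of `J`. -/
theorem hflow_transpose_mul_symplJ_mul_hflow {n : ℕ} {Q : Mat n ℂ} (hQ : Q.IsSymm) (t : ℝ) :
    (hflow Q t)ᵀ * symplJ n * hflow Q t = symplJ n := by
  rw [Matrix.mul_assoc, symplJ_mul_hflow, ← Matrix.mul_assoc, hflow, ← Matrix.exp_transpose]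
  have h : (t • ((-2 * Complex.I) • (symplJ n * Q)))ᵀ
      = -(t • ((-2 * Complex.I) • (Q * symplJ n))) := by
    rw [Matrix.transpose_smul, Matrix.transpose_smul, Matrix.transpose_mul, hQ.eq,
      symplJ_transpose, Matrix.mul_neg, smul_neg, smul_neg]
  rw [h, exp_neg_mul_exp_mul]

/-- The signs from `J* = -J` and from conjugating `-2i` cancel, so no inverse appears here, unlike
for the transpose. It makes the form `Im (Y* J Y)` at time `t` a function of a product of two flows.
-/
theorem hflow_conjTranspose_mul_symplJ {n : ℕ} (Q : Mat n ℂ) (t : ℝ) :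
    (hflow Qᴴ t)ᴴ * symplJ n = symplJ n * hflow Q t := by
  rw [symplJ_mul_hflow, hflow, ← Matrix.exp_conjTranspose]
  congr 2
  rw [Matrix.conjTranspose_smul, Matrix.conjTranspose_smul, Matrix.conjTranspose_mul,
    Matrix.conjTranspose_conjTranspose, symplJ_conjTranspose, Matrix.mul_neg, smul_neg]
  simp

/-- A symmetric matrix whose associated Hermitian form has non-negative real part. -/
structure IsAccretive {n : ℕ} (Q : Mat n ℂ) : Prop where
  symm : Q.IsSymm
  nonneg : ∀ Y, 0 ≤ (star Y ⬝ᵥ Q *ᵥ Y).re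

theorem re_star_dotProduct_conjTranspose_mulVec {n : ℕ} (Q : Mat n ℂ) (Y : Fin n ⊕ Fin n → ℂ) :
    (star Y ⬝ᵥ Qᴴ *ᵥ Y).re = (star Y ⬝ᵥ Q *ᵥ Y).re := by
  rw [Matrix.dotProduct_mulVec, ← Matrix.star_mulVec, star_dotProduct_star_comm]
  simp

theorem IsAccretive.conjTranspose {n : ℕ} {Q : Mat n ℂ} (hQ : IsAccretive Q) :
    IsAccretive Qᴴ where
  symm := by
    have := hQ.symm
    rw [Matrix.IsSymm] at this ⊢
    conv_rhs => rw [← this]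
    rfl
  nonneg Y := by
    rw [re_star_dotProduct_conjTranspose_mulVec]
    exact hQ.nonneg Y

/-- A frame of a positive Lagrangian subspace of the complex phase space. -/
structure IsPosFrame {n : ℕ} (Φ : Matrix (Fin n ⊕ Fin n) (Fin n) ℂ) : Prop where
  lagrangian : Φᵀ * symplJ n * Φ = 0
  pos : ∀ v, v ≠ 0 → 0 < symplIm (Φ *ᵥ v)

theorem symplIm_le_symplIm_hflow {n : ℕ} {Q : Mat n ℂ} (hQ : IsAccretive Q)
    (X : Fin n ⊕ Fin n → ℂ) {t : ℝ} (ht : 0 ≤ t) : symplIm X ≤ symplIm (hflow Q t *ᵥ X) := by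
  have h : Monotone fun t => symplIm (hflow Q t *ᵥ X) :=
    monotone_of_hasDerivAt_nonneg (fun t => hasDerivAt_symplIm (hasDerivAt_hflow_mulVec Q X t))
      (fun t => mul_nonneg (by norm_num) (hQ.nonneg _))
  simpa using h ht

/-- The flow is symplectic, which preserves the Lagrangian condition, and `Im (Y* J Y)` does not
decrease in forward time, which preserves positivity. -/
theorem IsPosFrame.hflow_mul {n : ℕ} {Φ : Matrix (Fin n ⊕ Fin n) (Fin n) ℂ} (hΦ : IsPosFrame Φ)
    {Q : Mat n ℂ} (hQ : IsAccretive Q) {t : ℝ} (ht : 0 ≤ t) : IsPosFrame (hflow Q t * Φ) where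
  lagrangian := by
    have h := hflow_transpose_mul_symplJ_mul_hflow hQ.symm t
    calc (hflow Q t * Φ)ᵀ * symplJ n * (hflow Q t * Φ)
        = Φᵀ * ((hflow Q t)ᵀ * symplJ n * hflow Q t) * Φ := by
          simp only [Matrix.transpose_mul, Matrix.mul_assoc]
      _ = 0 := by rw [h, hΦ.lagrangian]
  pos v hv := by
    rw [← Matrix.mulVec_mulVec]
    exact (hΦ.pos v hv).trans_le (symplIm_le_symplIm_hflow hQ _ ht)

theorem symplJ_mul_eq_fromRows {n : ℕ} {ι : Type*} (M : Matrix (Fin n ⊕ Fin n) ι ℂ) :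
    symplJ n * M = Matrix.fromRows M.toRows₂ (-M.toRows₁) := by
  conv_lhs => rw [← Matrix.fromRows_toRows M]
  rw [symplJ, Matrix.fromBlocks_mul_fromRows]
  simp

theorem symplIm_sumElim {n : ℕ} (x y : Fin n → ℂ) :
    symplIm (Sum.elim x y) = 2 * (star x ⬝ᵥ y).im := by
  have h1 : symplJ n *ᵥ Sum.elim x y = Sum.elim y (-x) := by
    rw [symplJ, Matrix.fromBlocks_mulVec]
    simp [Matrix.neg_mulVec]
  have h2 : star y ⬝ᵥ x = star (star x ⬝ᵥ y) := by rw [Matrix.star_dotProduct]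
  have h3 : star (Sum.elim x y) ⬝ᵥ Sum.elim y (-x) = star x ⬝ᵥ y - star y ⬝ᵥ x := by
    simp [dotProduct, Fintype.sum_sum_type, sub_eq_add_neg]
  rw [symplIm, h1, h3, h2]
  simp
  ring

/-- The matrix `Z = C A⁻¹` of the Lagrangian subspace with frame `(A, C)`. -/
def frameZ {n : ℕ} (Φ : Matrix (Fin n ⊕ Fin n) (Fin n) ℂ) : Matrix (Fin n) (Fin n) ℂ :=
  Φ.toRows₂ * (Φ.toRows₁)⁻¹

/-- A kernel vector of the upper block would be sent to some `(0, y)`, where `Im (Y* J Y)` vanishes.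
-/
theorem IsPosFrame.isUnit_det {n : ℕ} {Φ : Matrix (Fin n ⊕ Fin n) (Fin n) ℂ}
    (hΦ : IsPosFrame Φ) : IsUnit Φ.toRows₁.det := by
  rw [isUnit_iff_ne_zero]
  intro h
  obtain ⟨v, hv, hv0⟩ := Matrix.exists_mulVec_eq_zero_iff.2 h
  have h1 := hΦ.pos v hv
  rw [← Matrix.fromRows_toRows Φ, Matrix.fromRows_mulVec, hv0, symplIm_sumElim] at h1
  simp at h1

theorem IsPosFrame.graphFrame_mul {n : ℕ} {Φ : Matrix (Fin n ⊕ Fin n) (Fin n) ℂ}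
    (hΦ : IsPosFrame Φ) : graphFrame (frameZ Φ) * Φ.toRows₁ = Φ := by
  rw [graphFrame, Matrix.fromRows_mul, Matrix.one_mul, frameZ, Matrix.mul_assoc,
    Matrix.nonsing_inv_mul _ hΦ.isUnit_det, Matrix.mul_one, Matrix.fromRows_toRows]

/-- For a frame `(A, C)` the Lagrangian condition reads `Aᵀ C = Cᵀ A`. -/
theorem IsPosFrame.frameZ_isSymm {n : ℕ} {Φ : Matrix (Fin n ⊕ Fin n) (Fin n) ℂ}
    (hΦ : IsPosFrame Φ) : (frameZ Φ).IsSymm := by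
  have h1 := hΦ.lagrangian
  set A := Φ.toRows₁ with hA
  set C := Φ.toRows₂ with hC
  have h2 : Φᵀ * symplJ n * Φ = Aᵀ * C - Cᵀ * A := by
    rw [Matrix.mul_assoc, symplJ_mul_eq_fromRows, ← hA, ← hC]
    conv_lhs => rw [← Matrix.fromRows_toRows Φ]
    rw [Matrix.transpose_fromRows, Matrix.fromCols_mul_fromRows, ← hA, ← hC, Matrix.mul_neg,
      sub_eq_add_neg]
  rw [h2, sub_eq_zero] at h1
  have hu := hΦ.isUnit_det
  have hu' : IsUnit (Aᵀ).det := by rwa [Matrix.det_transpose]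
  rw [Matrix.IsSymm, frameZ, Matrix.transpose_mul, Matrix.transpose_nonsing_inv]
  calc (Aᵀ)⁻¹ * Cᵀ = (Aᵀ)⁻¹ * (Cᵀ * A) * A⁻¹ := by
        rw [Matrix.mul_assoc, Matrix.mul_assoc, Matrix.mul_nonsing_inv _ hu, Matrix.mul_one]
    _ = C * A⁻¹ := by
        rw [← h1, ← Matrix.mul_assoc (Aᵀ)⁻¹, Matrix.nonsing_inv_mul _ hu', Matrix.one_mul]

/-- Positivity on the vectors `(x, Zx)` with `x` real and nonzero is made uniform by homogeneity and
compactness of the unit sphere. -/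
theorem IsPosFrame.frameZ_imPosDef {n : ℕ} {Φ : Matrix (Fin n ⊕ Fin n) (Fin n) ℂ}
    (hΦ : IsPosFrame Φ) : ImPosDef (frameZ Φ) := by
  set Z := frameZ Φ with hZ
  set f : EuclideanSpace ℝ (Fin n) → ℝ := fun x => (cvec x ⬝ᵥ Z *ᵥ cvec x).im with hf
  have hpos : ∀ x, x ≠ 0 → 0 < f x := by
    intro x hx
    set v := (Φ.toRows₁)⁻¹ *ᵥ cvec x
    have hv1 : Φ *ᵥ v = Sum.elim (cvec x) (Z *ᵥ cvec x) := by
      rw [← hΦ.graphFrame_mul, ← Matrix.mulVec_mulVec, Matrix.mulVec_mulVec (cvec x),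
        Matrix.mul_nonsing_inv _ hΦ.isUnit_det, Matrix.one_mulVec, graphFrame,
        Matrix.fromRows_mulVec, Matrix.one_mulVec]
    have hv : v ≠ 0 := by
      intro h0
      rw [h0, Matrix.mulVec_zero] at hv1
      refine hx ?_
      ext j
      have := congrFun hv1 (Sum.inl j)
      simpa [cvec] using this.symm
    have h1 := hΦ.pos v hv
    have h2 : star (cvec x) = cvec x := by ext j; simp [cvec]
    rw [hv1, symplIm_sumElim, h2] at h1
    simp only [hf]
    linarith
  have hcont : Continuous f := by
    have h1 : f = fun x => (2 * gaussExponent Z 0 0 x).re * (-1) := by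
      ext x
      simp [hf, gaussExponent]
    rw [h1]
    have := (gaussExponent_hasTemperateGrowth Z 0 0).1.continuous
    exact ((Complex.continuous_re.comp (this.const_mul 2)).mul_const (-1))
  have hsm : ∀ (c : ℝ) x, f (c • x) = c ^ 2 * f x := by
    intro c x
    have h1 : cvec (c • x) = (c : ℂ) • cvec x := by ext j; simp [cvec]
    simp only [hf, h1, Matrix.mulVec_smul, dotProduct_smul, smul_dotProduct, smul_eq_mul]
    rw [← mul_assoc, ← Complex.ofReal_mul, Complex.im_ofReal_mul]
    ring
  -- The sphere is empty only in dimension `0`, where any constant works.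
  rcases (Metric.sphere (0 : EuclideanSpace ℝ (Fin n)) 1).eq_empty_or_nonempty with h | h
  · refine ⟨1, one_pos, fun x => ?_⟩
    have hx : x = 0 := by
      by_contra hx
      have : ‖x‖⁻¹ • x ∈ Metric.sphere (0 : EuclideanSpace ℝ (Fin n)) 1 := by
        simp [norm_smul, hx]
      rw [h] at this
      exact this
    have h0 := hsm 0 0
    subst hx
    simp only [hf] at h0
    simp at h0 ⊢
    exact h0.ge
  · obtain ⟨x₀, hx₀, hmin⟩ := (isCompact_sphere _ _).exists_isMinOn h hcont.continuousOn
    have hx₀' : x₀ ≠ 0 := by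
      rintro rfl
      simp at hx₀
    refine ⟨f x₀, hpos x₀ hx₀', fun x => ?_⟩
    by_cases hx : x = 0
    · have h0 := hsm 0 x
      simp only [zero_smul] at h0
      subst hx
      change _ ≤ f 0
      rw [h0]; simp
    · have hm : f x₀ ≤ f (‖x‖⁻¹ • x) := hmin (by simp [norm_smul, hx])
      rw [hsm] at hm
      have hxn : 0 < ‖x‖ := norm_pos_iff.2 hx
      change _ ≤ f x
      calc f x₀ * ‖x‖ ^ 2 ≤ (‖x‖⁻¹ ^ 2 * f x) * ‖x‖ ^ 2 := by gcongr
        _ = f x := by field_simp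

end Flow

/-! ### Evolution of Gaussians -/

/-- The linear part `m = A⁻ᵀ b` of the exponent of the Gaussian with frame `(A, C)`. -/
def frameM {n : ℕ} (Φ : Matrix (Fin n ⊕ Fin n) (Fin n) ℂ) (b : Fin n → ℂ) : Fin n → ℂ :=
  ((Φ.toRows₁)⁻¹)ᵀ *ᵥ b

section Flow

open scoped Matrix.Norms.Operator

theorem hasDerivAt_matrix_inv {n : ℕ} {A : ℝ → Matrix (Fin n) (Fin n) ℂ}
    {A' : Matrix (Fin n) (Fin n) ℂ} {t : ℝ} (hA : HasDerivAt A A' t) (hu : IsUnit (A t).det) :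
    HasDerivAt (fun t => (A t)⁻¹) (-((A t)⁻¹ * A' * (A t)⁻¹)) t := by
  obtain ⟨u, hu'⟩ := (Matrix.isUnit_iff_isUnit_det _).2 hu
  have h := hasFDerivAt_ringInverse (𝕜 := ℝ) u
  rw [hu'] at h
  have h2 := h.comp_hasDerivAt t hA
  have h3 : ((u⁻¹ : (Matrix (Fin n) (Fin n) ℂ)ˣ) : Matrix (Fin n) (Fin n) ℂ) = (A t)⁻¹ := by
    rw [Matrix.coe_units_inv, hu']
  have h4 : (fun t => (A t)⁻¹) = Ring.inverse ∘ A := by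
    ext1 s
    exact Matrix.nonsing_inv_eq_ringInverse (A s)
  rw [h4]
  refine h2.congr_deriv ?_
  simp [h3]

theorem hasDerivAt_matrix_apply {n : ℕ} {A : ℝ → Matrix (Fin n) (Fin n) ℂ}
    {A' : Matrix (Fin n) (Fin n) ℂ} {t : ℝ} (hA : HasDerivAt A A' t) (i j : Fin n) :
    HasDerivAt (fun t => A t i j) (A' i j) t :=
  (LinearMap.toContinuousLinearMap (Matrix.entryLinearMap ℝ ℂ i j)).hasFDerivAt.comp_hasDerivAt t hA

theorem hasDerivAt_hflow_mul_toRows₁ {n : ℕ} (Q : Mat n ℂ)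
    (Φ : Matrix (Fin n ⊕ Fin n) (Fin n) ℂ) (t : ℝ) :
    HasDerivAt (fun t => (hflow Q t * Φ).toRows₁)
      ((-2 * Complex.I) • (Q * (hflow Q t * Φ)).toRows₂) t := by
  have h := hasDerivAt_linearMap_hflow
    ({ toFun := fun G => (G * Φ).toRows₁
       map_add' := fun A B => by rw [Matrix.add_mul]; rfl
       map_smul' := fun c A => by rw [Matrix.smul_mul]; rfl } :
      Mat n ℂ →ₗ[ℝ] Matrix (Fin n) (Fin n) ℂ) Q t
  have e : ((-2 * Complex.I) • (symplJ n * Q) * hflow Q t * Φ).toRows₁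
      = (-2 * Complex.I) • (Q * (hflow Q t * Φ)).toRows₂ := by
    rw [Matrix.smul_mul, Matrix.smul_mul, Matrix.mul_assoc, Matrix.mul_assoc,
      symplJ_mul_eq_fromRows]
    ext i j
    simp
  exact h.congr_deriv e

theorem hasDerivAt_hflow_mul_toRows₂ {n : ℕ} (Q : Mat n ℂ)
    (Φ : Matrix (Fin n ⊕ Fin n) (Fin n) ℂ) (t : ℝ) :
    HasDerivAt (fun t => (hflow Q t * Φ).toRows₂)
      ((2 * Complex.I) • (Q * (hflow Q t * Φ)).toRows₁) t := by
  have h := hasDerivAt_linearMap_hflow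
    ({ toFun := fun G => (G * Φ).toRows₂
       map_add' := fun A B => by rw [Matrix.add_mul]; rfl
       map_smul' := fun c A => by rw [Matrix.smul_mul]; rfl } :
      Mat n ℂ →ₗ[ℝ] Matrix (Fin n) (Fin n) ℂ) Q t
  have e : ((-2 * Complex.I) • (symplJ n * Q) * hflow Q t * Φ).toRows₂
      = (2 * Complex.I) • (Q * (hflow Q t * Φ)).toRows₁ := by
    rw [Matrix.smul_mul, Matrix.smul_mul, Matrix.mul_assoc, Matrix.mul_assoc,
      symplJ_mul_eq_fromRows]
    ext i j
    simp
  exact h.congr_deriv e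

theorem graphFrame_transpose_mul {n : ℕ} {ι : Type*} {Z : Matrix (Fin n) (Fin n) ℂ}
    (hZ : Z.IsSymm) (W : Matrix (Fin n ⊕ Fin n) ι ℂ) :
    (graphFrame Z)ᵀ * W = W.toRows₁ + Z * W.toRows₂ := by
  conv_lhs => rw [← Matrix.fromRows_toRows W]
  rw [graphFrame, Matrix.transpose_fromRows, Matrix.fromCols_mul_fromRows, hZ.eq,
    Matrix.transpose_one, Matrix.one_mul]

/-- The quotient `Z = C A⁻¹` linearizes the Riccati equation. Since `Ψ = N A` with `N = (1, Z)`, the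
factors `A` cancel and leave `2i ((QN)₁ + Z (QN)₂)`, which is `2i Nᵀ Q N` by symmetry of `Z`. -/
theorem hasDerivAt_frameZ {n : ℕ} (Q : Mat n ℂ) {Φ : Matrix (Fin n ⊕ Fin n) (Fin n) ℂ} {t : ℝ}
    (hΦ : IsPosFrame (hflow Q t * Φ)) :
    HasDerivAt (fun t => frameZ (hflow Q t * Φ)) ((2 * Complex.I) •
      ((graphFrame (frameZ (hflow Q t * Φ)))ᵀ * Q * graphFrame (frameZ (hflow Q t * Φ)))) t := by
  have h1 := hasDerivAt_hflow_mul_toRows₁ Q Φ t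
  have h2 := hasDerivAt_hflow_mul_toRows₂ Q Φ t
  have hu := hΦ.isUnit_det
  have h3 := h2.mul (hasDerivAt_matrix_inv h1 hu)
  have hN := hΦ.graphFrame_mul
  have hs := hΦ.frameZ_isSymm
  set Ψ := hflow Q t * Φ with hΨ
  set Z := frameZ Ψ with hZ
  set A := Ψ.toRows₁ with hA
  have e1 : Q * Ψ = Q * graphFrame Z * A := by rw [Matrix.mul_assoc, hN]
  have e2 : (Q * Ψ).toRows₁ = (Q * graphFrame Z).toRows₁ * A := by rw [e1]; rfl
  have e3 : (Q * Ψ).toRows₂ = (Q * graphFrame Z).toRows₂ * A := by rw [e1]; rfl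
  have e4 : A * A⁻¹ = 1 := Matrix.mul_nonsing_inv _ hu
  have key : (2 * Complex.I) • (Q * Ψ).toRows₁ * A⁻¹
      + Ψ.toRows₂ * -(A⁻¹ * (-2 * Complex.I) • (Q * Ψ).toRows₂ * A⁻¹)
      = (2 * Complex.I) • ((graphFrame Z)ᵀ * Q * graphFrame Z) := by
    have e5 : ∀ W : Matrix (Fin n) (Fin n) ℂ, Ψ.toRows₂ * (A⁻¹ * W) = Z * W := fun W => by
      rw [← Matrix.mul_assoc]; rfl
    rw [Matrix.mul_assoc _ Q, graphFrame_transpose_mul hs, e2, e3]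
    simp only [Matrix.smul_mul, Matrix.mul_smul, Matrix.mul_neg, Matrix.mul_assoc, e4,
      Matrix.mul_one, e5]
    module
  exact h3.congr_deriv key

/-- With `b` constant, only `A⁻ᵀ` is differentiated, and the linear equation for `m` results from
the same cancellation of `A`. -/
theorem hasDerivAt_frameM {n : ℕ} (Q : Mat n ℂ) (hQ : Q.IsSymm)
    {Φ : Matrix (Fin n ⊕ Fin n) (Fin n) ℂ} (b : Fin n → ℂ) {t : ℝ}
    (hΦ : IsPosFrame (hflow Q t * Φ)) (j : Fin n) :
    HasDerivAt (fun t => frameM (hflow Q t * Φ) b j) (((2 * Complex.I) •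
      ((graphFrame (frameZ (hflow Q t * Φ)))ᵀ *ᵥ Q *ᵥ xiVec (frameM (hflow Q t * Φ) b))) j) t := by
  have h1 := hasDerivAt_hflow_mul_toRows₁ Q Φ t
  have hu := hΦ.isUnit_det
  have h3 := hasDerivAt_matrix_inv h1 hu
  have h4 : HasDerivAt (fun t => frameM (hflow Q t * Φ) b j) _ t :=
    HasDerivAt.fun_sum (u := Finset.univ) fun i _ =>
      (hasDerivAt_matrix_apply h3 i j).mul_const (b i)
  refine h4.congr_deriv ?_
  have hN := hΦ.graphFrame_mul
  set Ψ := hflow Q t * Φ with hΨ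
  set Z := frameZ Ψ with hZ
  set A := Ψ.toRows₁ with hA
  have e1 : Q * Ψ = Q * graphFrame Z * A := by rw [Matrix.mul_assoc, hN]
  have e3 : (Q * Ψ).toRows₂ = (Q * graphFrame Z).toRows₂ * A := by rw [e1]; rfl
  have e4 : A * A⁻¹ = 1 := Matrix.mul_nonsing_inv _ hu
  have e5 : -(A⁻¹ * (-2 * Complex.I) • (Q * Ψ).toRows₂ * A⁻¹)
      = (2 * Complex.I) • (A⁻¹ * (Q * graphFrame Z).toRows₂) := by
    rw [e3]
    simp only [Matrix.smul_mul, Matrix.mul_smul, Matrix.mul_assoc, e4, Matrix.mul_one]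
    module
  have e6 : (graphFrame Z)ᵀ *ᵥ Q *ᵥ xiVec (frameM Ψ b)
      = (A⁻¹ * (Q * graphFrame Z).toRows₂)ᵀ *ᵥ b := by
    have h7 : (graphFrame Z)ᵀ *ᵥ Q *ᵥ xiVec (frameM Ψ b)
        = (Q * graphFrame Z)ᵀ *ᵥ xiVec (frameM Ψ b) := by
      rw [Matrix.transpose_mul, hQ.eq, Matrix.mulVec_mulVec]
    rw [h7, Matrix.transpose_mul A⁻¹, ← Matrix.mulVec_mulVec]
    conv_lhs => rw [← Matrix.fromRows_toRows (Q * graphFrame Z), Matrix.transpose_fromRows]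
    rw [xiVec, Matrix.fromCols_mulVec_sumElim, Matrix.mulVec_zero, zero_add]
    rfl
  rw [e5, e6]
  simp only [Matrix.smul_apply, Pi.smul_apply, Matrix.mulVec, dotProduct, Finset.smul_sum,
    Matrix.transpose_apply, smul_mul_assoc]

/-- Gaussians evolve by moving their frame along the Hamiltonian flow. -/
theorem exists_gaussS_evolution {n : ℕ} {Q : Mat n ℂ} (hQ : IsAccretive Q)
    {Φ : Matrix (Fin n ⊕ Fin n) (Fin n) ℂ} (hΦ : IsPosFrame Φ) (b : Fin n → ℂ) (κ₀ : ℂ) :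
    ∃ κ : ℝ → ℂ, κ 0 = κ₀ ∧ ∀ s, 0 ≤ s →
      HasDerivAt (fun t => ((gaussS (frameZ (hflow Q t * Φ)) (frameM (hflow Q t * Φ) b)
        (κ t)).toLp 2 : L2 n))
      (-(weylS Q (gaussS (frameZ (hflow Q s * Φ)) (frameM (hflow Q s * Φ) b) (κ s))).toLp 2) s := by
  have hpos : ∀ s : ℝ, 0 ≤ s → IsPosFrame (hflow Q s * Φ) := fun s hs => hΦ.hflow_mul hQ hs
  set Z : ℝ → Matrix (Fin n) (Fin n) ℂ := fun t => frameZ (hflow Q t * Φ) with hZ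
  set m : ℝ → Fin n → ℂ := fun t => frameM (hflow Q t * Φ) b with hm
  have hZd : ∀ s : ℝ, 0 ≤ s → _ := fun s hs => hasDerivAt_frameZ Q (hpos s hs)
  have hmd : ∀ s : ℝ, 0 ≤ s → _ := fun s hs => hasDerivAt_frameM Q hQ.symm b (hpos s hs)
  set h : ℝ → ℂ := fun s => -(xiVec (m s) ⬝ᵥ Q *ᵥ xiVec (m s)) - gaussTrace Q (Z s) with hh
  have hmc : ∀ i, ContinuousOn (fun s => xiVec (m s) i) (Set.Ici 0) := by
    rintro (i | i) s hs
    · exact continuousWithinAt_const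
    · exact (hmd s hs i).continuousAt.continuousWithinAt
  have hZc : ∀ i j, ContinuousOn (fun s => graphFrame (Z s) i j) (Set.Ici 0) := by
    rintro (i | i) j s hs
    · exact continuousWithinAt_const
    · exact (hasDerivAt_matrix_apply (hZd s hs) i j).continuousAt.continuousWithinAt
  have hc : ContinuousOn h (Set.Ici 0) := by
    refine ContinuousOn.sub (ContinuousOn.neg ?_) (ContinuousOn.mul continuousOn_const ?_)
    · refine continuousOn_finsetSum _ fun i _ => (hmc i).mul ?_
      exact continuousOn_finsetSum Finset.univ (f := fun j s => Q i j * xiVec (m s) j)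
        fun j _ => continuousOn_const.mul (hmc j)
    · refine continuousOn_finsetSum _ fun k _ => ?_
      simp only [Matrix.mul_apply]
      exact continuousOn_finsetSum _ fun j _ => continuousOn_const.mul (hZc j k)
  -- The rate `h` is controlled only for `s ≥ 0`. Freezing it for negative times keeps it
  -- continuous, so that its primitive has a two-sided derivative at `0` as well.
  have hc' : Continuous fun s => h (max 0 s) :=
    hc.comp_continuous (by fun_prop) fun s => Set.mem_Ici.2 (le_max_left _ _)
  refine ⟨fun t => κ₀ + ∫ s in (0 : ℝ)..t, h (max 0 s), by simp, fun s hs => ?_⟩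
  refine hasDerivAt_gaussS_of_riccati hQ.symm (hpos s hs).frameZ_isSymm
    (hpos s hs).frameZ_imPosDef (hasDerivAt_matrix_apply (hZd s hs)) (hmd s hs) ?_
  have h1 := (intervalIntegral.integral_hasDerivAt_right (hc'.intervalIntegrable 0 s)
    (hc'.stronglyMeasurableAtFilter _ _) hc'.continuousAt).const_add κ₀
  rw [max_eq_right hs] at h1
  exact h1

end Flow

theorem IsSemigroupOf.exists_apply_gaussS {n : ℕ} {q : QuadraticMap ℝ (Phase n) ℂ}
    {S : ℝ → L2 n →L[ℂ] L2 n} (hS : IsSemigroupOf q S) (hq : IsAccretive (formMatrix q))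
    {Φ : Matrix (Fin n ⊕ Fin n) (Fin n) ℂ} (hΦ : IsPosFrame Φ) (b : Fin n → ℂ) (κ₀ : ℂ)
    {t : ℝ} (ht : 0 ≤ t) :
    ∃ κ : ℂ, S t ((gaussS (frameZ Φ) (frameM Φ b) κ₀).toLp 2)
      = (gaussS (frameZ (hflow (formMatrix q) t * Φ)) (frameM (hflow (formMatrix q) t * Φ) b)
          κ).toLp 2 := by
  obtain ⟨κ, h0, h⟩ := exists_gaussS_evolution hq hΦ b κ₀
  refine ⟨κ t, ?_⟩
  have := hS.apply_toLp h ht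
  simpa only [hflow_zero, Matrix.one_mul, h0] using this

theorem IsSemigroupOf.exists_adjoint_apply_gaussS {n : ℕ} {q : QuadraticMap ℝ (Phase n) ℂ}
    {S : ℝ → L2 n →L[ℂ] L2 n} (hS : IsSemigroupOf q S) (hq : IsAccretive (formMatrix q))
    {Φ : Matrix (Fin n ⊕ Fin n) (Fin n) ℂ} (hΦ : IsPosFrame Φ) (b : Fin n → ℂ) (κ₀ : ℂ)
    {t : ℝ} (ht : 0 ≤ t) :
    ∃ κ : ℂ, ContinuousLinearMap.adjoint (S t) ((gaussS (frameZ Φ) (frameM Φ b) κ₀).toLp 2)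
      = (gaussS (frameZ (hflow (formMatrix q)ᴴ t * Φ)) (frameM (hflow (formMatrix q)ᴴ t * Φ) b)
          κ).toLp 2 := by
  obtain ⟨κ, h0, h⟩ := exists_gaussS_evolution hq.conjTranspose hΦ b κ₀
  refine ⟨κ t, ?_⟩
  have := hS.adjoint_apply_toLp h ht
  simpa only [hflow_zero, Matrix.one_mul, h0] using this

/-- The parameters `Z`, `m` of a Gaussian are determined by its class in `L²`. -/
theorem gaussS_toLp_injective {n : ℕ} {Z Z' : Matrix (Fin n) (Fin n) ℂ} (hZ : ImPosDef Z)
    (hZ' : ImPosDef Z') (hs : Z.IsSymm) (hs' : Z'.IsSymm) {m m' : Fin n → ℂ} {κ κ' : ℂ}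
    (h : ((gaussS Z m κ).toLp 2 : L2 n) = (gaussS Z' m' κ').toLp 2) : Z = Z' ∧ m = m' := by
  have h1 : gaussS Z m κ = gaussS Z' m' κ' := SchwartzMap.injective_toLp 2 volume h
  have h2 : ∀ x, Complex.exp (gaussExponent (Z - Z') (m - m') (κ - κ') x) = 1 := by
    intro x
    have := DFunLike.congr_fun h1 x
    rw [gaussS_apply hZ, gaussS_apply hZ'] at this
    rw [← gaussExponent_sub, Complex.exp_sub, this, div_self (Complex.exp_ne_zero _)]
  have hD : (Z - Z').IsSymm := hs.sub hs'
  set D := Z - Z'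
  set d := m - m'
  set k := κ - κ'
  -- Equality of exponentials fixes the exponent only modulo `2πi`; differentiating it removes the
  -- ambiguity.
  have h4 : ∀ x : EuclideanSpace ℝ (Fin n), D *ᵥ cvec x + d = 0 := by
    intro x
    ext j
    obtain ⟨h5, h6⟩ := fderiv_gaussExponent hD d k x j
    have h7 := h5.hasFDerivAt.cexp
    have h8 : (fun x => Complex.exp (gaussExponent D d k x)) = fun _ => 1 := funext h2
    rw [h8] at h7
    have h9 := DFunLike.congr_fun (h7.unique (hasFDerivAt_const _ _))
      (EuclideanSpace.single j (1 : ℝ))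
    rw [smul_apply, h6, h2] at h9
    simpa using h9
  have hd : d = 0 := by
    have := h4 0
    have h0 : cvec (0 : EuclideanSpace ℝ (Fin n)) = 0 := by ext j; simp [cvec]
    rwa [h0, Matrix.mulVec_zero, zero_add] at this
  refine ⟨sub_eq_zero.1 ?_, sub_eq_zero.1 hd⟩
  ext i j
  have h5 := congrFun (h4 (EuclideanSpace.single j 1)) i
  have h6 : cvec (EuclideanSpace.single j (1 : ℝ)) = Pi.single j 1 := by
    ext l
    by_cases h : l = j
    · subst h; simp [cvec]
    · simp [cvec, h]
  rw [h6, hd, add_zero, Matrix.mulVec_single_one] at h5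
  exact h5

/-- `Z` gives only the Lagrangian subspace; the linear parts `A⁻ᵀ b` for all `b` recover the upper
block, hence the frame. This is why Gaussians with linear terms are needed. -/
theorem IsPosFrame.eq_of_forall {n : ℕ} {Φ Ψ : Matrix (Fin n ⊕ Fin n) (Fin n) ℂ}
    (hΦ : IsPosFrame Φ) (hΨ : IsPosFrame Ψ) (hZ : frameZ Φ = frameZ Ψ)
    (hm : ∀ b, frameM Φ b = frameM Ψ b) : Φ = Ψ := by
  have h1 : (Φ.toRows₁⁻¹)ᵀ = (Ψ.toRows₁⁻¹)ᵀ := Matrix.ext_of_mulVec_single fun i => hm _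
  have h2 : Φ.toRows₁ = Ψ.toRows₁ := by
    rw [← Matrix.nonsing_inv_nonsing_inv _ hΦ.isUnit_det,
      ← Matrix.nonsing_inv_nonsing_inv _ hΨ.isUnit_det, Matrix.transpose_injective h1]
  rw [← hΦ.graphFrame_mul, ← hΨ.graphFrame_mul, hZ, h2]

open scoped ComplexOrder in
theorem re_star_dotProduct_self_pos {ι : Type*} [Fintype ι] {v : ι → ℂ} (hv : v ≠ 0) :
    0 < (star v ⬝ᵥ v).re :=
  (Complex.pos_iff.1 (Matrix.dotProduct_star_self_pos_iff.2 hv)).1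

/-- The frame `(1, ic)`. -/
theorem isPosFrame_graphFrame {n : ℕ} {c : ℝ} (hc : 0 < c) :
    IsPosFrame (graphFrame ((c * Complex.I) • (1 : Matrix (Fin n) (Fin n) ℂ))) where
  lagrangian := by
    rw [Matrix.mul_assoc, symplJ_mul_eq_fromRows, graphFrame, Matrix.transpose_fromRows,
      Matrix.fromCols_mul_fromRows]
    simp
  pos v hv := by
    rw [graphFrame, Matrix.fromRows_mulVec, symplIm_sumElim, Matrix.smul_mulVec,
      Matrix.one_mulVec, dotProduct_smul]
    have h1 := re_star_dotProduct_self_pos hv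
    simp only [smul_eq_mul, Complex.mul_im]
    simp
    positivity

/-- A matrix is determined by its values on the frames `(1, ic)`, `c = 1, 2`. -/
theorem eq_of_mul_isPosFrame {n : ℕ} {G G' : Mat n ℂ}
    (key : ∀ Φ : Matrix (Fin n ⊕ Fin n) (Fin n) ℂ, IsPosFrame Φ → G * Φ = G' * Φ) : G = G' := by
  have h1 := key _ (isPosFrame_graphFrame one_pos)
  have h2 := key _ (isPosFrame_graphFrame two_pos)
  have hsplit : ∀ (M : Mat n ℂ) (c : ℝ),
      M * graphFrame ((c * Complex.I) • (1 : Matrix (Fin n) (Fin n) ℂ))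
        = M.toCols₁ + (c * Complex.I) • M.toCols₂ := by
    -- On the frame `(1, ic)` a matrix with column blocks `(M₁, M₂)` takes the value `M₁ + ic M₂`,
    -- and two values of `c` separate the blocks.
    intro M c
    conv_lhs => rw [← Matrix.fromCols_toCols M]
    rw [graphFrame, Matrix.fromCols_mul_fromRows, Matrix.mul_smul, Matrix.mul_one, Matrix.mul_one]
  rw [hsplit, hsplit] at h1 h2
  have h3 : G.toCols₂ = G'.toCols₂ := by
    ext i j
    have e1 := congrFun (congrFun h1 i) j
    have e2 := congrFun (congrFun h2 i) j
    simp at e1 e2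
    have e3 : Complex.I * G i (Sum.inr j) = Complex.I * G' i (Sum.inr j) := by
      linear_combination e2 - e1
    exact mul_left_cancel₀ Complex.I_ne_zero e3
  have h4 : G.toCols₁ = G'.toCols₁ := by rwa [h3, add_left_inj] at h1
  rw [← Matrix.fromCols_toCols G, ← Matrix.fromCols_toCols G', h3, h4]

theorem IsSemigroupOf.exists_apply_adjoint_apply_gaussS {n : ℕ} {q : QuadraticMap ℝ (Phase n) ℂ}
    {S : ℝ → L2 n →L[ℂ] L2 n} (hS : IsSemigroupOf q S) (hq : IsAccretive (formMatrix q))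
    {Φ : Matrix (Fin n ⊕ Fin n) (Fin n) ℂ} (hΦ : IsPosFrame Φ) (b : Fin n → ℂ) {t : ℝ}
    (ht : 0 ≤ t) :
    ∃ κ : ℂ, S t (ContinuousLinearMap.adjoint (S t)
        ((gaussS (frameZ Φ) (frameM Φ b) 0).toLp 2))
      = (gaussS (frameZ (hflow (formMatrix q) t * (hflow (formMatrix q)ᴴ t * Φ)))
          (frameM (hflow (formMatrix q) t * (hflow (formMatrix q)ᴴ t * Φ)) b) κ).toLp 2 := by
  obtain ⟨κ₁, h1⟩ := hS.exists_adjoint_apply_gaussS hq hΦ b 0 ht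
  obtain ⟨κ₂, h2⟩ := hS.exists_apply_gaussS hq (hΦ.hflow_mul hq.conjTranspose ht) b κ₁ ht
  exact ⟨κ₂, by rw [h1, h2]⟩

/-- The classical counterpart of `e^{-tq^w} (e^{-tq^w})* = e^{-ta^w} (e^{-ta^w})*`. -/
theorem hflow_mul_hflow_eq {n : ℕ} {q a : QuadraticMap ℝ (Phase n) ℂ}
    (hq : IsAccretive (formMatrix q)) (ha : IsAccretive (formMatrix a))
    {S E : ℝ → L2 n →L[ℂ] L2 n} (hS : IsSemigroupOf q S) (hE : IsSemigroupOf a E) {t : ℝ}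
    (ht : 0 ≤ t) {U : L2 n ≃ₗᵢ[ℂ] L2 n} (hU : ∀ u, S t u = E t (U u)) :
    hflow (formMatrix q) t * hflow (formMatrix q)ᴴ t
      = hflow (formMatrix a) t * hflow (formMatrix a)ᴴ t := by
  refine eq_of_mul_isPosFrame fun Φ hΦ => ?_
  rw [Matrix.mul_assoc, Matrix.mul_assoc]
  have hΦq := (hΦ.hflow_mul hq.conjTranspose ht).hflow_mul hq ht
  have hΦa := (hΦ.hflow_mul ha.conjTranspose ht).hflow_mul ha ht
  have h : ∀ b, frameZ (hflow (formMatrix q) t * (hflow (formMatrix q)ᴴ t * Φ))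
        = frameZ (hflow (formMatrix a) t * (hflow (formMatrix a)ᴴ t * Φ))
      ∧ frameM (hflow (formMatrix q) t * (hflow (formMatrix q)ᴴ t * Φ)) b
        = frameM (hflow (formMatrix a) t * (hflow (formMatrix a)ᴴ t * Φ)) b := by
    intro b
    obtain ⟨κ₁, h1⟩ := hS.exists_apply_adjoint_apply_gaussS hq hΦ b ht
    obtain ⟨κ₂, h2⟩ := hE.exists_apply_adjoint_apply_gaussS ha hΦ b ht
    refine gaussS_toLp_injective hΦq.frameZ_imPosDef hΦa.frameZ_imPosDef
      hΦq.frameZ_isSymm hΦa.frameZ_isSymm (h1.symm.trans (Eq.trans ?_ h2))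
    exact DFunLike.congr_fun (comp_adjoint_eq_of_polar hU) _
  exact hΦq.eq_of_forall hΦa (h 0).1 fun b => (h b).2

/-! ### Matrices of quadratic forms -/

/-- A real phase space vector, seen as a complex one. -/
def rvec {n : ℕ} (X : Phase n) : Fin n ⊕ Fin n → ℂ := fun i => (X i : ℂ)

theorem formMatrix_isSymm {n : ℕ} (q : QuadraticMap ℝ (Phase n) ℂ) : (formMatrix q).IsSymm := by
  ext i j
  simp [formMatrix, QuadraticMap.polar_comm]

theorem rvec_dotProduct_formMatrix_mulVec {n : ℕ} (q : QuadraticMap ℝ (Phase n) ℂ)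
    (X Y : Phase n) :
    rvec X ⬝ᵥ formMatrix q *ᵥ rvec Y = QuadraticMap.polar q X Y / 2 := by
  have h : ∀ Z : Phase n, Z = ∑ i, Z i • (Pi.single i 1 : Phase n) := fun Z => by
    ext j; simp [Finset.sum_apply, Pi.single_apply]
  have h1 : QuadraticMap.polar q X Y
      = ∑ i, ∑ j, (X i : ℂ) * ((Y j : ℂ) * QuadraticMap.polar q (Pi.single i 1) (Pi.single j 1)) := by
    rw [← QuadraticMap.polarBilin_apply_apply]
    conv_lhs => rw [h X, h Y]
    simp [map_sum, LinearMap.sum_apply, Finset.mul_sum, -Fintype.sum_sum_type]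
    rw [Finset.sum_comm]
    refine Finset.sum_congr rfl fun i _ => Finset.sum_congr rfl fun j _ => by ring
  rw [h1, Finset.sum_div]
  simp only [dotProduct, Matrix.mulVec, Finset.mul_sum, Finset.sum_div, rvec, formMatrix,
    Matrix.of_apply]
  exact Finset.sum_congr rfl fun i _ => Finset.sum_congr rfl fun j _ => by ring

theorem rvec_dotProduct_formMatrix_mulVec_self {n : ℕ} (q : QuadraticMap ℝ (Phase n) ℂ)
    (X : Phase n) : rvec X ⬝ᵥ formMatrix q *ᵥ rvec X = q X := by
  rw [rvec_dotProduct_formMatrix_mulVec, QuadraticMap.polar_self]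
  simp

/-- In `Y = u + iv` the cross terms cancel by symmetry of the matrix, so non-negativity on real
points extends to the Hermitian form. -/
theorem re_star_dotProduct_formMatrix_mulVec {n : ℕ} (q : QuadraticMap ℝ (Phase n) ℂ)
    (Y : Fin n ⊕ Fin n → ℂ) :
    (star Y ⬝ᵥ formMatrix q *ᵥ Y).re
      = (q fun i => (Y i).re).re + (q fun i => (Y i).im).re := by
  set u : Phase n := fun i => (Y i).re
  set v : Phase n := fun i => (Y i).im
  have h1 : Y = rvec u + Complex.I • rvec v := by
    ext i
    simp only [Pi.add_apply, Pi.smul_apply, rvec, u, v, smul_eq_mul]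
    rw [mul_comm]
    exact (Complex.re_add_im (Y i)).symm
  have h2 : star Y = rvec u - Complex.I • rvec v := by
    rw [h1]
    ext i
    simp [rvec, sub_eq_add_neg]
  have h3 : star Y ⬝ᵥ formMatrix q *ᵥ Y = q u + q v := by
    rw [h2]
    conv_lhs => rw [h1]
    simp only [Matrix.mulVec_add, Matrix.mulVec_smul, dotProduct_add, sub_dotProduct,
      dotProduct_smul, smul_dotProduct, rvec_dotProduct_formMatrix_mulVec_self,
      rvec_dotProduct_formMatrix_mulVec, smul_eq_mul, QuadraticMap.polar_comm q v u]
    linear_combination (-q v) * Complex.I_sq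
  rw [h3, Complex.add_re]

theorem isAccretive_formMatrix {n : ℕ} {q : QuadraticMap ℝ (Phase n) ℂ}
    (hq : ∀ X, 0 ≤ (q X).re) : IsAccretive (formMatrix q) where
  symm := formMatrix_isSymm q
  nonneg Y := by
    rw [re_star_dotProduct_formMatrix_mulVec]
    exact add_nonneg (hq _) (hq _)

theorem formMatrix_toComplexForm_conjTranspose {n : ℕ} (a : QuadraticForm ℝ (Phase n)) :
    (formMatrix (toComplexForm a))ᴴ = formMatrix (toComplexForm a) := by
  ext i j
  rw [Matrix.conjTranspose_apply, (formMatrix_isSymm (toComplexForm a)).apply]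
  simp [formMatrix, toComplexForm, QuadraticMap.polar]

/-! ### Energy identities -/

/-- The squared Hermitian norm. -/
def normSq {ι : Type*} [Fintype ι] (Y : ι → ℂ) : ℝ := ∑ i, ‖Y i‖ ^ 2

theorem symplIm_le_normSq {n : ℕ} (Y : Fin n ⊕ Fin n → ℂ) : symplIm Y ≤ normSq Y := by
  have h : Y = Sum.elim (fun i => Y (Sum.inl i)) (fun i => Y (Sum.inr i)) := by
    ext (i | i) <;> rfl
  have h1 : symplIm Y = ∑ i, 2 * (star (Y (Sum.inl i)) * Y (Sum.inr i)).im := by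
    conv_lhs => rw [h, symplIm_sumElim]
    rw [dotProduct, Complex.im_sum, Finset.mul_sum]
    rfl
  rw [h1, normSq, Fintype.sum_sum_type, ← Finset.sum_add_distrib]
  refine Finset.sum_le_sum fun i _ => ?_
  have h2 := (Complex.abs_im_le_norm (star (Y (Sum.inl i)) * Y (Sum.inr i)))
  rw [norm_mul, norm_star] at h2
  nlinarith [abs_le.1 h2, sq_nonneg (‖Y (Sum.inl i)‖ - ‖Y (Sum.inr i)‖)]

theorem symplIm_hflow_conjTranspose {n : ℕ} (Q : Mat n ℂ) (t : ℝ) (x : Fin n ⊕ Fin n → ℂ) :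
    symplIm (hflow Qᴴ t *ᵥ x)
      = (star x ⬝ᵥ symplJ n *ᵥ (hflow Q t * hflow Qᴴ t) *ᵥ x).im := by
  rw [symplIm, Matrix.star_mulVec, ← Matrix.dotProduct_mulVec, Matrix.mulVec_mulVec,
    hflow_conjTranspose_mul_symplJ, Matrix.mulVec_mulVec, Matrix.mulVec_mulVec, Matrix.mul_assoc]

theorem continuous_re_star_dotProduct_hflow {n : ℕ} (Q Q' : Mat n ℂ) (x : Fin n ⊕ Fin n → ℂ) :
    Continuous fun s => (star (hflow Q s *ᵥ x) ⬝ᵥ Q' *ᵥ hflow Q s *ᵥ x).re := by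
  have h : Continuous fun s => hflow Q s *ᵥ x :=
    continuous_iff_continuousAt.2 fun s => (hasDerivAt_hflow_mulVec Q x s).continuousAt
  exact Complex.continuous_re.comp
    (h.star.dotProduct (continuous_const.matrix_mulVec h))

theorem integral_re_star_dotProduct_hflow {n : ℕ} (Q : Mat n ℂ) (x : Fin n ⊕ Fin n → ℂ) (t : ℝ) :
    4 * ∫ s in (0 : ℝ)..t, (star (hflow Q s *ᵥ x) ⬝ᵥ Q *ᵥ hflow Q s *ᵥ x).re
      = symplIm (hflow Q t *ᵥ x) - symplIm x := by
  have h := intervalIntegral.integral_eq_sub_of_hasDerivAt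
    (fun s (_ : s ∈ Set.uIcc 0 t) => hasDerivAt_symplIm (hasDerivAt_hflow_mulVec Q x s))
    (((continuous_re_star_dotProduct_hflow Q Q x).const_mul 4).intervalIntegrable 0 t)
  rw [intervalIntegral.integral_const_mul] at h
  simpa using h

/-- Both integrals are the increment of `Im (Y* J Y) / 4` along their flow; the initial values
agree, and the final ones are read off the two products, equal by hypothesis. -/
theorem integral_energy_eq {n : ℕ} {Q A : Mat n ℂ} {t : ℝ}
    (h : hflow Q t * hflow Qᴴ t = hflow A t * hflow Aᴴ t) (x : Fin n ⊕ Fin n → ℂ) :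
    ∫ s in (0 : ℝ)..t, (star (hflow Qᴴ s *ᵥ x) ⬝ᵥ Q *ᵥ hflow Qᴴ s *ᵥ x).re
      = ∫ s in (0 : ℝ)..t, (star (hflow Aᴴ s *ᵥ x) ⬝ᵥ A *ᵥ hflow Aᴴ s *ᵥ x).re := by
  have h1 := integral_re_star_dotProduct_hflow Qᴴ x t
  have h2 := integral_re_star_dotProduct_hflow Aᴴ x t
  rw [symplIm_hflow_conjTranspose] at h1 h2
  simp only [re_star_dotProduct_conjTranspose_mulVec] at h1 h2
  rw [h] at h1
  linarith

/-- With `W = AY` and `A` Hermitian, the derivative is `2 Re (-2i W* J W)`. It is therefore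
controlled by `|AY|²`, which the energy itself dominates. -/
theorem hasDerivAt_energy_of_conjTranspose_eq {n : ℕ} {A : Mat n ℂ} (hA : Aᴴ = A)
    (x : Fin n ⊕ Fin n → ℂ) (s : ℝ) :
    HasDerivAt (fun s => (star (hflow A s *ᵥ x) ⬝ᵥ A *ᵥ hflow A s *ᵥ x).re)
      (4 * symplIm (A *ᵥ hflow A s *ᵥ x)) s := by
  have h1 := hasDerivAt_hflow_mulVec A x s
  have h2 := HasDerivAt.star_dotProduct h1 (HasDerivAt.const_mulVec A h1)
  have h3 := Complex.reCLM.hasFDerivAt.comp_hasDerivAt s h2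
  refine h3.congr_deriv ?_
  set Y := hflow A s *ᵥ x
  set W := A *ᵥ Y with hW
  have e1 : star Y ⬝ᵥ A *ᵥ ((-2 * Complex.I) • (symplJ n *ᵥ W))
      = star W ⬝ᵥ (-2 * Complex.I) • (symplJ n *ᵥ W) := by
    rw [hW, Matrix.star_mulVec A Y, hA, ← Matrix.dotProduct_mulVec]
  rw [e1, star_dotProduct_star_comm]
  rw [dotProduct_smul, symplIm]
  simp
  ring

/-- Exponential bound on the energy along the flow of a real non-negative form. -/
theorem energy_le_exp_mul {n : ℕ} {A : Mat n ℂ} (hA : Aᴴ = A) {K : ℝ}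
    (hK : ∀ Y, normSq (A *ᵥ Y) ≤ K * (star Y ⬝ᵥ A *ᵥ Y).re) (x : Fin n ⊕ Fin n → ℂ) {s : ℝ}
    (hs : 0 ≤ s) :
    (star (hflow A s *ᵥ x) ⬝ᵥ A *ᵥ hflow A s *ᵥ x).re
      ≤ Real.exp (4 * K * s) * (star x ⬝ᵥ A *ᵥ x).re := by
  set N : ℝ → ℝ := fun s => (star (hflow A s *ᵥ x) ⬝ᵥ A *ᵥ hflow A s *ᵥ x).re with hN
  have hd : ∀ r, HasDerivAt (fun r => Real.exp (-(4 * K) * r) * N r)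
      (Real.exp (-(4 * K) * r) * (-(4 * K)) * N r
        + Real.exp (-(4 * K) * r) * (4 * symplIm (A *ᵥ hflow A r *ᵥ x))) r := fun r => by
    have h1 : HasDerivAt (fun r : ℝ => Real.exp (-(4 * K) * r))
        (Real.exp (-(4 * K) * r) * (-(4 * K))) r := by
      simpa using ((hasDerivAt_id r).const_mul (-(4 * K))).exp
    exact h1.mul (hasDerivAt_energy_of_conjTranspose_eq hA x r)
  have hanti : Antitone fun r => Real.exp (-(4 * K) * r) * N r := by
    refine antitone_of_hasDerivAt_nonpos hd fun r => ?_
    have h1 := (symplIm_le_normSq (A *ᵥ hflow A r *ᵥ x)).trans (hK _)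
    have h2 : 0 < Real.exp (-(4 * K) * r) := Real.exp_pos _
    have h3 : Real.exp (-(4 * K) * r) * (-(4 * K)) * N r
        + Real.exp (-(4 * K) * r) * (4 * symplIm (A *ᵥ hflow A r *ᵥ x))
        = Real.exp (-(4 * K) * r) * (4 * (symplIm (A *ᵥ hflow A r *ᵥ x) - K * N r)) := by ring
    rw [h3]
    exact mul_nonpos_of_nonneg_of_nonpos h2.le (by linarith)
  have h1 := hanti hs
  simp only [mul_zero, Real.exp_zero, one_mul] at h1
  have h2 : N 0 = (star x ⬝ᵥ A *ᵥ x).re := by simp [hN]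
  rw [h2] at h1
  calc N s = Real.exp (4 * K * s) * (Real.exp (-(4 * K) * s) * N s) := by
        rw [← mul_assoc, ← Real.exp_add]; simp
    _ ≤ _ := by gcongr

/-! ### Factorization of the real part of a form -/

open scoped MatrixOrder Matrix.Norms.L2Operator in
theorem exists_eq_transpose_mul_self {ι : Type*} [Fintype ι] [DecidableEq ι] {R : Matrix ι ι ℝ}
    (h : R.PosSemidef) : ∃ P : Matrix ι ι ℝ, R = Pᵀ * P := by
  obtain ⟨P, hP⟩ := CStarAlgebra.nonneg_iff_eq_star_mul_self.1 h.nonneg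
  exact ⟨P, by rw [hP, Matrix.star_eq_conjTranspose, Matrix.conjTranspose_eq_transpose_of_trivial]⟩

/-- A factorization `Re Q = Pᵀ P` of the real part of an accretive form. -/
theorem exists_re_formMatrix_eq {n : ℕ} {q : QuadraticMap ℝ (Phase n) ℂ}
    (hq : ∀ X, 0 ≤ (q X).re) :
    ∃ P : Mat n ℝ, (formMatrix q).map Complex.re = Pᵀ * P := by
  have h : ((formMatrix q).map Complex.re).PosSemidef := by
    refine Matrix.PosSemidef.of_dotProduct_mulVec_nonneg ?_ fun X => ?_
    · ext i j
      simp [(formMatrix_isSymm q).apply i j]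
    · have h1 := congrArg Complex.re (rvec_dotProduct_formMatrix_mulVec_self q X)
      have h2 : (rvec X ⬝ᵥ formMatrix q *ᵥ rvec X).re
          = star X ⬝ᵥ (formMatrix q).map Complex.re *ᵥ X := by
        simp [dotProduct, Matrix.mulVec, rvec, Complex.re_sum, -Fintype.sum_sum_type]
      rw [← h2, h1]
      exact hq X
  exact exists_eq_transpose_mul_self h

theorem re_apply_eq_of_re_formMatrix_eq {n : ℕ} {q : QuadraticMap ℝ (Phase n) ℂ} {P : Mat n ℝ}
    (hP : (formMatrix q).map Complex.re = Pᵀ * P) (X : Phase n) :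
    (q X).re = ∑ i, (P *ᵥ X) i ^ 2 := by
  have h1 := congrArg Complex.re (rvec_dotProduct_formMatrix_mulVec_self q X)
  have h2 : (rvec X ⬝ᵥ formMatrix q *ᵥ rvec X).re
      = X ⬝ᵥ (formMatrix q).map Complex.re *ᵥ X := by
    simp [dotProduct, Matrix.mulVec, rvec, Complex.re_sum, -Fintype.sum_sum_type]
  rw [← h1, h2, hP, ← Matrix.mulVec_mulVec, Matrix.dotProduct_mulVec, Matrix.vecMul_transpose]
  simp only [dotProduct, sq]

theorem re_star_dotProduct_eq_normSq {n : ℕ} {q : QuadraticMap ℝ (Phase n) ℂ} {P : Mat n ℝ}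
    (hP : (formMatrix q).map Complex.re = Pᵀ * P) (Y : Fin n ⊕ Fin n → ℂ) :
    (star Y ⬝ᵥ formMatrix q *ᵥ Y).re = normSq (P.map Complex.ofReal *ᵥ Y) := by
  rw [re_star_dotProduct_formMatrix_mulVec, re_apply_eq_of_re_formMatrix_eq hP,
    re_apply_eq_of_re_formMatrix_eq hP, normSq, ← Finset.sum_add_distrib]
  refine Finset.sum_congr rfl fun i _ => ?_
  rw [← Complex.normSq_eq_norm_sq, Complex.normSq_apply]
  have h1 : ((P.map Complex.ofReal *ᵥ Y) i).re = (P *ᵥ fun i => (Y i).re) i := by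
    simp [Matrix.mulVec, dotProduct, -Fintype.sum_sum_type]
  have h2 : ((P.map Complex.ofReal *ᵥ Y) i).im = (P *ᵥ fun i => (Y i).im) i := by
    simp [Matrix.mulVec, dotProduct, -Fintype.sum_sum_type]
  rw [h1, h2]
  ring

theorem normSq_mulVec_le {ι ι' : Type*} [Fintype ι] [Fintype ι'] (B : Matrix ι' ι ℂ)
    (Y : ι → ℂ) : normSq (B *ᵥ Y) ≤ (∑ i, ∑ j, ‖B i j‖ ^ 2) * normSq Y := by
  rw [normSq, Finset.sum_mul]
  refine Finset.sum_le_sum fun i _ => ?_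
  calc ‖(B *ᵥ Y) i‖ ^ 2 ≤ (∑ j, ‖B i j‖ * ‖Y j‖) ^ 2 := by
        gcongr
        refine (norm_sum_le _ _).trans (Finset.sum_le_sum fun j _ => ?_)
        rw [norm_mul]
    _ ≤ _ := Finset.sum_mul_sq_le_sq_mul_sq _ _ _

/-- `|A Y|² ≤ (tr A) Y* A Y` for the matrix `A` of a non-negative real form. -/
theorem normSq_formMatrix_mulVec_le {n : ℕ} {a : QuadraticForm ℝ (Phase n)}
    (ha : ∀ X, 0 ≤ a X) (Y : Fin n ⊕ Fin n → ℂ) :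
    normSq (formMatrix (toComplexForm a) *ᵥ Y)
      ≤ (∑ i, a (Pi.single i 1)) * (star Y ⬝ᵥ formMatrix (toComplexForm a) *ᵥ Y).re := by
  have hre : ∀ X, (toComplexForm a X).re = a X := fun X => by simp [toComplexForm]
  obtain ⟨P, hP⟩ := exists_re_formMatrix_eq (q := toComplexForm a) fun X => by
    rw [hre]; exact ha X
  have hA : formMatrix (toComplexForm a) = (Pᵀ.map Complex.ofReal) * (P.map Complex.ofReal) := by
    have hm : (Pᵀ * P).map Complex.ofReal = (Pᵀ.map Complex.ofReal) * (P.map Complex.ofReal) :=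
      Matrix.map_mul (f := Complex.ofRealHom)
    rw [← hm, ← hP]
    ext i j
    have := congrFun (congrFun (formMatrix_toComplexForm_conjTranspose a) i) j
    rw [Matrix.conjTranspose_apply, (formMatrix_isSymm (toComplexForm a)).apply] at this
    exact (Complex.conj_eq_iff_re.1 this).symm
  -- The trace of `A = Pᵀ P` is the squared Hilbert–Schmidt norm of `Pᵀ`, which bounds `|Pᵀ (PY)|²`
  -- by a multiple of `|PY|² = Y* A Y`.
  have htr : ∑ i, a (Pi.single i 1) = ∑ i, ∑ j, ‖(Pᵀ.map Complex.ofReal) i j‖ ^ 2 := by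
    refine Finset.sum_congr rfl fun i _ => ?_
    rw [← hre, re_apply_eq_of_re_formMatrix_eq hP]
    refine Finset.sum_congr rfl fun j _ => ?_
    simp
  rw [re_star_dotProduct_eq_normSq hP, htr]
  conv_lhs => rw [hA, ← Matrix.mulVec_mulVec]
  exact normSq_mulVec_le _ _

/-! ### Uniform observability of linear systems depending on a parameter -/

section Observability

variable {E V : Type*} [NormedAddCommGroup E] [NormedSpace ℝ E] [FiniteDimensional ℝ E]
  [NormedAddCommGroup V] [NormedSpace ℝ V]

theorem hasDerivAt_exp_smul_apply (A : E →L[ℝ] E) (w : E) (σ : ℝ) :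
    HasDerivAt (fun σ : ℝ => NormedSpace.exp (σ • A) w) (A (NormedSpace.exp (σ • A) w)) σ := by
  have : CompleteSpace E := FiniteDimensional.complete ℝ E
  have h := hasDerivAt_exp_smul_const' (𝕂 := ℝ) A σ
  exact ((ContinuousLinearMap.apply ℝ E w).hasFDerivAt.comp_hasDerivAt σ h)

theorem eq_exp_smul_apply_of_hasDerivAt (A : E →L[ℝ] E) {W : ℝ → E}
    (hW : ∀ σ, HasDerivAt W (A (W σ)) σ) : W = fun σ => NormedSpace.exp (σ • A) (W 0) := by
  refine ODE_solution_unique_univ (v := fun _ => A) (s := fun _ => Set.univ) (K := ‖A‖₊) (t₀ := 0)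
    (fun _ => A.lipschitz.lipschitzOnWith) (fun t => ⟨hW t, trivial⟩)
    (fun t => ⟨hasDerivAt_exp_smul_apply A (W 0) t, trivial⟩) ?_
  simp [NormedSpace.exp_zero]

theorem exp_smul_apply_eq_zero (A : E →L[ℝ] E) {w : E} {σ : ℝ}
    (h : NormedSpace.exp (σ • A) w = 0) : w = 0 := by
  have : CompleteSpace E := FiniteDimensional.complete ℝ E
  let _ : NormedAlgebra ℚ (E →L[ℝ] E) := .restrictScalars ℚ ℝ _
  obtain ⟨u, hu⟩ := NormedSpace.isUnit_exp (σ • A)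
  have h1 : ((↑u⁻¹ : E →L[ℝ] E) * (u : E →L[ℝ] E)) w = w := by simp
  rw [← h1, hu, mul_apply_eq_comp, h, map_zero]

/-- Kalman's argument: differentiating a vanishing output on an open interval shows that all `c A^j`
vanish on the state there. The state at one time is then zero, and the exponential is invertible. -/
theorem eq_zero_of_forall_output_eq_zero (A : E →L[ℝ] E) (c : E →L[ℝ] V)
    (hobs : ∀ w, (∀ j : ℕ, c ((A ^ j) w) = 0) → w = 0) (w : E)
    (h : ∀ σ ∈ Set.Ioo (0 : ℝ) 1, c (NormedSpace.exp (σ • A) w) = 0) : w = 0 := by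
  have h1 : ∀ j : ℕ, ∀ σ ∈ Set.Ioo (0 : ℝ) 1, c ((A ^ j) (NormedSpace.exp (σ • A) w)) = 0 := by
    intro j
    induction j with
    | zero => simpa using h
    | succ j ih =>
      intro σ hσ
      have hd : HasDerivAt (fun σ : ℝ => c ((A ^ j) (NormedSpace.exp (σ • A) w)))
          (c ((A ^ j) (A (NormedSpace.exp (σ • A) w)))) σ :=
        (c.comp (A ^ j)).hasFDerivAt.comp_hasDerivAt σ (hasDerivAt_exp_smul_apply A w σ)
      have h0 : HasDerivAt (fun σ : ℝ => c ((A ^ j) (NormedSpace.exp (σ • A) w))) 0 σ :=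
        (hasDerivAt_const σ (0 : V)).congr_of_eventuallyEq
          (Filter.eventually_of_mem (isOpen_Ioo.mem_nhds hσ) ih)
      rw [pow_succ]
      exact hd.unique h0
  exact exp_smul_apply_eq_zero A
    (hobs _ fun j => h1 j (1 / 2) ⟨by norm_num, by norm_num⟩)

/-- The output energy depends continuously on the parameter and the initial state, and is positive
for nonzero states; its minimum over `[0, 1]` times the unit sphere gives a constant independent of
`t`, and homogeneity does the rest. -/
theorem exists_observability (H : ℝ → E →L[ℝ] E) (hH : Continuous H) (c : E →L[ℝ] V)
    (hobs : ∀ t ∈ Set.Icc (0 : ℝ) 1, ∀ w, (∀ j : ℕ, c ((H t ^ j) w) = 0) → w = 0) :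
    ∃ δ : ℝ, 0 < δ ∧ ∀ t ∈ Set.Icc (0 : ℝ) 1, ∀ W : ℝ → E,
      (∀ σ, HasDerivAt W (H t (W σ)) σ) →
        δ * ‖W 0‖ ^ 2 ≤ ∫ σ in (0 : ℝ)..1, ‖c (W σ)‖ ^ 2 := by
  have : CompleteSpace E := FiniteDimensional.complete ℝ E
  let _ : NormedAlgebra ℚ (E →L[ℝ] E) := .restrictScalars ℚ ℝ _
  set θ : ℝ × E → ℝ → ℝ := fun p σ => ‖c (NormedSpace.exp (σ • H p.1) p.2)‖ ^ 2 with hθ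
  have hexp : Continuous (NormedSpace.exp : (E →L[ℝ] E) → (E →L[ℝ] E)) :=
    NormedSpace.exp_continuous
  have hc : Continuous θ.uncurry := by
    have h1 : Continuous fun z : (ℝ × E) × ℝ => NormedSpace.exp (z.2 • H z.1.1) :=
      hexp.comp (continuous_snd.smul (hH.comp (continuous_fst.comp continuous_fst)))
    exact ((c.continuous.comp
      (h1.clm_apply (continuous_snd.comp continuous_fst))).norm).pow 2
  set Θ : ℝ × E → ℝ := fun p => ∫ σ in (0 : ℝ)..1, θ p σ with hΘ
  have hΘc : Continuous Θ := intervalIntegral.continuous_parametric_intervalIntegral_of_continuous'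
    hc 0 1
  have hθσ : ∀ p, Continuous (θ p) := fun p => hc.comp (Continuous.prodMk_right p)
  have hpos : ∀ p : ℝ × E, p.1 ∈ Set.Icc (0 : ℝ) 1 → p.2 ≠ 0 → 0 < Θ p := by
    intro p hp hp2
    by_contra hle
    refine hp2 (eq_zero_of_forall_output_eq_zero (H p.1) c (hobs p.1 hp) p.2 fun σ hσ => ?_)
    by_contra hne
    refine hle (intervalIntegral.integral_pos one_pos (hθσ p).continuousOn
      (fun x _ => by positivity) ⟨σ, Set.Ioo_subset_Icc_self hσ, ?_⟩)
    have := norm_pos_iff.2 hne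
    positivity
  have hK : IsCompact (Set.Icc (0 : ℝ) 1 ×ˢ Metric.sphere (0 : E) 1) := by
    have : ProperSpace E := FiniteDimensional.proper ℝ E
    exact isCompact_Icc.prod (isCompact_sphere _ _)
  obtain ⟨δ, hδ, hmin⟩ : ∃ δ > 0, ∀ p ∈ Set.Icc (0 : ℝ) 1 ×ˢ Metric.sphere (0 : E) 1, δ ≤ Θ p := by
    -- The product is empty only for the trivial space.
    rcases (Set.Icc (0 : ℝ) 1 ×ˢ Metric.sphere (0 : E) 1).eq_empty_or_nonempty with he | hne
    · exact ⟨1, one_pos, by simp [he]⟩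
    · obtain ⟨p, hp, hmin⟩ := hK.exists_isMinOn hne hΘc.continuousOn
      refine ⟨Θ p, hpos p hp.1 ?_, fun p' hp' => hmin hp'⟩
      have := hp.2
      rintro h0
      simp [h0] at this
  refine ⟨δ, hδ, fun t ht W hW => ?_⟩
  have hWe := eq_exp_smul_apply_of_hasDerivAt (H t) hW
  have hint : (∫ σ in (0 : ℝ)..1, ‖c (W σ)‖ ^ 2) = Θ (t, W 0) :=
    intervalIntegral.integral_congr fun σ _ => by
      simp only [hθ]
      exact congrArg (fun w => ‖c w‖ ^ 2) (congrFun hWe σ)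
  rw [hint]
  rcases eq_or_ne (W 0) 0 with h0 | h0
  · simp only [h0, norm_zero, hΘ, hθ, map_zero]
    simp
  · have hn : ‖W 0‖ ≠ 0 := norm_ne_zero_iff.2 h0
    have h1 : Θ (t, W 0) = ‖W 0‖ ^ 2 * Θ (t, ‖W 0‖⁻¹ • W 0) := by
      simp only [hΘ, hθ, map_smul, norm_smul, norm_inv, norm_norm]
      rw [← intervalIntegral.integral_const_mul]
      refine intervalIntegral.integral_congr fun σ _ => ?_
      field_simp
    rw [h1, mul_comm]
    refine mul_le_mul_of_nonneg_left (hmin _ ⟨ht, ?_⟩) (by positivity)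
    simp [norm_smul, hn]

end Observability

/-! ### Linear relations between iterated kernels -/

/-- `g` factors through the quotient by the common kernel, and the injection of that quotient into
`ι → V` has a linear left inverse; the `B i` are the components of the resulting map. -/
theorem exists_linearMap_comp_eq {K E V : Type*} [Field K] [AddCommGroup E] [Module K E]
    [AddCommGroup V] [Module K V] {ι : Type*} [Fintype ι] [DecidableEq ι] (f : ι → E →ₗ[K] V)
    (g : E →ₗ[K] V)
    (h : ∀ x, (∀ i, f i x = 0) → g x = 0) :
    ∃ B : ι → V →ₗ[K] V, ∀ x, g x = ∑ i, B i (f i x) := by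
  obtain ⟨G, hG⟩ : ∃ G : (ι → V) →ₗ[K] V, G ∘ₗ LinearMap.pi f = g := by
    obtain ⟨L, hL⟩ := ((LinearMap.ker (LinearMap.pi f)).liftQ (LinearMap.pi f)
      le_rfl).exists_leftInverse_of_injective (Submodule.ker_liftQ_eq_bot _ _ _ le_rfl)
    refine ⟨(LinearMap.ker (LinearMap.pi f)).liftQ g
      (fun x hx => h x fun i => congrFun hx i) ∘ₗ L, LinearMap.ext fun x => ?_⟩
    have h1 := LinearMap.congr_fun hL (Submodule.Quotient.mk x)
    simp only [LinearMap.comp_apply, Submodule.liftQ_apply, LinearMap.id_apply] at h1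
    rw [LinearMap.comp_apply, LinearMap.comp_apply, h1]
    exact Submodule.liftQ_apply _ _ _
  refine ⟨fun i => G ∘ₗ LinearMap.single K (fun _ => V) i, fun x => ?_⟩
  rw [← hG]
  simp only [LinearMap.comp_apply]
  rw [← map_sum]
  congr 1
  ext i
  simp

/-! ### Lower bounds for the integrated output of a rescaled flow -/

section CompanionFlow

variable {V : Type*} [NormedAddCommGroup V] [NormedSpace ℝ V]

/-- The system solved by `(t ^ j • P (M ^ j Y (t σ)))_j`, `j ≤ k`, when `Y' = -2 (M Y + G P Y)` and
`P M ^ (k + 1) = ∑ i, B i P M ^ i`. -/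
def companionFlow (P M G : V →L[ℝ] V) (k : ℕ) (B : Fin (k + 1) → V →L[ℝ] V) (t : ℝ) :
    (Fin (k + 1) → V) →L[ℝ] (Fin (k + 1) → V) :=
  ContinuousLinearMap.pi fun j => (-2 : ℝ) •
    ((if h : (j : ℕ) + 1 < k + 1 then
        ContinuousLinearMap.proj (R := ℝ) (φ := fun _ : Fin (k + 1) => V) ⟨j + 1, h⟩
      else ∑ i : Fin (k + 1), t ^ (k + 1 - i : ℕ) •
        (B i ∘L ContinuousLinearMap.proj (R := ℝ) (φ := fun _ : Fin (k + 1) => V) i))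
      + t ^ (j + 1 : ℕ) • (P ∘L (M ^ (j : ℕ)) ∘L G ∘L
        ContinuousLinearMap.proj (R := ℝ) (φ := fun _ : Fin (k + 1) => V) 0))

variable {P M G : V →L[ℝ] V} {k : ℕ} {B : Fin (k + 1) → V →L[ℝ] V}

theorem companionFlow_apply (t : ℝ) (W : Fin (k + 1) → V) (j : Fin (k + 1)) :
    companionFlow P M G k B t W j = (-2 : ℝ) •
      ((if h : (j : ℕ) + 1 < k + 1 then W ⟨j + 1, h⟩
        else ∑ i : Fin (k + 1), t ^ (k + 1 - i : ℕ) • B i (W i))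
        + t ^ (j + 1 : ℕ) • P ((M ^ (j : ℕ)) (G (W 0)))) := by
  simp only [companionFlow, ContinuousLinearMap.coe_pi']
  split_ifs <;> simp

theorem continuous_companionFlow [FiniteDimensional ℝ V] :
    Continuous (companionFlow P M G k B) := by
  refine continuous_clm_apply.2 fun W => continuous_pi fun j => ?_
  simp only [companionFlow_apply]
  split_ifs <;> fun_prop

/-- Row `j` of the system is `-2` times entry `j + 1` plus a term in entry `0`. If entry `0`
vanishes along all iterates, so do the following ones in turn. The coefficient of entry `j + 1` does
not involve `t`, so `t = 0` is allowed. -/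
theorem eq_zero_of_companionFlow_pow (t : ℝ) (W : Fin (k + 1) → V)
    (h : ∀ j : ℕ, (companionFlow P M G k B t ^ j) W 0 = 0) : W = 0 := by
  have h1 : ∀ i : ℕ, ∀ hi : i < k + 1, ∀ j : ℕ, (companionFlow P M G k B t ^ j) W ⟨i, hi⟩ = 0 := by
    intro i
    induction i with
    | zero => exact fun _ j => h j
    | succ i ih =>
      intro hi j
      have h2 := ih (by omega) (j + 1)
      rw [pow_succ', mul_apply_eq_comp, companionFlow_apply, h j] at h2
      simpa [hi] using h2
  ext i
  exact h1 i i.2 0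

/-- The chain rule contributes a factor `t`, which is what the weight of entry `j + 1` has over that
of entry `j`. In the last row, `P M^(k+1)` is eliminated by `hB`, leaving the non-negative powers
`t^(k+1-i)`. -/
theorem hasDerivAt_companion
    (hB : ∀ x, P ((M ^ (k + 1)) x) = ∑ i : Fin (k + 1), B i (P ((M ^ (i : ℕ)) x)))
    {Y : ℝ → V} (hY : ∀ s, HasDerivAt Y ((-2 : ℝ) • (M (Y s) + G (P (Y s)))) s) (t σ : ℝ) :
    HasDerivAt (fun (σ : ℝ) (j : Fin (k + 1)) => t ^ (j : ℕ) • P ((M ^ (j : ℕ)) (Y (t * σ))))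
      (companionFlow P M G k B t fun j => t ^ (j : ℕ) • P ((M ^ (j : ℕ)) (Y (t * σ)))) σ := by
  refine hasDerivAt_pi.2 fun j => ?_
  have h1 : HasDerivAt (fun σ => Y (t * σ))
      (t • ((-2 : ℝ) • (M (Y (t * σ)) + G (P (Y (t * σ)))))) σ := by
    have h := (hY (t * σ)).scomp σ ((hasDerivAt_id σ).const_mul t)
    rw [mul_one] at h
    exact h
  have h2 : HasDerivAt (fun σ => t ^ (j : ℕ) • P ((M ^ (j : ℕ)) (Y (t * σ))))
      (t ^ (j : ℕ) • P ((M ^ (j : ℕ)) (t • ((-2 : ℝ) • (M (Y (t * σ)) + G (P (Y (t * σ)))))))) σ :=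
    ((P ∘L (M ^ (j : ℕ))).hasFDerivAt.comp_hasDerivAt σ h1).const_smul _
  refine h2.congr_deriv ?_
  rw [companionFlow_apply]
  have h4 : (if h : (j : ℕ) + 1 < k + 1 then
        t ^ (j + 1 : ℕ) • P ((M ^ (j + 1 : ℕ)) (Y (t * σ)))
        else ∑ i : Fin (k + 1), t ^ (k + 1 - i : ℕ) • B i (t ^ (i : ℕ) • P ((M ^ (i : ℕ)) (Y (t * σ)))))
      = t ^ (j + 1 : ℕ) • P ((M ^ (j + 1 : ℕ)) (Y (t * σ))) := by
    split_ifs with h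
    · rfl
    · have hj : (j : ℕ) = k := by omega
      rw [hj, hB, Finset.smul_sum]
      refine Finset.sum_congr rfl fun i _ => ?_
      rw [map_smul, smul_smul, ← pow_add]
      congr 2
      omega
  rw [h4]
  have h3 : (M ^ (j : ℕ)) (M (Y (t * σ))) = (M ^ (j + 1 : ℕ)) (Y (t * σ)) := by
    rw [pow_succ]; rfl
  simp only [map_smul, map_add, h3, Fin.val_zero, pow_zero, one_smul, one_apply_eq_self]
  module

/-- The powers of `t` sit in the initial state of the companion system, so a constant uniform in `t`
produces the weights `t^(2j)`. -/
theorem exists_le_integral_rescaled [FiniteDimensional ℝ V]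
    (hB : ∀ x, P ((M ^ (k + 1)) x) = ∑ i : Fin (k + 1), B i (P ((M ^ (i : ℕ)) x))) :
    ∃ δ : ℝ, 0 < δ ∧ ∀ t ∈ Set.Icc (0 : ℝ) 1, ∀ Y : ℝ → V,
      (∀ s, HasDerivAt Y ((-2 : ℝ) • (M (Y s) + G (P (Y s)))) s) →
      δ * ∑ j ∈ Finset.range (k + 1), t ^ (2 * j) * ‖P ((M ^ j) (Y 0))‖ ^ 2
        ≤ ∫ σ in (0 : ℝ)..1, ‖P (Y (t * σ))‖ ^ 2 := by
  obtain ⟨δ, hδ, h⟩ := exists_observability (companionFlow P M G k B) continuous_companionFlow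
    (ContinuousLinearMap.proj (R := ℝ) (φ := fun _ : Fin (k + 1) => V) 0)
    fun t _ W hW => eq_zero_of_companionFlow_pow t W hW
  -- The state space carries the sup norm, so the sum of the `k + 1` squares is at most `k + 1`
  -- times the square of the norm.
  refine ⟨δ / (k + 1), by positivity, fun t ht Y hY => ?_⟩
  have h1 := h t ht _ (hasDerivAt_companion hB hY t)
  simp only [ContinuousLinearMap.proj_apply, Fin.val_zero, pow_zero, one_smul,
    one_apply_eq_self, mul_zero] at h1
  refine le_trans ?_ h1
  set N := ‖fun j : Fin (k + 1) => t ^ (j : ℕ) • P ((M ^ (j : ℕ)) (Y 0))‖ with hN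
  have h2 : ∑ j ∈ Finset.range (k + 1), t ^ (2 * j) * ‖P ((M ^ j) (Y 0))‖ ^ 2
      ≤ ∑ j ∈ Finset.range (k + 1), N ^ 2 := by
    refine Finset.sum_le_sum fun j hj => ?_
    have h3 := norm_le_pi_norm (fun j : Fin (k + 1) => t ^ (j : ℕ) • P ((M ^ (j : ℕ)) (Y 0)))
      ⟨j, Finset.mem_range.1 hj⟩
    rw [norm_smul, Real.norm_of_nonneg (pow_nonneg ht.1 _)] at h3
    calc t ^ (2 * j) * ‖P ((M ^ j) (Y 0))‖ ^ 2 = (t ^ j * ‖P ((M ^ j) (Y 0))‖) ^ 2 := by ring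
      _ ≤ N ^ 2 := pow_le_pow_left₀ (mul_nonneg (pow_nonneg ht.1 _) (norm_nonneg _)) h3 2
  rw [Finset.sum_const, Finset.card_range, nsmul_eq_mul] at h2
  calc _ ≤ δ / (k + 1) * (((k + 1 : ℕ) : ℝ) * N ^ 2) :=
        mul_le_mul_of_nonneg_left h2 (by positivity)
    _ = δ * N ^ 2 := by push_cast; field_simp

end CompanionFlow

/-! ### The structural index -/

/-- By Cayley–Hamilton every power of `Im F` is a combination of those of exponent less than `2n`.
-/
theorem structuralIndex_le {n : ℕ} (hn : 1 ≤ n) (q : QuadraticMap ℝ (Phase n) ℂ) :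
    structuralIndex q ≤ 2 * n - 1 := by
  refine (structuralIndex_isLeast q).2 (le_antisymm (le_iInf₂ fun j _ => iInf_le _ j)
    (le_iInf fun j X hX => ?_))
  rw [show 2 * n - 1 + 1 = 2 * n by omega] at hX
  simp only [Submodule.mem_iInf] at hX
  have hdim : (imF q).charpoly.natDegree = 2 * n := by
    rw [Matrix.charpoly_natDegree_eq_dim, Fintype.card_sum, Fintype.card_fin, two_mul]
  have hdeg : (Polynomial.X ^ j %ₘ (imF q).charpoly).natDegree < 2 * n := by
    rw [← hdim]
    -- The remainder has strictly smaller degree only if the characteristic polynomial is not `1`,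
    -- that is, if `2n > 0`.
    refine Polynomial.natDegree_modByMonic_lt _ (Matrix.charpoly_monic _) fun h => ?_
    rw [h, Polynomial.natDegree_one] at hdim
    omega
  have h : reF q * imF q ^ j = ∑ i ∈ Finset.range (2 * n),
      (Polynomial.X ^ j %ₘ (imF q).charpoly).coeff i • (reF q * imF q ^ i) := by
    rw [Matrix.pow_eq_aeval_mod_charpoly, Polynomial.aeval_eq_sum_range' hdeg, Finset.mul_sum]
    exact Finset.sum_congr rfl fun i _ => by rw [mul_smul_comm]
  rw [kerStep, LinearMap.mem_ker, h, map_sum, LinearMap.sum_apply]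
  refine Finset.sum_eq_zero fun i hi => ?_
  have h1 := hX i hi
  rw [kerStep, LinearMap.mem_ker] at h1
  rw [map_smul, LinearMap.smul_apply, h1, smul_zero]

/-- The real symplectic matrix. -/
def symplJReal (n : ℕ) : Mat n ℝ := Matrix.fromBlocks 0 1 (-1) 0

theorem symplJReal_map (n : ℕ) : (symplJReal n).map Complex.ofReal = symplJ n := by
  rw [symplJReal, symplJ, Matrix.fromBlocks_map, Matrix.map_zero _ Complex.ofReal_zero,
    Matrix.map_one _ Complex.ofReal_zero Complex.ofReal_one]
  congr 1
  ext i j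
  simp [Matrix.one_apply, apply_ite]

theorem symplJReal_mul_self (n : ℕ) : symplJReal n * symplJReal n = -1 := by
  simp [symplJReal, Matrix.fromBlocks_multiply, ← Matrix.fromBlocks_one, Matrix.fromBlocks_neg]

theorem reF_eq {n : ℕ} (q : QuadraticMap ℝ (Phase n) ℂ) :
    reF q = symplJReal n * (formMatrix q).map Complex.re := by
  ext i j
  simp [reF, hamiltonMap, ← symplJReal_map, Matrix.mul_apply, Complex.re_sum,
    -Fintype.sum_sum_type]

theorem imF_eq {n : ℕ} (q : QuadraticMap ℝ (Phase n) ℂ) :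
    imF q = symplJReal n * (formMatrix q).map Complex.im := by
  ext i j
  simp [imF, hamiltonMap, ← symplJReal_map, Matrix.mul_apply, Complex.im_sum,
    -Fintype.sum_sum_type]

/-- `J` is invertible and `Pᵀ P` has the same kernel as `P`. -/
theorem mem_kerStep_iff {n : ℕ} {q : QuadraticMap ℝ (Phase n) ℂ} {P : Mat n ℝ}
    (hP : (formMatrix q).map Complex.re = Pᵀ * P) (j : ℕ) (X : Phase n) :
    X ∈ kerStep q j ↔ (P * imF q ^ j) *ᵥ X = 0 := by
  rw [kerStep, LinearMap.mem_ker, Matrix.toLin'_apply, reF_eq, hP, ← Matrix.mulVec_mulVec,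
    ← Matrix.mulVec_mulVec, ← Matrix.mulVec_mulVec]
  constructor
  · intro h
    have h1 := congrArg (fun v => symplJReal n *ᵥ v) h
    simp only [Matrix.mulVec_mulVec, ← Matrix.mul_assoc, symplJReal_mul_self, Matrix.mulVec_zero]
      at h1
    rw [Matrix.neg_mul, Matrix.one_mul, Matrix.neg_mul, Matrix.neg_mul, Matrix.neg_mulVec,
      neg_eq_zero, ← Matrix.mulVec_mulVec, ← Matrix.conjTranspose_eq_transpose_of_trivial,
      Matrix.conjTranspose_mul_self_mulVec_eq_zero,
      Matrix.mulVec_mulVec] at h1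
    exact h1
  · intro h
    rw [← Matrix.mulVec_mulVec] at h
    rw [h, Matrix.mulVec_zero, Matrix.mulVec_zero]

/-- The first `k₀ + 1` kernels already cut out the singular space, which lies in the next kernel.
This is the input that closes the companion system at level `k₀`. -/
theorem mulVec_imF_pow_succ_eq_zero {n : ℕ} {q : QuadraticMap ℝ (Phase n) ℂ} {P : Mat n ℝ}
    (hP : (formMatrix q).map Complex.re = Pᵀ * P) (X : Phase n)
    (h : ∀ i < structuralIndex q + 1, (P * imF q ^ i) *ᵥ X = 0) :
    (P * imF q ^ (structuralIndex q + 1)) *ᵥ X = 0 := by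
  rw [← mem_kerStep_iff hP]
  have h1 : X ∈ singularSpace q := by
    rw [(structuralIndex_isLeast q).1]
    simp only [Submodule.mem_iInf]
    exact fun i hi => (mem_kerStep_iff hP i X).2 (h i (Finset.mem_range.1 hi))
  exact (Submodule.mem_iInf _).1 h1 _

/-! ### Lower bound for the dissipated energy -/

/-- Multiplication by a complex matrix, as a real-linear map. -/
def mulVecCLM {ι : Type*} [Fintype ι] (M : Matrix ι ι ℂ) : (ι → ℂ) →L[ℝ] (ι → ℂ) :=
  LinearMap.toContinuousLinearMap (M.mulVecLin.restrictScalars ℝ)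

@[simp]
theorem mulVecCLM_apply {ι : Type*} [Fintype ι] (M : Matrix ι ι ℂ) (Y : ι → ℂ) :
    mulVecCLM M Y = M *ᵥ Y := rfl

theorem mulVecCLM_pow_apply {ι : Type*} [Fintype ι] [DecidableEq ι] (M : Matrix ι ι ℂ) (j : ℕ)
    (Y : ι → ℂ) : (mulVecCLM M ^ j) Y = (M ^ j) *ᵥ Y := by
  induction j generalizing Y with
  | zero => simp
  | succ j ih => rw [pow_succ, mul_apply_eq_comp, ih, pow_succ, ← Matrix.mulVec_mulVec]; rfl

theorem map_ofReal_mulVec {ι : Type*} [Fintype ι] (M : Matrix ι ι ℝ) (Y : ι → ℂ) :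
    M.map Complex.ofReal *ᵥ Y = fun i =>
      (((M *ᵥ fun i => (Y i).re) i : ℝ) : ℂ) + ((M *ᵥ fun i => (Y i).im) i : ℝ) * Complex.I := by
  ext i
  apply Complex.ext <;>
  simp [Matrix.mulVec, dotProduct, Complex.re_sum, Complex.im_sum]

theorem map_ofReal_mulVec_eq_zero_iff {ι : Type*} [Fintype ι] (M : Matrix ι ι ℝ) (Y : ι → ℂ) :
    M.map Complex.ofReal *ᵥ Y = 0
      ↔ (M *ᵥ fun i => (Y i).re) = 0 ∧ (M *ᵥ fun i => (Y i).im) = 0 := by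
  simp only [map_ofReal_mulVec, funext_iff, Pi.zero_apply, Complex.ext_iff]
  simp [forall_and]

theorem map_ofReal_mul_pow {ι : Type*} [Fintype ι] [DecidableEq ι] (P M : Matrix ι ι ℝ) (j : ℕ) :
    (P * M ^ j).map Complex.ofReal = P.map Complex.ofReal * M.map Complex.ofReal ^ j := by
  have h1 := Matrix.map_mul (f := Complex.ofRealHom) (L := P) (M := M ^ j)
  have h2 := map_pow (Complex.ofRealHom.mapMatrix (m := ι)) M j
  exact h1.trans (congrArg (fun N => P.map Complex.ofReal * N) h2)

theorem conjTranspose_formMatrix_eq {n : ℕ} {q : QuadraticMap ℝ (Phase n) ℂ} {P : Mat n ℝ}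
    (hP : (formMatrix q).map Complex.re = Pᵀ * P) :
    (formMatrix q)ᴴ = Pᵀ.map Complex.ofReal * P.map Complex.ofReal
      - Complex.I • ((formMatrix q).map Complex.im).map Complex.ofReal := by
  have h1 : Pᵀ.map Complex.ofReal * P.map Complex.ofReal
      = ((formMatrix q).map Complex.re).map Complex.ofReal := by
    rw [hP]
    exact (Matrix.map_mul (f := Complex.ofRealHom)).symm
  rw [h1]
  ext i j
  rw [Matrix.conjTranspose_apply, (formMatrix_isSymm q).apply]
  apply Complex.ext <;> simp

/-- As `Q̄ = PᵀP - i Im Q`, the real part of the form acts on the state only through the output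
`PY`, so it does not affect observability; the remaining drift is `Im F`. -/
theorem symplJ_mul_conjTranspose_formMatrix {n : ℕ} {q : QuadraticMap ℝ (Phase n) ℂ} {P : Mat n ℝ}
    (hP : (formMatrix q).map Complex.re = Pᵀ * P) (Y : Fin n ⊕ Fin n → ℂ) :
    (-2 * Complex.I) • (symplJ n *ᵥ (formMatrix q)ᴴ *ᵥ Y)
      = (-2 : ℝ) • ((imF q).map Complex.ofReal *ᵥ Y
        + (Complex.I • (symplJ n * Pᵀ.map Complex.ofReal)) *ᵥ P.map Complex.ofReal *ᵥ Y) := by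
  have h1 : (imF q).map Complex.ofReal
      = symplJ n * ((formMatrix q).map Complex.im).map Complex.ofReal := by
    rw [imF_eq, ← symplJReal_map]
    exact Matrix.map_mul (f := Complex.ofRealHom)
  rw [conjTranspose_formMatrix_eq hP, h1]
  simp only [Matrix.sub_mulVec, Matrix.smul_mulVec, Matrix.mulVec_sub, Matrix.mulVec_smul,
    ← Matrix.mulVec_mulVec]
  ext i
  simp only [Pi.smul_apply, Pi.add_apply, Pi.sub_apply, smul_eq_mul, Complex.real_smul]
  push_cast
  linear_combination (2 * (symplJ n *ᵥ (((formMatrix q).map Complex.im).map Complex.ofReal) *ᵥ Y) i)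
    * Complex.I_mul_I

theorem norm_sq_le_normSq {ι : Type*} [Fintype ι] (Y : ι → ℂ) : ‖Y‖ ^ 2 ≤ normSq Y := by
  rcases isEmpty_or_nonempty ι with h | h
  · simp [normSq, Subsingleton.elim Y 0]
  · obtain ⟨i, hi⟩ := Finite.exists_max fun i => ‖Y i‖
    have h1 : ‖Y‖ ≤ ‖Y i‖ := (pi_norm_le_iff_of_nonneg (norm_nonneg _)).2 hi
    calc ‖Y‖ ^ 2 ≤ ‖Y i‖ ^ 2 := pow_le_pow_left₀ (norm_nonneg _) h1 2
      _ ≤ normSq Y := Finset.single_le_sum (f := fun i => ‖Y i‖ ^ 2)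
        (fun i _ => by positivity) (Finset.mem_univ i)

theorem normSq_le_card_mul {ι : Type*} [Fintype ι] (Y : ι → ℂ) :
    normSq Y ≤ Fintype.card ι * ‖Y‖ ^ 2 := by
  have h := Finset.sum_le_sum (s := Finset.univ) (f := fun i => ‖Y i‖ ^ 2)
    (g := fun _ => ‖Y‖ ^ 2) fun i _ =>
      pow_le_pow_left₀ (norm_nonneg _) (norm_le_pi_norm Y i) 2
  simpa [normSq] using h

theorem re_apply_mulVec_pow_eq {n : ℕ} {q : QuadraticMap ℝ (Phase n) ℂ} {P : Mat n ℝ}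
    (hP : (formMatrix q).map Complex.re = Pᵀ * P) (X : Phase n) (j : ℕ) :
    (q ((imF q ^ j) *ᵥ X)).re
      = normSq (P.map Complex.ofReal *ᵥ (imF q).map Complex.ofReal ^ j *ᵥ rvec X) := by
  rw [re_apply_eq_of_re_formMatrix_eq hP, Matrix.mulVec_mulVec, Matrix.mulVec_mulVec,
    ← map_ofReal_mul_pow, map_ofReal_mulVec]
  simp only [rvec, Complex.ofReal_re, Complex.ofReal_im, normSq]
  refine Finset.sum_congr rfl fun i _ => ?_
  have h0 : (P * imF q ^ j) *ᵥ (fun _ : Fin n ⊕ Fin n => (0 : ℝ)) = 0 := Matrix.mulVec_zero _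
  simp [h0]

theorem exists_le_integral_energy {n : ℕ} {q : QuadraticMap ℝ (Phase n) ℂ}
    (hq : ∀ X, 0 ≤ (q X).re) :
    ∃ δ : ℝ, 0 < δ ∧ ∀ t ∈ Set.Icc (0 : ℝ) 1, ∀ X : Phase n,
      t * (δ * ∑ j ∈ Finset.range (structuralIndex q + 1),
          t ^ (2 * j) * (q ((imF q ^ j) *ᵥ X)).re)
        ≤ ∫ s in (0 : ℝ)..t, (star (hflow (formMatrix q)ᴴ s *ᵥ rvec X) ⬝ᵥ
            formMatrix q *ᵥ hflow (formMatrix q)ᴴ s *ᵥ rvec X).re := by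
  obtain ⟨P, hP⟩ := exists_re_formMatrix_eq hq
  set Pc := P.map Complex.ofReal with hPc
  set Mc := (imF q).map Complex.ofReal with hMc
  set L : ℕ → (Fin n ⊕ Fin n → ℂ) →L[ℝ] (Fin n ⊕ Fin n → ℂ) :=
    fun i => mulVecCLM Pc ∘L mulVecCLM Mc ^ i with hL
  have hL0 : ∀ (i : ℕ) Y, L i Y = 0 ↔ ((P * imF q ^ i) *ᵥ fun i => (Y i).re) = 0
      ∧ ((P * imF q ^ i) *ᵥ fun i => (Y i).im) = 0 := fun i Y => by
    rw [← map_ofReal_mulVec_eq_zero_iff, map_ofReal_mul_pow, ← Matrix.mulVec_mulVec,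
      ← mulVecCLM_pow_apply]
    rfl
  -- The kernel relation is real, and is applied to the real and imaginary parts of a complex state
  -- separately.
  obtain ⟨B, hB⟩ := exists_linearMap_comp_eq
    (fun i : Fin (structuralIndex q + 1) => (L i).toLinearMap) (L (structuralIndex q + 1)).toLinearMap
    fun Y hY => (hL0 _ Y).2
      ⟨mulVec_imF_pow_succ_eq_zero hP _ fun i hi => ((hL0 i Y).1 (hY ⟨i, hi⟩)).1,
        mulVec_imF_pow_succ_eq_zero hP _ fun i hi => ((hL0 i Y).1 (hY ⟨i, hi⟩)).2⟩
  obtain ⟨δ, hδ, h⟩ := exists_le_integral_rescaled (P := mulVecCLM Pc) (M := mulVecCLM Mc)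
    (G := mulVecCLM (Complex.I • (symplJ n * Pᵀ.map Complex.ofReal)))
    (B := fun i => LinearMap.toContinuousLinearMap (B i)) hB
  -- `D` is the cost of comparing the Euclidean norm with the sup norm; `D + 1` keeps the
  -- denominator positive also in dimension `0`.
  set D : ℝ := ((Fintype.card (Fin n ⊕ Fin n) : ℕ) : ℝ) with hD
  have hD0 : 0 ≤ D := Nat.cast_nonneg _
  refine ⟨δ / (D + 1), by positivity, fun t ht X => ?_⟩
  set Y : ℝ → Fin n ⊕ Fin n → ℂ := fun s => hflow (formMatrix q)ᴴ s *ᵥ rvec X with hYdef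
  have hYd : ∀ s, HasDerivAt Y ((-2 : ℝ) • (mulVecCLM Mc (Y s)
      + mulVecCLM (Complex.I • (symplJ n * Pᵀ.map Complex.ofReal)) (mulVecCLM Pc (Y s)))) s :=
    fun s => (hasDerivAt_hflow_mulVec (formMatrix q)ᴴ (rvec X) s).congr_deriv
      (symplJ_mul_conjTranspose_formMatrix hP (Y s))
  have h1 := h t ht Y hYd
  have hY0 : Y 0 = rvec X := by simp [hYdef, hflow_zero]
  have hYc : Continuous Y := continuous_iff_continuousAt.2 fun s => (hYd s).continuousAt
  have hrho : ∀ s, (star (Y s) ⬝ᵥ formMatrix q *ᵥ Y s).re = normSq (Pc *ᵥ Y s) :=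
    fun s => re_star_dotProduct_eq_normSq hP (Y s)
  -- The substitution `s = tσ` releases the factor `t` that is cancelled in the final comparison.
  have hsub : ∫ s in (0 : ℝ)..t, (star (Y s) ⬝ᵥ formMatrix q *ᵥ Y s).re
      = t * ∫ σ in (0 : ℝ)..1, normSq (Pc *ᵥ Y (t * σ)) := by
    have h2 := intervalIntegral.smul_integral_comp_mul_left (a := (0 : ℝ)) (b := 1)
      (fun s => (star (Y s) ⬝ᵥ formMatrix q *ᵥ Y s).re) t
    rw [mul_zero, mul_one, smul_eq_mul] at h2
    rw [← h2]
    simp only [hrho]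
  change _ ≤ ∫ s in (0 : ℝ)..t, (star (Y s) ⬝ᵥ formMatrix q *ᵥ Y s).re
  rw [hsub]
  refine mul_le_mul_of_nonneg_left ?_ ht.1
  have h3 : ∑ j ∈ Finset.range (structuralIndex q + 1), t ^ (2 * j) * (q ((imF q ^ j) *ᵥ X)).re
      ≤ (D + 1) * ∑ j ∈ Finset.range (structuralIndex q + 1),
        t ^ (2 * j) * ‖mulVecCLM Pc ((mulVecCLM Mc ^ j) (Y 0))‖ ^ 2 := by
    rw [Finset.mul_sum]
    refine Finset.sum_le_sum fun j _ => ?_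
    rw [re_apply_mulVec_pow_eq hP, mulVecCLM_pow_apply, mulVecCLM_apply, hY0, mul_left_comm]
    refine mul_le_mul_of_nonneg_left ((normSq_le_card_mul _).trans ?_) (pow_nonneg ht.1 _)
    exact mul_le_mul_of_nonneg_right (le_add_of_nonneg_right zero_le_one) (by positivity)
  have hPY : Continuous fun σ => mulVecCLM Pc (Y (t * σ)) :=
    (mulVecCLM Pc).continuous.comp (hYc.comp (continuous_const.mul continuous_id))
  have hns : Continuous fun σ => normSq (Pc *ᵥ Y (t * σ)) :=
    continuous_finsetSum Finset.univ (f := fun i σ => ‖(mulVecCLM Pc (Y (t * σ))) i‖ ^ 2)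
      fun i _ => (((continuous_apply i).comp hPY).norm).pow 2
  calc _ ≤ δ / (D + 1) * ((D + 1) * ∑ j ∈ Finset.range (structuralIndex q + 1),
        t ^ (2 * j) * ‖mulVecCLM Pc ((mulVecCLM Mc ^ j) (Y 0))‖ ^ 2) :=
        mul_le_mul_of_nonneg_left h3 (by positivity)
    _ = δ * ∑ j ∈ Finset.range (structuralIndex q + 1),
        t ^ (2 * j) * ‖mulVecCLM Pc ((mulVecCLM Mc ^ j) (Y 0))‖ ^ 2 := by field_simp
    _ ≤ _ := h1
    _ ≤ _ := intervalIntegral.integral_mono_on zero_le_one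
        ((hPY.norm.pow 2).intervalIntegrable _ _) (hns.intervalIntegrable _ _)
        fun σ _ => norm_sq_le_normSq _

/-! ### Upper bound for the dissipated energy of a non-negative form -/

theorem isAccretive_formMatrix_toComplexForm {n : ℕ} {a : QuadraticForm ℝ (Phase n)}
    (ha : ∀ X, 0 ≤ a X) : IsAccretive (formMatrix (toComplexForm a)) :=
  isAccretive_formMatrix fun X => by simpa [toComplexForm] using ha X

/-- The exponential bound on the density is used with `s ≤ t ≤ 1`, so that its constant depends on
`K` only. -/
theorem integral_energy_le {n : ℕ} {a : QuadraticForm ℝ (Phase n)} (ha : ∀ X, 0 ≤ a X) {K : ℝ}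
    (hK0 : 0 ≤ K) (hK : ∑ i, a (Pi.single i 1) ≤ K) {t : ℝ} (ht0 : 0 ≤ t) (ht1 : t ≤ 1)
    (X : Phase n) :
    ∫ s in (0 : ℝ)..t, (star (hflow (formMatrix (toComplexForm a)) s *ᵥ rvec X) ⬝ᵥ
        formMatrix (toComplexForm a) *ᵥ hflow (formMatrix (toComplexForm a)) s *ᵥ rvec X).re
      ≤ t * (Real.exp (4 * K) * a X) := by
  set A := formMatrix (toComplexForm a) with hA
  have hnn : ∀ Y, 0 ≤ (star Y ⬝ᵥ A *ᵥ Y).re := (isAccretive_formMatrix_toComplexForm ha).nonneg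
  have hstar : star (rvec X) = rvec X := by ext i; simp [rvec]
  have hX : (star (rvec X) ⬝ᵥ A *ᵥ rvec X).re = a X := by
    rw [hstar, rvec_dotProduct_formMatrix_mulVec_self]
    simp [toComplexForm]
  have h1 : ∀ s ∈ Set.Icc 0 t, (star (hflow A s *ᵥ rvec X) ⬝ᵥ A *ᵥ hflow A s *ᵥ rvec X).re
      ≤ Real.exp (4 * K) * a X := fun s hs => by
    have h2 := energy_le_exp_mul (formMatrix_toComplexForm_conjTranspose a)
      (fun Y => (normSq_formMatrix_mulVec_le ha Y).trans
        (mul_le_mul_of_nonneg_right hK (hnn Y))) (rvec X) hs.1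
    rw [← hA, hX] at h2
    refine h2.trans (mul_le_mul_of_nonneg_right (Real.exp_le_exp.2 ?_) (ha X))
    exact mul_le_of_le_one_right (by positivity) (hs.2.trans ht1)
  have h2 := intervalIntegral.integral_mono_on ht0
    ((continuous_re_star_dotProduct_hflow A A (rvec X)).intervalIntegrable 0 t)
    ((continuous_const (y := Real.exp (4 * K) * a X)).intervalIntegrable (μ := volume) 0 t) h1
  rwa [intervalIntegral.integral_const, sub_zero, smul_eq_mul] at h2

/-! ### Comparison of the dissipated energies -/

theorem IsPolarFamily.hflow_mul_hflow_eq {n : ℕ} {q : QuadraticMap ℝ (Phase n) ℂ}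
    {a : ℝ → QuadraticForm ℝ (Phase n)} (ha : IsPolarFamily q a) (hq : ∀ X, 0 ≤ (q X).re) {t : ℝ}
    (ht : 0 ≤ t) :
    hflow (formMatrix q) t * hflow (formMatrix q)ᴴ t
      = hflow (formMatrix (toComplexForm (a t))) t
        * hflow (formMatrix (toComplexForm (a t)))ᴴ t := by
  obtain ⟨S, E, U, hS, hE, hU⟩ := ha.polar
  exact QuadraticSemigroup.hflow_mul_hflow_eq (isAccretive_formMatrix hq)
    (isAccretive_formMatrix_toComplexForm (ha.nonneg t)) hS (hE t ht) ht (hU t ht)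

theorem IsPolarFamily.exists_lower_bound {n : ℕ} {q : QuadraticMap ℝ (Phase n) ℂ}
    {a : ℝ → QuadraticForm ℝ (Phase n)} (ha : IsPolarFamily q a) (hq : ∀ X, 0 ≤ (q X).re) :
    ∃ c : ℝ, 0 < c ∧ ∀ t ∈ Set.Icc (0 : ℝ) (1 / 2), ∀ X : Phase n,
      c * ∑ j ∈ Finset.range (structuralIndex q + 1),
          t ^ (2 * j) * (q ((imF q ^ j) *ᵥ X)).re ≤ a t X := by
  obtain ⟨δ, hδ, hlow⟩ := exists_le_integral_energy hq
  have hac : ∀ X, Continuous fun t => a t X := fun X =>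
    continuousOn_univ.1 (ha.analytic X).continuousOn
  -- The dependence of `a_t` on `t` enters here: continuity, a consequence of analyticity, bounds
  -- the trace of `a_t` uniformly on `[0, 1]`.
  obtain ⟨K, hK⟩ := (isCompact_Icc (a := (0 : ℝ)) (b := 1)).bddAbove_image
    (f := fun t => ∑ i, a t (Pi.single i 1))
    (continuous_finsetSum Finset.univ fun i _ => hac (Pi.single i 1)).continuousOn
  have hK' : ∀ t ∈ Set.Icc (0 : ℝ) 1, ∑ i, a t (Pi.single i 1) ≤ K := fun t ht =>
    hK (Set.mem_image_of_mem _ ht)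
  have hK0 : 0 ≤ K := (Finset.sum_nonneg fun i _ => ha.nonneg 0 _).trans
    (hK' 0 ⟨le_rfl, zero_le_one⟩)
  have hpos : ∀ t ∈ Set.Ioc (0 : ℝ) (1 / 2), ∀ X : Phase n,
      δ * Real.exp (-(4 * K)) * ∑ j ∈ Finset.range (structuralIndex q + 1),
          t ^ (2 * j) * (q ((imF q ^ j) *ᵥ X)).re ≤ a t X := by
    intro t ht X
    have ht1 : t ≤ 1 := ht.2.trans (by norm_num)
    have h1 := hlow t ⟨ht.1.le, ht1⟩ X
    rw [integral_energy_eq (ha.hflow_mul_hflow_eq hq ht.1.le),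
      formMatrix_toComplexForm_conjTranspose] at h1
    have h2 := le_of_mul_le_mul_left (h1.trans (integral_energy_le (ha.nonneg t) hK0
      (hK' t ⟨ht.1.le, ht1⟩) ht.1.le ht1 X)) ht.1
    calc _ = Real.exp (-(4 * K)) * (δ * ∑ j ∈ Finset.range (structuralIndex q + 1),
          t ^ (2 * j) * (q ((imF q ^ j) *ᵥ X)).re) := by ring
      _ ≤ Real.exp (-(4 * K)) * (Real.exp (4 * K) * a t X) :=
        mul_le_mul_of_nonneg_left h2 (Real.exp_pos _).le
      _ = a t X := by rw [← mul_assoc, ← Real.exp_add, neg_add_cancel, Real.exp_zero, one_mul]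
  refine ⟨δ * Real.exp (-(4 * K)), by positivity, fun t ht X => ?_⟩
  -- At `t = 0` the factor `t` cannot be cancelled, and the inequality is obtained as the limit from
  -- the right.
  rcases ht.1.eq_or_lt with rfl | h0
  · have hleft : Continuous fun t : ℝ => δ * Real.exp (-(4 * K)) *
        ∑ j ∈ Finset.range (structuralIndex q + 1), t ^ (2 * j) * (q ((imF q ^ j) *ᵥ X)).re := by
      fun_prop
    refine le_of_tendsto_of_tendsto ((hleft.tendsto 0).mono_left nhdsWithin_le_nhds)
      (((hac X).tendsto 0).mono_left nhdsWithin_le_nhds) (b := 𝓝[>] (0 : ℝ)) ?_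
    filter_upwards [Ioc_mem_nhdsGT (show (0 : ℝ) < 1 / 2 by norm_num)] with s hs
    exact hpos s hs X
  · exact hpos t ⟨h0, ht.2⟩ X

end QuadraticSemigroup

end

theorem mainTheorem2 (n : ℕ) (hn : 1 ≤ n)
    (q : QuadraticMap ℝ (QuadraticSemigroup.Phase n) ℂ) (hq : ∀ X, 0 ≤ (q X).re)
    (a : ℝ → QuadraticForm ℝ (QuadraticSemigroup.Phase n))
    (ha : QuadraticSemigroup.IsPolarFamily q a) :
    QuadraticSemigroup.structuralIndex q ≤ 2 * n - 1 ∧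
    ∃ T c : ℝ, 0 < T ∧ T < 1 ∧ 0 < c ∧
      ∀ t : ℝ, 0 ≤ t → t ≤ T → ∀ X : QuadraticSemigroup.Phase n,
        c * ∑ j ∈ Finset.range (QuadraticSemigroup.structuralIndex q + 1),
            t ^ (2 * j) * (q ((QuadraticSemigroup.imF q ^ j) *ᵥ X)).re ≤ a t X := by
  obtain ⟨c, hc, h⟩ := ha.exists_lower_bound hq
  exact ⟨QuadraticSemigroup.structuralIndex_le hn q, 1 / 2, c, by norm_num, by norm_num, hc,
    fun t ht0 ht1 X => h t ⟨ht0, ht1⟩ X⟩
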